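/- Let $\mathbb F$ be a field of characteristic $0$, let $n>1$ and $1\le n_1\le n_2\le n$ be integers, and put $J_1=\{1,\dots,n_1\}$, $J_2=\{n_1+1,\dots,n_2\}$, $J_3=\{n_2+1,\dots,n\}$. Let $\mathscr A=\mathbb F[x_1,\dots,x_n,y_1,\dots,y_n]$, and let $sl(n)$ act on $\mathscr A$ by the operators obtained from $E_{i,j}\mapsto x_i\partial_{x_j}-y_j\partial_{y_i}$ by the substitutions $\partial_{x_r}\mapsto -x_r,\ x_r\mapsto\partial_{x_r}$ for $r\in J_1$ and $\partial_{y_s}\mapsto -y_s,\ y_s\mapsto\partial_{y_s}$ for $s\in J_3$. Put $$\tilde\Delta=\sum_{i\in J_1}x_i\partial_{y_i}-\sum_{r\in J_2}\partial_{x_r}\partial_{y_r}+\sum_{s\in J_3}y_s\partial_{x_s}.$$ Give the variables $x_i$ $(i\in J_1)$ and $y_s$ $(s\in J_3)$ degree $-1$ and all other variables degree $1$. For $\ell_1,\ell_2\in\mathbb Z$ let $\mathscr A_{\langle\ell_1,\ell_2\rangle}$ be the space of polynomials that are homogeneous of degree $\ell_1$ in the $x$'s and of degree $\ell_2$ in the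 $y$'s, and let $\mathscr H_{\langle\ell_1,\ell_2\rangle}=\{f\in\mathscr A_{\langle\ell_1,\ell_2\rangle}:\tilde\Delta(f)=0\}$, an $sl(n)$-submodule of $\mathscr A$. For a Lie algebra $\mathfrak g$ over $\mathbb F$, a $\mathfrak g$-module $M$ and a finite-dimensional subspace $M_0\subseteq M$ with $U(\mathfrak g)(M_0)=M$, put $M_k=U_k(\mathfrak g)(M_0)$, where $U_k(\mathfrak g)=\mathbb F+\mathfrak g+\dots+\mathfrak g^k$, and $M_{-1}=0$. Let $\operatorname{gr}(M;M_0)=\bigoplus_{k\ge0}M_k/M_{k-1}$ be the associated graded $S(\mathfrak g)$-module. The Hilbert series $\mathfrak s_M(t)$ of the associated variety of $M$ is the Hilbert series of the graded ring $S(\mathfrak g)/\sqrt{\operatorname{Ann}_{S(\mathfrak g)}\operatorname{gr}(M;M_0)}$. Suppose that $M=\mathscr H_{\langle\ell_1,\ell_2\rangle}$ is an irreducible $sl(n)$-module. Then the following hold for every $M_0$ as above, where $\binom ar=\frac{a(a-1)\cdots(a-r+1)}{r!}$ for all integers $a$ and all $r\ge 0$, and $\binom ar=0$ for $r<0$. (1)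 If $n_2<n$, and $\ell_1\le 0$ or $\ell_2\le0$, then $$\mathfrak s_M(t)=\frac{\displaystyle\sum_{r,s=0}^{\infty}\begin{vmatrix}\binom{n_2-2}{r}\binom{n-n_2-1}{r}&\binom{n_2-2}{r-1}\binom{n-n_2}{r}\\[4pt] \binom{n_1-1}{s+1}\binom{n-n_1-2}{s}&\binom{n_1-1}{s}\binom{n-n_1-1}{s}\end{vmatrix}\,t^{r+s}}{(1-t)^{2n-3}}.$$ (2) If $n_1<n_2=n$, then $$\mathfrak s_M(t)=\frac{\displaystyle\sum_{r=0}^{\infty}\binom{n-n_1-1}{r}\binom{n_1-1}{r}t^r}{(1-t)^{n-1}}.$$ -/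

import Mathlib

noncomputable section

open MvPolynomial

/-! ### Associated graded modules and associated varieties of Lie modules -/

namespace AssocVar

attribute [local instance 100] LieRing.ofAssociativeRing

variable (F : Type*) (L : Type*) [Field F] [LieRing L] [LieAlgebra F L]

/-- `U_k(L) = F + L + L² + ⋯ + L^k`, the standard filtration of the enveloping algebra. -/
def envFiltration (k : ℕ) : Submodule F (UniversalEnvelopingAlgebra F L) :=
  ⨆ r ∈ Finset.range (k + 1),
    (LinearMap.range (UniversalEnvelopingAlgebra.ι F : L →ₗ⁅F⁆ _).toLinearMap) ^ r

variable (V : Type*) [AddCommGroup V] [Module F V] [LieRingModule L V] [LieModule F L V]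

/-- The action of `U(L)` on an `L`-module `V`. -/
def envAct : UniversalEnvelopingAlgebra F L →ₐ[F] Module.End F V :=
  UniversalEnvelopingAlgebra.lift F (LieModule.toEnd F L V)

variable {V}

/-- `W(V₀)`, the span of all `u v` with `u ∈ W ⊆ U(L)` and `v ∈ V₀`. -/
def envSpan (W : Submodule F (UniversalEnvelopingAlgebra F L)) (V₀ : Submodule F V) :
    Submodule F V :=
  Submodule.map₂ (envAct F L V).toLinearMap W V₀

/-- `V₀` generates `V` as a `U(L)`-module: `U(L)(V₀) = V`. -/
def Generates (V₀ : Submodule F V) : Prop := envSpan F L ⊤ V₀ = ⊤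

/-- The filtration `V_k = U_k(L)(V₀)`. -/
def filt (V₀ : Submodule F V) (k : ℕ) : Submodule F V := envSpan F L (envFiltration F L k) V₀

/-- The preceding step `V_{k-1}` of the filtration, with `V_{-1} = 0`. -/
def filtPrev (V₀ : Submodule F V) : ℕ → Submodule F V
  | 0 => ⊥
  | k + 1 => filt F L V₀ k

/-- The graded piece `V_k / V_{k-1}`. -/
abbrev GrPiece (V₀ : Submodule F V) (k : ℕ) : Type _ :=
  filt F L V₀ k ⧸ (filtPrev F L V₀ k).submoduleOf (filt F L V₀ k)

/-- The associated graded module `⨁ V_k / V_{k-1}`. -/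
abbrev Gr (V₀ : Submodule F V) : Type _ := DirectSum ℕ (GrPiece F L V₀)

variable {F L}

lemma envFiltration_step (ξ : L) (k : ℕ) {u : UniversalEnvelopingAlgebra F L}
    (hu : u ∈ envFiltration F L k) :
    UniversalEnvelopingAlgebra.ι F ξ * u ∈ envFiltration F L (k + 1) := by
  have hle : envFiltration F L k ≤
      (envFiltration F L (k + 1)).comap
        (LinearMap.mulLeft F (UniversalEnvelopingAlgebra.ι F ξ)) := by
    refine iSup₂_le fun r hr u hu => ?_
    have h1 : r + 1 ∈ Finset.range (k + 1 + 1) := by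
      simpa using Finset.mem_range.mp hr
    refine (le_iSup₂_of_le (f := fun r (_ : r ∈ Finset.range (k + 1 + 1)) =>
      (LinearMap.range (UniversalEnvelopingAlgebra.ι F : L →ₗ⁅F⁆ _).toLinearMap) ^ r)
      (r + 1) h1 le_rfl) ?_
    rw [pow_succ']
    exact Submodule.mul_mem_mul ⟨ξ, rfl⟩ hu
  exact hle hu

lemma filt_step (V₀ : Submodule F V) (ξ : L) (k : ℕ) {v : V} (hv : v ∈ filt F L V₀ k) :
    ⁅ξ, v⁆ ∈ filt F L V₀ (k + 1) := by
  have hle : filt F L V₀ k ≤ (filt F L V₀ (k + 1)).comap (LieModule.toEnd F L V ξ) := by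
    refine Submodule.map₂_le.mpr fun u hu m hm => ?_
    have : (LieModule.toEnd F L V ξ) ((envAct F L V).toLinearMap u m)
        = (envAct F L V).toLinearMap (UniversalEnvelopingAlgebra.ι F ξ * u) m := by
      simp only [AlgHom.toLinearMap_apply, map_mul, Module.End.mul_apply]
      rw [envAct, UniversalEnvelopingAlgebra.lift_ι_apply]
    rw [Submodule.mem_comap, this]
    exact Submodule.apply_mem_map₂ _ (envFiltration_step ξ k hu) hm
  exact hle hv

lemma filtPrev_step (V₀ : Submodule F V) (ξ : L) (k : ℕ) {v : V}
    (hv : v ∈ filtPrev F L V₀ k) : ⁅ξ, v⁆ ∈ filt F L V₀ k := by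
  cases k with
  | zero =>
    have h0 : v = 0 := by simpa [filtPrev] using hv
    simp [h0]
  | succ k => exact filt_step V₀ ξ k hv

/-- The map `V_k → V_{k+1}` given by an element of `L`. -/
def stepMap (V₀ : Submodule F V) (ξ : L) (k : ℕ) :
    filt F L V₀ k →ₗ[F] filt F L V₀ (k + 1) :=
  (LieModule.toEnd F L V ξ).restrict fun _ hv => filt_step V₀ ξ k hv

/-- The map `V_k / V_{k-1} → V_{k+1} / V_k` induced by an element of `L`. -/
def grStep (V₀ : Submodule F V) (ξ : L) (k : ℕ) :
    GrPiece F L V₀ k →ₗ[F] GrPiece F L V₀ (k + 1) :=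
  Submodule.mapQ _ _ (stepMap V₀ ξ k) fun _ hv => filtPrev_step V₀ ξ k hv

lemma grStep_mk (V₀ : Submodule F V) (ξ : L) (k : ℕ) (v : filt F L V₀ k) :
    grStep V₀ ξ k (Submodule.Quotient.mk v) = Submodule.Quotient.mk (stepMap V₀ ξ k v) := rfl

/-- The degree one operator on the associated graded module induced by an element of `L`. -/
def grOp (V₀ : Submodule F V) : L →ₗ[F] Module.End F (Gr F L V₀) where
  toFun ξ := DirectSum.toModule F ℕ _ fun k =>
    DirectSum.lof F ℕ (GrPiece F L V₀) (k + 1) ∘ₗ grStep V₀ ξ k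
  map_add' ξ η := by
    refine DirectSum.linearMap_ext F fun k => ?_
    refine LinearMap.ext fun v => ?_
    obtain ⟨v, rfl⟩ := Submodule.Quotient.mk_surjective _ v
    simp only [LinearMap.comp_apply, DirectSum.toModule_lof, LinearMap.add_apply, ← map_add,
      grStep_mk]
    congr 1
    rw [← Submodule.Quotient.mk_add]
    congr 1
    exact Subtype.ext (add_lie ξ η (v : V))
  map_smul' c ξ := by
    refine DirectSum.linearMap_ext F fun k => ?_
    refine LinearMap.ext fun v => ?_
    obtain ⟨v, rfl⟩ := Submodule.Quotient.mk_surjective _ v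
    simp only [LinearMap.comp_apply, DirectSum.toModule_lof, LinearMap.smul_apply, ← map_smul,
      grStep_mk, RingHom.id_apply]
    congr 1
    rw [← Submodule.Quotient.mk_smul]
    congr 1
    exact Subtype.ext (smul_lie c ξ (v : V))

lemma grOp_lof (V₀ : Submodule F V) (ξ : L) (k : ℕ) (v : GrPiece F L V₀ k) :
    grOp V₀ ξ (DirectSum.lof F ℕ _ k v) = DirectSum.lof F ℕ _ (k + 1) (grStep V₀ ξ k v) := by
  simp [grOp]

lemma grOp_comm (V₀ : Submodule F V) (ξ η : L) :
    grOp V₀ ξ * grOp V₀ η = grOp V₀ η * grOp V₀ ξ := by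
  refine DirectSum.linearMap_ext F fun k => ?_
  refine LinearMap.ext fun v => ?_
  obtain ⟨v, rfl⟩ := Submodule.Quotient.mk_surjective _ v
  simp only [LinearMap.comp_apply, Module.End.mul_apply, grOp_lof, grStep_mk]
  congr 1
  rw [Submodule.Quotient.eq]
  have h : ⁅ξ, ⁅η, (v : V)⁆⁆ - ⁅η, ⁅ξ, (v : V)⁆⁆ = ⁅⁅ξ, η⁆, (v : V)⁆ := (lie_lie ξ η (v : V)).symm
  change ⁅ξ, ⁅η, (v : V)⁆⁆ - ⁅η, ⁅ξ, (v : V)⁆⁆ ∈ filt F L V₀ (k + 1)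
  rw [h]
  exact filt_step V₀ _ k v.2

/-- The action of the symmetric algebra `S(L)` on the associated graded module. -/
def symAct (V₀ : Submodule F V) : SymmetricAlgebra F L →ₐ[F] Module.End F (Gr F L V₀) :=
  RingCon.liftₐ (TensorAlgebra.symRingCon F L) (TensorAlgebra.lift F (grOp V₀)) <| by
    refine RingCon.ringConGen_le.2 fun x y h => ?_
    induction h with
    | mul_comm x y =>
      rw [RingCon.ker_apply]
      simp only [AlgHom.toRingHom_eq_coe, map_mul, RingHom.coe_coe, TensorAlgebra.lift_ι_apply]
      exact grOp_comm V₀ x y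

lemma symAct_ι (V₀ : Submodule F V) (ξ : L) :
    symAct V₀ (SymmetricAlgebra.ι F L ξ) = grOp V₀ ξ :=
  TensorAlgebra.lift_ι_apply (grOp V₀) ξ

/-- The annihilator in `S(L)` of the associated graded module. -/
def annGr (V₀ : Submodule F V) : Ideal (SymmetricAlgebra F L) := RingHom.ker (symAct V₀)

variable (F L) in
/-- The degree `k` component `S^k(L)` of the symmetric algebra. -/
def symPiece (k : ℕ) : Submodule F (SymmetricAlgebra F L) :=
  (LinearMap.range (SymmetricAlgebra.ι F L)) ^ k

/-- The Hilbert series of `S(L) / I`: the coefficient of `t^k` is the dimension of the image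
of `S^k(L)` in `S(L) / I`. -/
def quotHilbertSeries (I : Ideal (SymmetricAlgebra F L)) : PowerSeries ℚ :=
  PowerSeries.mk fun k =>
    (Module.finrank F ((symPiece F L k).map (Ideal.Quotient.mkₐ F I).toLinearMap) : ℚ)

/-- The Hilbert series of the associated variety of `V`, computed from `V₀`: the Hilbert series
of the coordinate ring `S(L) / √Ann(gr(V; V₀))`. -/
def varHilbertSeries (V₀ : Submodule F V) : PowerSeries ℚ :=
  quotHilbertSeries (annGr (F := F) (L := L) V₀).radical

end AssocVar

/-! ### The oscillator representations of `sl(n)` -/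

namespace Osc

section Weyl

variable {R : Type*} [Ring R] {ι : Type*}

section Twist

variable [DecidableEq ι]

lemma weyl_twist (m d : ι → R)
    (hdm : ∀ i j, d i * m j = m j * d i + if i = j then 1 else 0)
    (hm : ∀ i j, m i * m j = m j * m i) (hd : ∀ i j, d i * d j = d j * d i)
    (P : ι → Prop) [DecidablePred P] (i j : ι) :
    (if P i then -m i else d i) * (if P j then d j else m j)
      = (if P j then d j else m j) * (if P i then -m i else d i) + if i = j then 1 else 0 := by
  have h := hdm j i
  have hij : (if j = i then (1 : R) else 0) = if i = j then 1 else 0 := by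
    simp [eq_comm]
  rw [hij] at h
  by_cases hi : P i <;> by_cases hj : P j
  · rw [if_pos hi, if_pos hj, mul_neg, neg_mul, h]
    abel
  · have hne : i ≠ j := fun e => hj (e ▸ hi)
    rw [if_pos hi, if_neg hj, if_neg hne, mul_neg, neg_mul, hm i j, add_zero]
  · have hne : i ≠ j := fun e => hi (e ▸ hj)
    rw [if_neg hi, if_pos hj, if_neg hne, hd i j, add_zero]
  · rw [if_neg hi, if_neg hj, hdm i j]

lemma weyl_twist_comm (m d : ι → R)
    (hdm : ∀ i j, d i * m j = m j * d i + if i = j then 1 else 0)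
    (hm : ∀ i j, m i * m j = m j * m i) (hd : ∀ i j, d i * d j = d j * d i)
    (P : ι → Prop) [DecidablePred P] (i j : ι) :
    Commute (if P i then d i else m i) (if P j then d j else m j) := by
  by_cases hi : P i <;> by_cases hj : P j
  · rw [if_pos hi, if_pos hj]
    exact hd i j
  · have hne : i ≠ j := fun e => hj (e ▸ hi)
    have h := hdm i j
    rw [if_neg hne, add_zero] at h
    rw [if_pos hi, if_neg hj]
    exact h
  · have hne : j ≠ i := fun e => hi (e ▸ hj)
    have h := hdm j i
    rw [if_neg hne, add_zero] at h
    rw [if_neg hi, if_pos hj]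
    exact h.symm
  · rw [if_neg hi, if_neg hj]
    exact hm i j

lemma weyl_twist_comm' (m d : ι → R)
    (hdm : ∀ i j, d i * m j = m j * d i + if i = j then 1 else 0)
    (hm : ∀ i j, m i * m j = m j * m i) (hd : ∀ i j, d i * d j = d j * d i)
    (P : ι → Prop) [DecidablePred P] (i j : ι) :
    Commute (if P i then -m i else d i) (if P j then -m j else d j) := by
  have hmm : ∀ i j, Commute (m i) (m j) := hm
  by_cases hi : P i <;> by_cases hj : P j
  · rw [if_pos hi, if_pos hj]
    exact (hmm i j).neg_left.neg_right
  · have hne : j ≠ i := fun e => hj (e ▸ hi)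
    have h := hdm j i
    rw [if_neg hne, add_zero] at h
    have h' : Commute (d j) (m i) := h
    rw [if_pos hi, if_neg hj]
    exact h'.symm.neg_left
  · have hne : i ≠ j := fun e => hi (e ▸ hj)
    have h := hdm i j
    rw [if_neg hne, add_zero] at h
    have h' : Commute (d i) (m j) := h
    rw [if_neg hi, if_pos hj]
    exact h'.neg_right
  · rw [if_neg hi, if_neg hj]
    exact hd i j

end Twist

variable {F : Type*} [Field F] [Algebra F R] [Fintype ι]

/-- `∑ A_{ij} p_i q_j`. -/
def weylSum (p q : ι → R) (A : Matrix ι ι F) : R := ∑ i, ∑ j, A i j • (p i * q j)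

lemma weylSum_neg (p q : ι → R) (A : Matrix ι ι F) : weylSum p q (-A) = -weylSum p q A := by
  simp [weylSum]

lemma weylSum_mul [DecidableEq ι] (p q : ι → R) (A B : Matrix ι ι F) :
    weylSum p q (A * B) = ∑ i, ∑ j, ∑ k, ∑ l, (A i j * B k l) •
      ((if j = k then (1 : R) else 0) * (p i * q l)) := by
  have h : ∀ i j, ∑ k, ∑ l, (A i j * B k l) • ((if j = k then (1 : R) else 0) * (p i * q l))
      = ∑ l, (A i j * B j l) • (p i * q l) := by
    intro i j
    rw [Finset.sum_comm]
    refine Finset.sum_congr rfl fun l _ => ?_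
    rw [Finset.sum_eq_single j]
    · simp
    · intro k _ hk
      simp [hk.symm]
    · simp
  simp only [h, weylSum, Matrix.mul_apply, Finset.sum_smul]
  refine Finset.sum_congr rfl fun i _ => ?_
  rw [Finset.sum_comm]

lemma weylSum_prod (p q : ι → R) (A B : Matrix ι ι F) :
    weylSum p q A * weylSum p q B
      = ∑ i, ∑ j, ∑ k, ∑ l, (A i j * B k l) • (p i * q j * (p k * q l)) := by
  simp only [weylSum, Finset.sum_mul_sum, smul_mul_smul_comm]
  exact Finset.sum_congr rfl fun i _ => Finset.sum_comm

lemma weylSum_lie [DecidableEq ι] (p q : ι → R)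
    (hqp : ∀ i j, q i * p j = p j * q i + if i = j then 1 else 0)
    (hp : ∀ i j, Commute (p i) (p j)) (hq : ∀ i j, Commute (q i) (q j)) (A B : Matrix ι ι F) :
    weylSum p q A * weylSum p q B - weylSum p q B * weylSum p q A
      = weylSum p q (A * B - B * A) := by
  have key : ∀ A B : Matrix ι ι F, weylSum p q A * weylSum p q B = weylSum p q (A * B)
      + ∑ i, ∑ j, ∑ k, ∑ l, (A i j * B k l) • (p i * p k * (q j * q l)) := by
    intro A B
    rw [weylSum_prod, weylSum_mul]
    simp only [← Finset.sum_add_distrib, ← smul_add]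
    refine Finset.sum_congr rfl fun i _ => Finset.sum_congr rfl fun j _ =>
      Finset.sum_congr rfl fun k _ => Finset.sum_congr rfl fun l _ => ?_
    congr 1
    rw [mul_assoc, ← mul_assoc (q j), hqp j k]
    split_ifs <;> noncomm_ring
  have hsymm : ∑ i, ∑ j, ∑ k, ∑ l, (A i j * B k l) • (p i * p k * (q j * q l))
      = ∑ i, ∑ j, ∑ k, ∑ l, (B i j * A k l) • (p i * p k * (q j * q l)) := by
    calc _ = ∑ i, ∑ k, ∑ j, ∑ l, (A i j * B k l) • (p i * p k * (q j * q l)) :=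
          Finset.sum_congr rfl fun i _ => Finset.sum_comm
      _ = ∑ k, ∑ i, ∑ j, ∑ l, (A i j * B k l) • (p i * p k * (q j * q l)) := Finset.sum_comm
      _ = ∑ k, ∑ i, ∑ l, ∑ j, (A i j * B k l) • (p i * p k * (q j * q l)) :=
          Finset.sum_congr rfl fun k _ => Finset.sum_congr rfl fun i _ => Finset.sum_comm
      _ = ∑ k, ∑ l, ∑ i, ∑ j, (A i j * B k l) • (p i * p k * (q j * q l)) :=
          Finset.sum_congr rfl fun k _ => Finset.sum_comm
      _ = _ := by
          refine Finset.sum_congr rfl fun k _ => Finset.sum_congr rfl fun l _ =>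
            Finset.sum_congr rfl fun i _ => Finset.sum_congr rfl fun j _ => ?_
          rw [mul_comm (A i j), (hp i k).eq, (hq j l).eq]
  have hsub : weylSum p q (A * B - B * A) = weylSum p q (A * B) - weylSum p q (B * A) := by
    simp [weylSum, sub_smul]
  rw [key A B, key B A, hsymm, hsub]
  abel

lemma weyl_aux₁ {d x e b : R} {P : Prop} [Decidable P]
    (hdx : d * x = x * d + if P then 1 else 0) (hde : Commute d e) (hxb : Commute x b)
    (heb : Commute e b) :
    x * e * (d * b) = d * b * (x * e) - if P then e * b else 0 := by
  have h₁ : d * b * (x * e) = d * x * (e * b) := by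
    rw [mul_assoc d b, ← mul_assoc b x e, ← hxb.eq, mul_assoc x b e, ← heb.eq, ← mul_assoc d x]
  have h₂ : x * e * (d * b) = x * d * (e * b) := by
    rw [mul_assoc x e, ← mul_assoc e d b, ← hde.eq, mul_assoc d e b, ← mul_assoc x d]
  rw [h₁, h₂, hdx]
  split_ifs <;> noncomm_ring

lemma weyl_aux₂ {d y e a : R} {P : Prop} [Decidable P]
    (hdy : d * y = y * d + if P then 1 else 0) (hde : Commute d e) (hay : Commute a y)
    (hae : Commute a e) :
    y * e * (a * d) = a * d * (y * e) - if P then a * e else 0 := by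
  have h₁ : a * d * (y * e) = a * (d * y) * e := by noncomm_ring
  have h₂ : y * e * (a * d) = a * (y * d) * e := by
    rw [mul_assoc y e, ← mul_assoc e a d, ← hae.eq, mul_assoc a e d, ← hde.eq, ← mul_assoc y a,
      ← hay.eq]
    noncomm_ring
  rw [h₁, h₂, hdy]
  split_ifs <;> noncomm_ring

lemma neg_neg_mul (a b : R) : -(-a * b) = a * b := by noncomm_ring

lemma neg_mul_neg' (a b : R) : -(a * -b) = a * b := by noncomm_ring

lemma sub_lie_aux {a b c d : R} (h₁ : Commute a d) (h₂ : Commute b c) :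
    a * b - b * a - -(c * d - d * c) = (a - c) * (b - d) - (b - d) * (a - c) := by
  have e₁ := h₁.eq
  have e₂ := h₂.eq
  calc _ = a * b - b * a - -(c * d - d * c) + (d * a - a * d) + (b * c - c * b) := by
        rw [e₁, e₂]; abel
    _ = _ := by noncomm_ring

end Weyl

section Operators

variable (F : Type*) [Field F] (n n₁ n₂ : ℕ)

/-- The polynomial algebra in `x_1, …, x_n` (variables `Sum.inl i`) and `y_1, …, y_n`
(variables `Sum.inr i`). The index `i : Fin n` stands for the index `i + 1`, so that
`J₁ = {i | i < n₁}`, `J₂ = {i | n₁ ≤ i < n₂}` and `J₃ = {i | n₂ ≤ i}`. -/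
abbrev Poly : Type _ := MvPolynomial (Fin n ⊕ Fin n) F

variable {n}

/-- Multiplication by a variable. -/
def mulVar (s : Fin n ⊕ Fin n) : Module.End F (Poly F n) := LinearMap.mulLeft F (X s)

/-- The partial derivative with respect to a variable. -/
def der (s : Fin n ⊕ Fin n) : Module.End F (Poly F n) := (pderiv s).toLinearMap

/-- What becomes of the operator `x_i`: it is replaced by `∂_{x_i}` for `i ∈ J₁`. -/
def opX (i : Fin n) : Module.End F (Poly F n) :=
  if (i : ℕ) < n₁ then der F (.inl i) else mulVar F (.inl i)

/-- What becomes of the operator `∂_{x_i}`: it is replaced by `-x_i` for `i ∈ J₁`. -/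
def opDX (i : Fin n) : Module.End F (Poly F n) :=
  if (i : ℕ) < n₁ then -mulVar F (.inl i) else der F (.inl i)

/-- What becomes of the operator `y_i`: it is replaced by `∂_{y_i}` for `i ∈ J₃`. -/
def opY (i : Fin n) : Module.End F (Poly F n) :=
  if n₂ ≤ (i : ℕ) then der F (.inr i) else mulVar F (.inr i)

/-- What becomes of the operator `∂_{y_i}`: it is replaced by `-y_i` for `i ∈ J₃`. -/
def opDY (i : Fin n) : Module.End F (Poly F n) :=
  if n₂ ≤ (i : ℕ) then -mulVar F (.inr i) else der F (.inr i)

/-- The operator by which `E_{i,j}` acts, the transform of `x_i ∂_{x_j} - y_j ∂_{y_i}`. -/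
def unitOp (i j : Fin n) : Module.End F (Poly F n) :=
  opX F n₁ i * opDX F n₁ j - opY F n₂ j * opDY F n₂ i

variable (n)

/-- The linear map sending a matrix `A = ∑ A_{ij} E_{i,j}` to `∑ A_{ij} E_{i,j}` acting on
polynomials. -/
def matOp : Matrix (Fin n) (Fin n) F →ₗ[F] Module.End F (Poly F n) where
  toFun A := ∑ i, ∑ j, A i j • unitOp F n₁ n₂ i j
  map_add' A B := by simp [add_smul, Finset.sum_add_distrib]
  map_smul' c A := by simp [Finset.smul_sum, mul_smul]

/-- The transformed Laplace operator `Δ̃`, the negative of the transform of `∑ ∂_{x_i} ∂_{y_i}`.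
For `n₁ ≤ n₂` it is
`∑_{i ∈ J₁} x_i ∂_{y_i} - ∑_{i ∈ J₂} ∂_{x_i} ∂_{y_i} + ∑_{i ∈ J₃} y_i ∂_{x_i}`,
see `laplace_eq`. -/
def laplace : Module.End F (Poly F n) := -∑ i : Fin n, opDX F n₁ i * opDY F n₂ i

/-- The `ℤ²`-degrees of the variables: `x_i` has degree `(-1, 0)` for `i ∈ J₁` and `(1, 0)`
otherwise, `y_i` has degree `(0, -1)` for `i ∈ J₃` and `(0, 1)` otherwise. -/
def wt : Fin n ⊕ Fin n → ℤ × ℤ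
  | .inl i => (if (i : ℕ) < n₁ then -1 else 1, 0)
  | .inr i => (0, if n₂ ≤ (i : ℕ) then -1 else 1)

/-- The space `𝒜_⟨ℓ₁,ℓ₂⟩` of polynomials that are homogeneous of degree `(ℓ₁, ℓ₂)`. -/
def homog (ℓ₁ ℓ₂ : ℤ) : Submodule F (Poly F n) :=
  weightedHomogeneousSubmodule F (wt n n₁ n₂) (ℓ₁, ℓ₂)

/-! Weyl relations -/

variable {n}

lemma der_mul (s t : Fin n ⊕ Fin n) :
    der F s * mulVar F t = mulVar F t * der F s + if s = t then 1 else 0 := by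
  refine LinearMap.ext fun f => ?_
  by_cases h : s = t
  · subst h
    simp [der, mulVar, add_comm]
  · have h' : t ≠ s := fun e => h e.symm
    simp [der, mulVar, pderiv_X_of_ne h', h]

lemma mulVar_comm (s t : Fin n ⊕ Fin n) : mulVar F s * mulVar F t = mulVar F t * mulVar F s := by
  refine LinearMap.ext fun f => ?_
  simp [mulVar, mul_left_comm]

lemma der_comm (s t : Fin n ⊕ Fin n) : der F s * der F t = der F t * der F s := by
  have h : ⁅(pderiv s : Derivation F (Poly F n) (Poly F n)),
      (pderiv t : Derivation F (Poly F n) (Poly F n))⁆ = 0 := by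
    refine MvPolynomial.derivation_ext fun i => ?_
    have c : ∀ u v : Fin n ⊕ Fin n, pderiv (R := F) u (pderiv v (X i : Poly F n)) = 0 := by
      intro u v
      by_cases h : i = v
      · rw [h, pderiv_X_self, pderiv_one]
      · rw [pderiv_X_of_ne h, map_zero]
    rw [Derivation.commutator_apply, c, c, sub_zero]
    rfl
  refine LinearMap.ext fun f => ?_
  have := congrArg (fun D : Derivation F (Poly F n) (Poly F n) => D f) h
  simp only [Derivation.commutator_apply, Derivation.zero_apply] at this
  simpa [der] using sub_eq_zero.mp this

lemma opDX_opX (i j : Fin n) :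
    opDX F n₁ i * opX F n₁ j = opX F n₁ j * opDX F n₁ i + if i = j then 1 else 0 :=
  weyl_twist (fun i : Fin n => mulVar F (.inl i)) (fun i => der F (.inl i))
    (fun i j => by simpa using der_mul F (Sum.inl i : Fin n ⊕ Fin n) (Sum.inl j))
    (fun _ _ => mulVar_comm F _ _) (fun _ _ => der_comm F _ _) (fun i => (i : ℕ) < n₁) i j

lemma opDY_opY (i j : Fin n) :
    opDY F n₂ i * opY F n₂ j = opY F n₂ j * opDY F n₂ i + if i = j then 1 else 0 :=
  weyl_twist (fun i : Fin n => mulVar F (.inr i)) (fun i => der F (.inr i))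
    (fun i j => by simpa using der_mul F (Sum.inr i : Fin n ⊕ Fin n) (Sum.inr j))
    (fun _ _ => mulVar_comm F _ _) (fun _ _ => der_comm F _ _) (fun i => n₂ ≤ (i : ℕ)) i j

lemma opX_comm (i j : Fin n) : Commute (opX F n₁ i) (opX F n₁ j) :=
  weyl_twist_comm (fun i : Fin n => mulVar F (.inl i)) (fun i => der F (.inl i))
    (fun i j => by simpa using der_mul F (Sum.inl i : Fin n ⊕ Fin n) (Sum.inl j))
    (fun _ _ => mulVar_comm F _ _) (fun _ _ => der_comm F _ _) (fun i => (i : ℕ) < n₁) i j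

lemma opY_comm (i j : Fin n) : Commute (opY F n₂ i) (opY F n₂ j) :=
  weyl_twist_comm (fun i : Fin n => mulVar F (.inr i)) (fun i => der F (.inr i))
    (fun i j => by simpa using der_mul F (Sum.inr i : Fin n ⊕ Fin n) (Sum.inr j))
    (fun _ _ => mulVar_comm F _ _) (fun _ _ => der_comm F _ _) (fun i => n₂ ≤ (i : ℕ)) i j

lemma opDX_comm (i j : Fin n) : Commute (opDX F n₁ i) (opDX F n₁ j) :=
  weyl_twist_comm' (fun i : Fin n => mulVar F (.inl i)) (fun i => der F (.inl i))
    (fun i j => by simpa using der_mul F (Sum.inl i : Fin n ⊕ Fin n) (Sum.inl j))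
    (fun _ _ => mulVar_comm F _ _) (fun _ _ => der_comm F _ _) (fun i => (i : ℕ) < n₁) i j

lemma opDY_comm (i j : Fin n) : Commute (opDY F n₂ i) (opDY F n₂ j) :=
  weyl_twist_comm' (fun i : Fin n => mulVar F (.inr i)) (fun i => der F (.inr i))
    (fun i j => by simpa using der_mul F (Sum.inr i : Fin n ⊕ Fin n) (Sum.inr j))
    (fun _ _ => mulVar_comm F _ _) (fun _ _ => der_comm F _ _) (fun i => n₂ ≤ (i : ℕ)) i j

lemma der_mul_cross (i j : Fin n) :
    Commute (der F (Sum.inl i : Fin n ⊕ Fin n)) (mulVar F (Sum.inr j)) := by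
  have h := der_mul F (Sum.inl i : Fin n ⊕ Fin n) (Sum.inr j)
  rw [if_neg (by simp), add_zero] at h
  exact h

lemma der_mul_cross' (i j : Fin n) :
    Commute (der F (Sum.inr i : Fin n ⊕ Fin n)) (mulVar F (Sum.inl j)) := by
  have h := der_mul F (Sum.inr i : Fin n ⊕ Fin n) (Sum.inl j)
  rw [if_neg (by simp), add_zero] at h
  exact h

lemma cross_comm (i j : Fin n) :
    Commute (opX F n₁ i) (opY F n₂ j) ∧ Commute (opX F n₁ i) (opDY F n₂ j) ∧
      Commute (opDX F n₁ i) (opY F n₂ j) ∧ Commute (opDX F n₁ i) (opDY F n₂ j) := by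
  have a := der_mul_cross F i j
  have b := (der_mul_cross' F j i).symm
  have c : Commute (der F (Sum.inl i : Fin n ⊕ Fin n)) (der F (Sum.inr j)) := der_comm F _ _
  have d : Commute (mulVar F (Sum.inl i : Fin n ⊕ Fin n)) (mulVar F (Sum.inr j)) :=
    mulVar_comm F _ _
  unfold opX opDX opY opDY
  split_ifs
  · exact ⟨c, a.neg_right, b.neg_left, (d.neg_left).neg_right⟩
  · exact ⟨a, c, d.neg_left, b.neg_left⟩
  · exact ⟨b, d.neg_right, c, a.neg_right⟩
  · exact ⟨d, b, a, c⟩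

lemma matOp_apply (A : Matrix (Fin n) (Fin n) F) :
    matOp F n n₁ n₂ A = weylSum (opX F n₁) (opDX F n₁) A
      - weylSum (opY F n₂) (opDY F n₂) A.transpose := by
  simp only [matOp, LinearMap.coe_mk, AddHom.coe_mk, unitOp, weylSum, smul_sub,
    Finset.sum_sub_distrib, Matrix.transpose_apply]
  congr 1
  rw [Finset.sum_comm]

lemma matOp_lie (A B : Matrix (Fin n) (Fin n) F) :
    matOp F n n₁ n₂ (A * B - B * A)
      = matOp F n n₁ n₂ A * matOp F n n₁ n₂ B - matOp F n n₁ n₂ B * matOp F n n₁ n₂ A := by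
  have hX := weylSum_lie (opX F n₁) (opDX F n₁) (opDX_opX F n₁) (opX_comm F n₁)
    (opDX_comm F n₁) A B
  have hY := weylSum_lie (opY F n₂) (opDY F n₂) (opDY_opY F n₂) (opY_comm F n₂)
    (opDY_comm F n₂) A.transpose B.transpose
  have hc : ∀ A B : Matrix (Fin n) (Fin n) F,
      Commute (weylSum (opX F n₁) (opDX F n₁) A) (weylSum (opY F n₂) (opDY F n₂) B) := by
    intro A B
    refine Commute.sum_left _ _ _ fun i _ => Commute.sum_left _ _ _ fun j _ =>
      Commute.sum_right _ _ _ fun k _ => Commute.sum_right _ _ _ fun l _ => ?_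
    refine Commute.smul_left (Commute.smul_right ?_ _) _
    obtain ⟨h1, h2, -, -⟩ := cross_comm F n₁ n₂ i k
    obtain ⟨-, h2, -, -⟩ := cross_comm F n₁ n₂ i l
    obtain ⟨-, -, h3, -⟩ := cross_comm F n₁ n₂ j k
    obtain ⟨-, -, -, h4⟩ := cross_comm F n₁ n₂ j l
    exact (h1.mul_right h2).mul_left (h3.mul_right h4)
  have h1 := hc A B.transpose
  have h2 := hc B A.transpose
  have hT : (A * B - B * A).transpose
      = -(A.transpose * B.transpose - B.transpose * A.transpose) := by
    simp [Matrix.transpose_sub, Matrix.transpose_mul]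
  rw [matOp_apply, matOp_apply, matOp_apply, hT, weylSum_neg, ← hX, ← hY]
  exact sub_lie_aux h1 h2

lemma laplace_eq (h : n₁ ≤ n₂) : laplace F n n₁ n₂ = ∑ i : Fin n,
    if (i : ℕ) < n₁ then mulVar F (.inl i) * der F (.inr i)
    else if (i : ℕ) < n₂ then -(der F (.inl i) * der F (.inr i))
    else mulVar F (.inr i) * der F (.inl i) := by
  rw [laplace, ← Finset.sum_neg_distrib]
  refine Finset.sum_congr rfl fun i _ => ?_
  unfold opDX opDY
  by_cases h1 : (i : ℕ) < n₁
  · have h2 : ¬ n₂ ≤ (i : ℕ) := by omega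
    rw [if_pos h1, if_pos h1, if_neg h2]
    exact neg_neg_mul _ _
  · by_cases h2 : (i : ℕ) < n₂
    · rw [if_neg h1, if_neg h1, if_pos h2, if_neg (by omega)]
    · rw [if_neg h1, if_neg h1, if_neg h2, if_pos (by omega)]
      exact (neg_mul_neg' _ _).trans (der_mul_cross F i i).eq

lemma unitOp_laplace (i j : Fin n) :
    Commute (unitOp F n₁ n₂ i j) (laplace F n n₁ n₂) := by
  have hx : (opX F n₁ i * opDX F n₁ j) * ∑ k, opDX F n₁ k * opDY F n₂ k
      = (∑ k, opDX F n₁ k * opDY F n₂ k) * (opX F n₁ i * opDX F n₁ j)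
        - opDX F n₁ j * opDY F n₂ i := by
    have h : ∀ k, (opX F n₁ i * opDX F n₁ j) * (opDX F n₁ k * opDY F n₂ k)
        = (opDX F n₁ k * opDY F n₂ k) * (opX F n₁ i * opDX F n₁ j)
          - if k = i then opDX F n₁ j * opDY F n₂ k else 0 := fun k =>
      weyl_aux₁ (opDX_opX F n₁ k i) (opDX_comm F n₁ k j) (cross_comm F n₁ n₂ i k).2.1
        (cross_comm F n₁ n₂ j k).2.2.2
    rw [Finset.mul_sum, Finset.sum_mul, Finset.sum_congr rfl fun k _ => h k,
      Finset.sum_sub_distrib, Finset.sum_ite_eq' Finset.univ i, if_pos (Finset.mem_univ i)]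
  have hy : (opY F n₂ j * opDY F n₂ i) * ∑ k, opDX F n₁ k * opDY F n₂ k
      = (∑ k, opDX F n₁ k * opDY F n₂ k) * (opY F n₂ j * opDY F n₂ i)
        - opDX F n₁ j * opDY F n₂ i := by
    have h : ∀ k, (opY F n₂ j * opDY F n₂ i) * (opDX F n₁ k * opDY F n₂ k)
        = (opDX F n₁ k * opDY F n₂ k) * (opY F n₂ j * opDY F n₂ i)
          - if k = j then opDX F n₁ k * opDY F n₂ i else 0 := fun k =>
      weyl_aux₂ (opDY_opY F n₂ k j) (opDY_comm F n₂ k i) (cross_comm F n₁ n₂ k j).2.2.1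
        (cross_comm F n₁ n₂ k i).2.2.2
    rw [Finset.mul_sum, Finset.sum_mul, Finset.sum_congr rfl fun k _ => h k,
      Finset.sum_sub_distrib, Finset.sum_ite_eq' Finset.univ j, if_pos (Finset.mem_univ j)]
  refine Commute.neg_right (R := Module.End F (Poly F n)) ?_
  rw [commute_iff_eq, unitOp, sub_mul, hx, hy, mul_sub]
  abel

lemma matOp_laplace (A : Matrix (Fin n) (Fin n) F) :
    Commute (matOp F n n₁ n₂ A) (laplace F n n₁ n₂) :=
  Commute.sum_left _ _ _ fun i _ => Commute.sum_left _ _ _ fun j _ =>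
    (unitOp_laplace F n₁ n₂ i j).smul_left _

lemma mulVar_homog (s : Fin n ⊕ Fin n) (d : ℤ × ℤ) {f : Poly F n}
    (hf : IsWeightedHomogeneous (wt n n₁ n₂) f d) :
    IsWeightedHomogeneous (wt n n₁ n₂) (mulVar F s f) (d + wt n n₁ n₂ s) := by
  rw [add_comm]
  exact (isWeightedHomogeneous_X F _ s).mul hf

lemma der_homog (s : Fin n ⊕ Fin n) (d : ℤ × ℤ) {f : Poly F n}
    (hf : IsWeightedHomogeneous (wt n n₁ n₂) f d) :
    IsWeightedHomogeneous (wt n n₁ n₂) (der F s f) (d - wt n n₁ n₂ s) := by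
  intro m hm
  have h : coeff (m + Finsupp.single s 1) f ≠ 0 := by
    intro h0
    apply hm
    change coeff m (pderiv s f) = 0
    rw [coeff_pderiv, h0, zero_mul]
  have h' := hf h
  rw [map_add, Finsupp.weight_single, one_smul] at h'
  exact eq_sub_of_add_eq h'

lemma opX_homog (i : Fin n) (d : ℤ × ℤ) {f : Poly F n}
    (hf : IsWeightedHomogeneous (wt n n₁ n₂) f d) :
    IsWeightedHomogeneous (wt n n₁ n₂) (opX F n₁ i f) (d + (1, 0)) := by
  unfold opX
  split_ifs with h
  · have := der_homog F n₁ n₂ (Sum.inl i) d hf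
    simpa [wt, h, sub_eq_add_neg] using this
  · have := mulVar_homog F n₁ n₂ (Sum.inl i) d hf
    simpa [wt, h] using this

lemma opY_homog (i : Fin n) (d : ℤ × ℤ) {f : Poly F n}
    (hf : IsWeightedHomogeneous (wt n n₁ n₂) f d) :
    IsWeightedHomogeneous (wt n n₁ n₂) (opY F n₂ i f) (d + (0, 1)) := by
  unfold opY
  split_ifs with h
  · have := der_homog F n₁ n₂ (Sum.inr i) d hf
    simpa [wt, h, sub_eq_add_neg] using this
  · have := mulVar_homog F n₁ n₂ (Sum.inr i) d hf
    simpa [wt, h] using this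

lemma opDX_homog (i : Fin n) (d : ℤ × ℤ) {f : Poly F n}
    (hf : IsWeightedHomogeneous (wt n n₁ n₂) f d) :
    IsWeightedHomogeneous (wt n n₁ n₂) (opDX F n₁ i f) (d - (1, 0)) := by
  unfold opDX
  split_ifs with h
  · have := (mulVar_homog F n₁ n₂ (Sum.inl i) d hf).neg
    simpa [wt, h, sub_eq_add_neg] using this
  · have := der_homog F n₁ n₂ (Sum.inl i) d hf
    simpa [wt, h] using this

lemma opDY_homog (i : Fin n) (d : ℤ × ℤ) {f : Poly F n}
    (hf : IsWeightedHomogeneous (wt n n₁ n₂) f d) :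
    IsWeightedHomogeneous (wt n n₁ n₂) (opDY F n₂ i f) (d - (0, 1)) := by
  unfold opDY
  split_ifs with h
  · have := (mulVar_homog F n₁ n₂ (Sum.inr i) d hf).neg
    simpa [wt, h, sub_eq_add_neg] using this
  · have := der_homog F n₁ n₂ (Sum.inr i) d hf
    simpa [wt, h] using this

lemma matOp_homog (A : Matrix (Fin n) (Fin n) F) (ℓ₁ ℓ₂ : ℤ) {f : Poly F n}
    (hf : f ∈ homog F n n₁ n₂ ℓ₁ ℓ₂) : matOp F n n₁ n₂ A f ∈ homog F n n₁ n₂ ℓ₁ ℓ₂ := by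
  have e : matOp F n n₁ n₂ A f = ∑ i, ∑ j, A i j • unitOp F n₁ n₂ i j f := by
    simp [matOp]
  rw [e]
  refine Submodule.sum_mem _ fun i _ => Submodule.sum_mem _ fun j _ =>
    Submodule.smul_mem _ _ (Submodule.sub_mem _ ?_ ?_)
  · have := opX_homog F n₁ n₂ i _ (opDX_homog F n₁ n₂ j _ hf)
    rwa [sub_add_cancel] at this
  · have := opY_homog F n₁ n₂ j _ (opDY_homog F n₁ n₂ i _ hf)
    rwa [sub_add_cancel] at this

end Operators

/-! ### The modules `ℋ_⟨ℓ₁,ℓ₂⟩` -/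

variable (F : Type*) [Field F] (n n₁ n₂ : ℕ)

/-- The polynomial algebra `𝒜`, regarded as the carrier of the representation of `sl(n)` with
parameters `n₁` and `n₂`. -/
def OscMod (F : Type*) [Field F] (n _n₁ _n₂ : ℕ) : Type _ := Poly F n

instance : AddCommGroup (OscMod F n n₁ n₂) := inferInstanceAs (AddCommGroup (Poly F n))

instance : Module F (OscMod F n n₁ n₂) := inferInstanceAs (Module F (Poly F n))

instance : LieRingModule (LieAlgebra.SpecialLinear.sl (Fin n) F) (OscMod F n n₁ n₂) where
  bracket A f := matOp F n n₁ n₂ A.val f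
  add_lie A B f := by
    change matOp F n n₁ n₂ (A.val + B.val) f = _
    rw [map_add]
    rfl
  lie_add A f g := map_add (matOp F n n₁ n₂ A.val) f g
  leibniz_lie A B f := by
    have h := congrArg (fun T : Module.End F (Poly F n) => T f)
      (matOp_lie F n₁ n₂ A.val B.val)
    rw [← LieAlgebra.SpecialLinear.sl_bracket] at h
    exact (eq_sub_iff_add_eq.mp h).symm

instance : LieModule F (LieAlgebra.SpecialLinear.sl (Fin n) F) (OscMod F n n₁ n₂) where
  smul_lie c A f := by
    change matOp F n n₁ n₂ (c • A.val) f = _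
    rw [map_smul]
    rfl
  lie_smul c A f := map_smul (matOp F n n₁ n₂ A.val) c f

/-- The `sl(n)`-module `ℋ_⟨ℓ₁,ℓ₂⟩` of the homogeneous solutions of `Δ̃(f) = 0` of degree
`(ℓ₁, ℓ₂)`. -/
def harmonic (ℓ₁ ℓ₂ : ℤ) :
    LieSubmodule F (LieAlgebra.SpecialLinear.sl (Fin n) F) (OscMod F n n₁ n₂) where
  toSubmodule := homog F n n₁ n₂ ℓ₁ ℓ₂ ⊓ LinearMap.ker (laplace F n n₁ n₂)
  lie_mem {A f} hf := by
    refine ⟨matOp_homog F n₁ n₂ A.val ℓ₁ ℓ₂ hf.1, ?_⟩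
    have h := congrArg (fun T : Module.End F (Poly F n) => T f)
      (matOp_laplace F n₁ n₂ A.val).eq
    have h0 : laplace F n n₁ n₂ f = 0 := hf.2
    change laplace F n n₁ n₂ (matOp F n n₁ n₂ A.val f) = 0
    refine h.symm.trans ?_
    change matOp F n n₁ n₂ A.val (laplace F n n₁ n₂ f) = 0
    rw [h0, map_zero]

/-! ### The explicit series -/

/-- The binomial coefficient `a (a - 1) ⋯ (a - r + 1) / r!` for integers `a` and `r`, which is `0`
for `r < 0`. -/
def binom (a r : ℤ) : ℤ := if 0 ≤ r then Ring.choose a r.toNat else 0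

/-- The `2 × 2` determinant in the coefficients of the numerator. -/
def numDet (n n₁ n₂ r s : ℤ) : ℤ :=
  !![binom (n₂ - 2) r * binom (n - n₂ - 1) r, binom (n₂ - 2) (r - 1) * binom (n - n₂) r;
     binom (n₁ - 1) (s + 1) * binom (n - n₁ - 2) s, binom (n₁ - 1) s * binom (n - n₁ - 1) s].det

/-- The formal sum `∑_{r,s ≥ 0} numDet(r, s) t^{r+s}`. -/
def numSeries : PowerSeries ℚ :=
  PowerSeries.mk fun k => ∑ p ∈ Finset.HasAntidiagonal.antidiagonal k, (numDet n n₁ n₂ p.1 p.2 : ℚ)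

/-- The formal sum `∑_{r ≥ 0} C(n - n₁ - 1, r) C(n₁ - 1, r) t^r`. -/
def numSeries' : PowerSeries ℚ :=
  PowerSeries.mk fun r => ((binom ((n : ℤ) - n₁ - 1) r * binom ((n₁ : ℤ) - 1) r : ℤ) : ℚ)

end Osc

end

/-! Every element of sl(n) acts on 𝒜 as multiplication by a quadratic form, its symbol, plus an
operator that raises the degree by less than 2. Let B be the algebra generated by the symbols, that
is, the image of S(sl(n)) in 𝒜. Since 𝒜 is a domain, the kernel of S(sl(n)) → B is prime, and the
main point is that it equals √Ann gr(M; M₀) (`radical_annGr_eq_ker`). Hence the Hilbert series is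
that of B, with the products of k symbols in degree k, and it depends neither on M₀ nor on ℓ₁, ℓ₂.

If s of degree k kills gr(M; M₀), an operator lifting s moves M_j only into M_{j+k-1}; its powers
then raise the polynomial degree too slowly for the symbol of s to be nonzero. Conversely, if the
symbol of s vanishes, powers of the lift gain too little degree, and this has to be turned into a
gain in the filtration M_k. That requires the degree filtration to be bounded by a shift of M_k
(`exists_mem_filtZ_of_degLE`), which follows by a Noetherian argument once the leading forms of M
lie in a finitely generated B-module.

For this, put (u_i, v_i) = (x_i, y_i) for i ∈ J₁ and (y_i, x_i) for i ∈ J₃. The part of Δ̃ that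
preserves the degree is E = ∑ u_i ∂_{v_i}, and it kills all leading forms of M. By Capelli's
identity ker E is generated by the variables other than the v_i and by the minors u_i v_j - u_j v_i
(`mem_kerWeightSpan`). In a fixed ℤ²-degree all but finitely many products of generators contain a
factor from B, which gives finite generation; in degree (0, 0) it gives B = ker E.

Finally E is the raising operator of an sl₂, and it maps weight (0, 0) onto weight (-1, -1) because
the sl₂-weights there are positive (`polar_map_formSpace`). So the dimensions of B are differences
of numbers of monomials. The generating functions of products of two multiset coefficients are
rational with explicit numerators (`pairSeries_mul`, `shiftSeries_mul`), and they combine into the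
stated determinant. -/

noncomputable section

open MvPolynomial

/-! ### Degree filtration and homogeneous components of polynomials. -/

namespace MvPolynomial

variable {F : Type*} [Field F] {σ : Type*}

variable (F σ) in
/-- The polynomials of degree at most `d`, for an integer `d`. -/
def degLE (d : ℤ) : Submodule F (MvPolynomial σ F) where
  carrier := {f | ∀ m, coeff m f ≠ 0 → (m.degree : ℤ) ≤ d}
  add_mem' {f g} hf hg m hm := by
    by_cases h : coeff m f = 0
    · refine hg m fun h' => hm ?_
      rw [coeff_add, h, h', add_zero]
    · exact hf m h
  zero_mem' m hm := absurd (coeff_zero m) hm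
  smul_mem' c f hf m hm := hf m fun h => hm (by rw [coeff_smul, h, smul_zero])

lemma degLE_mono {d e : ℤ} (h : d ≤ e) : degLE F σ d ≤ degLE F σ e :=
  fun _ hf m hm => (hf m hm).trans h

lemma degLE_of_neg {d : ℤ} (hd : d < 0) {f : MvPolynomial σ F} (hf : f ∈ degLE F σ d) : f = 0 := by
  ext m
  by_contra h
  have := hf m h
  omega

lemma exists_mem_degLE (f : MvPolynomial σ F) : ∃ d : ℕ, f ∈ degLE F σ d := by
  refine ⟨f.totalDegree, fun m hm => ?_⟩
  have := le_totalDegree (mem_support_iff.mpr hm)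
  rw [Finsupp.degree_apply]
  exact_mod_cast this

lemma degLE_mul {d e : ℤ} {f g : MvPolynomial σ F} (hf : f ∈ degLE F σ d) (hg : g ∈ degLE F σ e) :
    f * g ∈ degLE F σ (d + e) := by
  classical
  intro m hm
  rw [coeff_mul] at hm
  obtain ⟨⟨a, b⟩, hab, h⟩ := Finset.exists_ne_zero_of_sum_ne_zero hm
  have h1 := hf a (left_ne_zero_of_mul h)
  have h2 := hg b (right_ne_zero_of_mul h)
  rw [Finset.HasAntidiagonal.mem_antidiagonal] at hab
  simp only at hab
  rw [← hab, map_add]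
  push_cast
  omega

lemma IsHomogeneous.mem_degLE {d : ℕ} {f : MvPolynomial σ F} (hf : f.IsHomogeneous d) :
    f ∈ degLE F σ d := by
  intro m hm
  by_contra h
  exact hm (hf.coeff_eq_zero (by omega))

lemma degLE_eq_zero_of_homogeneous {d : ℕ} {f : MvPolynomial σ F} (hf : f.IsHomogeneous d)
    (h : f ∈ degLE F σ (d - 1)) : f = 0 := by
  ext m
  by_contra hm
  have h1 := h m hm
  have h2 : m.degree = d := by
    by_contra h2
    exact hm (hf.coeff_eq_zero h2)
  omega

lemma homogeneousComponent_of_degLE {d : ℕ} {e : ℤ} {f : MvPolynomial σ F}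
    (hf : f ∈ degLE F σ e) (h : e < d) : homogeneousComponent d f = 0 := by
  ext m
  rw [coeff_homogeneousComponent, coeff_zero]
  split_ifs with hm
  · by_contra h'
    have := hf m h'
    omega
  · rfl

lemma sub_homogeneousComponent_mem {d : ℕ} {f : MvPolynomial σ F} (hf : f ∈ degLE F σ d) :
    f - homogeneousComponent d f ∈ degLE F σ (d - 1) := by
  intro m hm
  rw [coeff_sub, coeff_homogeneousComponent] at hm
  split_ifs at hm with h
  · simp at hm
  · rw [sub_zero] at hm
    have := hf m hm
    omega

lemma mem_degLE_pred {d : ℕ} {f : MvPolynomial σ F} (hf : f ∈ degLE F σ d)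
    (h : homogeneousComponent d f = 0) : f ∈ degLE F σ (d - 1) := by
  simpa [h] using sub_homogeneousComponent_mem hf

/-- The least degree bound works: if the component there vanished, the bound could be lowered by
one. -/
lemma exists_homogeneousComponent_ne_zero {f : MvPolynomial σ F} (hf : f ≠ 0) :
    ∃ d : ℕ, f ∈ degLE F σ d ∧ homogeneousComponent d f ≠ 0 := by
  classical
  have h := exists_mem_degLE f
  refine ⟨Nat.find h, Nat.find_spec h, fun h0 => ?_⟩
  have h1 := mem_degLE_pred (Nat.find_spec h) h0
  by_cases hz : Nat.find h = 0
  · rw [hz] at h1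
    exact hf (degLE_of_neg (by simp) h1)
  · refine Nat.find_min h (m := Nat.find h - 1) (by omega) ?_
    rwa [Nat.cast_pred (by omega)]

lemma homogeneousComponent_mul_of_homogeneous {e : ℕ} {p : MvPolynomial σ F}
    (hp : p.IsHomogeneous e) (d : ℕ) (f : MvPolynomial σ F) :
    homogeneousComponent (d + e) (p * f) = p * homogeneousComponent d f := by
  let := MvPolynomial.gradedAlgebra (σ := σ) (R := F)
  have h := DirectSum.coe_decompose_mul_add_of_left_mem (homogeneousSubmodule σ F) (i := e) (j := d)
    (a := p) (b := f) hp
  have hc (φ : MvPolynomial σ F) (i : ℕ) :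
      (DirectSum.decompose (homogeneousSubmodule σ F) φ i : MvPolynomial σ F)
        = homogeneousComponent i φ := decomposition.decompose'_apply φ i
  rwa [hc, hc, add_comm] at h

lemma homogeneousComponent_mul_of_homogeneous_of_lt {e : ℕ} {p : MvPolynomial σ F}
    (hp : p.IsHomogeneous e) {d : ℕ} (h : d < e) (f : MvPolynomial σ F) :
    homogeneousComponent d (p * f) = 0 := by
  classical
  ext m
  rw [coeff_homogeneousComponent, coeff_zero]
  split_ifs with hm
  · rw [coeff_mul]
    refine Finset.sum_eq_zero fun x hx => ?_
    rw [hp.coeff_eq_zero, zero_mul]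
    have hx := congrArg Finsupp.degree (Finset.HasAntidiagonal.mem_antidiagonal.mp hx)
    rw [map_add] at hx
    omega
  · rfl

lemma mem_of_homogeneousComponent_mem (G : Submodule F (MvPolynomial σ F)) {f : MvPolynomial σ F}
    (h : ∀ d, homogeneousComponent d f ∈ G) : f ∈ G := by
  rw [← sum_homogeneousComponent f]
  exact Submodule.sum_mem _ fun d _ => h d

instance finiteDimensional_degLE [Finite σ] (d : ℤ) : FiniteDimensional F (degLE F σ d) := by
  rcases lt_or_ge d 0 with hd | hd
  · have : degLE F σ d = ⊥ := by
      rw [eq_bot_iff]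
      intro f hf
      exact degLE_of_neg hd hf
    rw [this]
    infer_instance
  · obtain ⟨e, rfl⟩ := Int.eq_ofNat_of_zero_le hd
    have hle : degLE F σ e ≤ ⨆ i ∈ Finset.range (e + 1), homogeneousSubmodule σ F i := by
      intro f hf
      refine mem_of_homogeneousComponent_mem _ fun i => ?_
      by_cases h : i < e + 1
      · exact (le_iSup₂_of_le (f := fun i (_ : i ∈ Finset.range (e + 1)) =>
          homogeneousSubmodule σ F i) i (Finset.mem_range.mpr h) le_rfl)
          (homogeneousComponent_mem i f)
      · rw [homogeneousComponent_of_degLE hf (by omega)]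
        exact zero_mem _
    have hfg : (⨆ i ∈ Finset.range (e + 1), homogeneousSubmodule σ F i).FG :=
      Submodule.fg_biSup _ _ fun i _ => homogeneousSubmodule_fg _ _ i
    have : FiniteDimensional F ↥(⨆ i ∈ Finset.range (e + 1), homogeneousSubmodule σ F i) :=
      Module.Finite.iff_fg.mpr hfg
    exact Submodule.finiteDimensional_of_le hle

end MvPolynomial

namespace AssocVar

attribute [local instance 100] LieRing.ofAssociativeRing

/-! ### The standard filtration and classes in the associated graded module. -/

section Filtration

variable {F : Type*} {L : Type*} [Field F] [LieRing L] [LieAlgebra F L]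
variable {V : Type*} [AddCommGroup V] [Module F V] [LieRingModule L V] [LieModule F L V]

lemma envAct_ι (ξ : L) (v : V) : envAct F L V (UniversalEnvelopingAlgebra.ι F ξ) v = ⁅ξ, v⁆ := by
  rw [envAct, UniversalEnvelopingAlgebra.lift_ι_apply]
  rfl

lemma envAct_mem_of_lie_mem {W : Submodule F V} (hW : ∀ (ξ : L), ∀ v ∈ W, ⁅ξ, v⁆ ∈ W)
    (u : UniversalEnvelopingAlgebra F L) {v : V} (hv : v ∈ W) : envAct F L V u v ∈ W := by
  obtain ⟨a, rfl⟩ : ∃ a, UniversalEnvelopingAlgebra.mkAlgHom F L a = u :=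
    Quotient.mk_surjective u
  induction a using TensorAlgebra.induction generalizing v with
  | algebraMap r =>
    rw [AlgHom.commutes, AlgHom.commutes, Module.algebraMap_end_apply]
    exact W.smul_mem r hv
  | ι ξ =>
    have := envAct_ι (F := F) ξ v
    rw [UniversalEnvelopingAlgebra.ι_apply] at this
    rw [this]
    exact hW ξ v hv
  | mul a b ha hb =>
    rw [map_mul, map_mul, Module.End.mul_apply]
    exact ha (hb hv)
  | add a b ha hb =>
    rw [map_add, map_add, LinearMap.add_apply]
    exact W.add_mem (ha hv) (hb hv)

lemma envFiltration_mono : Monotone (envFiltration F L) := fun _ _ h =>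
  biSup_mono fun _ hi => Finset.mem_range.mpr ((Finset.mem_range.mp hi).trans_le (by omega))

lemma one_mem_envFiltration (k : ℕ) :
    (1 : UniversalEnvelopingAlgebra F L) ∈ envFiltration F L k := by
  refine (le_iSup₂_of_le (f := fun r (_ : r ∈ Finset.range (k + 1)) =>
    (LinearMap.range (UniversalEnvelopingAlgebra.ι F : L →ₗ⁅F⁆ _).toLinearMap) ^ r)
    0 (by simp) le_rfl) ?_
  rw [pow_zero]
  exact Submodule.one_le.mp le_rfl

variable (V₀ : Submodule F V)

lemma filt_mono : Monotone (filt F L V₀) := fun _ _ h =>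
  Submodule.map₂_le_map₂_left (envFiltration_mono h)

lemma le_filt (k : ℕ) : V₀ ≤ filt F L V₀ k := by
  intro v hv
  have := Submodule.apply_mem_map₂ (envAct F L V).toLinearMap
    (one_mem_envFiltration (F := F) (L := L) k) hv
  simpa [filt, envSpan] using this

variable {V₀}

/-- The filtration is the smallest one that starts with `V₀` and is compatible with the action. -/
lemma filt_le {P : ℕ → Submodule F V} (hmono : Monotone P) (h0 : V₀ ≤ P 0)
    (hP : ∀ (ξ : L) (k : ℕ), ∀ v ∈ P k, ⁅ξ, v⁆ ∈ P (k + 1)) (k : ℕ) : filt F L V₀ k ≤ P k := by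
  refine Submodule.map₂_le.mpr fun u hu m hm => ?_
  have key : ∀ r, ∀ u ∈ (LinearMap.range
      (UniversalEnvelopingAlgebra.ι F : L →ₗ⁅F⁆ _).toLinearMap) ^ r,
      envAct F L V u m ∈ P r := by
    intro r u hu
    induction hu using Submodule.pow_induction_on_left' with
    | algebraMap r =>
      rw [AlgHom.commutes, Module.algebraMap_end_apply]
      exact Submodule.smul_mem _ _ (h0 hm)
    | add x y i hx hy ihx ihy =>
      rw [map_add, LinearMap.add_apply]
      exact Submodule.add_mem _ ihx ihy
    | mem_mul x hx i y hy ih =>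
      obtain ⟨ξ, rfl⟩ := hx
      rw [map_mul, Module.End.mul_apply]
      change envAct F L V (UniversalEnvelopingAlgebra.ι F ξ) _ ∈ _
      rw [envAct_ι]
      exact hP ξ i _ ih
  have hle : envFiltration F L k ≤ (P k).comap ((envAct F L V).toLinearMap.flip m) :=
    iSup₂_le fun r hr u hu => hmono (by simpa [Nat.lt_succ_iff] using hr) (key r u hu)
  exact hle hu

/-- The union of the V_k contains V₀ and is stable under L, hence under U(L). -/
lemma exists_mem_filt (hgen : Generates F L V₀) (v : V) : ∃ k, v ∈ filt F L V₀ k := by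
  have hdir : Directed (· ≤ ·) (filt F L V₀) := (filt_mono V₀).directed_le
  have hle : envSpan F L ⊤ V₀ ≤ ⨆ k, filt F L V₀ k := by
    refine Submodule.map₂_le.mpr fun u _ m hm => ?_
    refine envAct_mem_of_lie_mem (fun ξ v hv => ?_) u
      ((le_filt V₀ 0).trans (le_iSup (filt F L V₀) 0) hm)
    obtain ⟨k, hk⟩ := (Submodule.mem_iSup_of_directed _ hdir).mp hv
    exact (Submodule.mem_iSup_of_directed _ hdir).mpr ⟨k + 1, filt_step V₀ ξ k hk⟩
  have hgen' : envSpan F L ⊤ V₀ = ⊤ := hgen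
  exact (Submodule.mem_iSup_of_directed _ hdir).mp (hle (hgen' ▸ Submodule.mem_top))

lemma exists_le_filt (hgen : Generates F L V₀) (W : Submodule F V) [FiniteDimensional F W] :
    ∃ k, W ≤ filt F L V₀ k := by
  obtain ⟨t, ht⟩ := Module.Finite.iff_fg.mp (inferInstance : FiniteDimensional F W)
  choose k hk using exists_mem_filt (L := L) hgen
  refine ⟨t.sup k, ?_⟩
  rw [← ht, Submodule.span_le]
  exact fun v hv => filt_mono V₀ (Finset.le_sup hv) (hk v)

variable (L V₀) in
/-- The filtration `filt`, extended by `0` to negative indices. -/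
def filtZ (i : ℤ) : Submodule F V := if i < 0 then ⊥ else filt F L V₀ i.toNat

@[simp] lemma filtZ_natCast (k : ℕ) : filtZ L V₀ k = filt F L V₀ k := by
  simp [filtZ]

lemma filtZ_of_neg {i : ℤ} (h : i < 0) : filtZ L V₀ i = ⊥ := if_pos h

lemma filtPrev_eq (k : ℕ) : filtPrev F L V₀ k = filtZ L V₀ (k - 1) := by
  cases k with
  | zero => simp [filtZ, filtPrev]
  | succ k => simp [filtPrev]

lemma filtZ_mono : Monotone (filtZ L V₀) := by
  intro i j h
  rcases lt_or_ge i 0 with hi | hi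
  · rw [filtZ_of_neg hi]
    exact bot_le
  · rw [filtZ, filtZ, if_neg (by omega), if_neg (by omega)]
    exact filt_mono V₀ (Int.toNat_le_toNat h)

open Classical in
/-- The class of an element of `V_k` in `V_k / V_{k-1}`; the value is `0` outside `V_k`. -/
def grClass (V₀ : Submodule F V) (k : ℕ) (v : V) : Gr F L V₀ :=
  if h : v ∈ filt F L V₀ k then
    DirectSum.lof F ℕ (GrPiece F L V₀) k (Submodule.Quotient.mk ⟨v, h⟩) else 0

lemma grClass_eq {k : ℕ} {v : V} (h : v ∈ filt F L V₀ k) : grClass (L := L) V₀ k v =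
    DirectSum.lof F ℕ (GrPiece F L V₀) k (Submodule.Quotient.mk ⟨v, h⟩) := dif_pos h

lemma grClass_add {k : ℕ} {v w : V} (hv : v ∈ filt F L V₀ k) (hw : w ∈ filt F L V₀ k) :
    grClass (L := L) V₀ k (v + w) = grClass V₀ k v + grClass V₀ k w := by
  rw [grClass_eq hv, grClass_eq hw, grClass_eq (add_mem hv hw), ← map_add]
  rfl

lemma grClass_smul {k : ℕ} {v : V} (c : F) (hv : v ∈ filt F L V₀ k) :
    grClass (L := L) V₀ k (c • v) = c • grClass V₀ k v := by
  rw [grClass_eq hv, grClass_eq (Submodule.smul_mem _ c hv), ← map_smul]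
  rfl

lemma grClass_eq_zero_iff {k : ℕ} {v : V} (hv : v ∈ filt F L V₀ k) :
    grClass (L := L) V₀ k v = 0 ↔ v ∈ filtZ L V₀ (k - 1) := by
  rw [grClass_eq hv, ← filtPrev_eq]
  constructor
  · intro h
    have h' : (Submodule.Quotient.mk ⟨v, hv⟩ : GrPiece F L V₀ k) = 0 :=
      DirectSum.of_injective (β := GrPiece F L V₀) k (h.trans (map_zero _).symm)
    exact (Submodule.Quotient.mk_eq_zero
      ((filtPrev F L V₀ k).submoduleOf (filt F L V₀ k))).mp h'
  · intro h
    have h' : (Submodule.Quotient.mk ⟨v, hv⟩ : GrPiece F L V₀ k) = 0 :=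
      (Submodule.Quotient.mk_eq_zero _).mpr h
    rw [h', map_zero]

lemma end_gr_eq_zero {T : Module.End F (Gr F L V₀)}
    (h : ∀ k, ∀ v ∈ filt F L V₀ k, T (grClass V₀ k v) = 0) : T = 0 := by
  refine DirectSum.linearMap_ext F fun k => LinearMap.ext fun v => ?_
  obtain ⟨⟨v, hv⟩, rfl⟩ := Submodule.Quotient.mk_surjective _ v
  have := h k v hv
  rwa [grClass_eq hv] at this

lemma grOp_grClass (ξ : L) {k : ℕ} {v : V} (hv : v ∈ filt F L V₀ k) :
    grOp V₀ ξ (grClass V₀ k v) = grClass V₀ (k + 1) ⁅ξ, v⁆ := by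
  rw [grClass_eq hv, grOp_lof, grStep_mk, grClass_eq (filt_step V₀ ξ k hv)]
  rfl

lemma eq_zero_of_sum_grClass {ι : Type*} (s : Finset ι) (k : ι → ℕ) (hk : Function.Injective k)
    (v : ι → V) (h : ∑ i ∈ s, grClass (L := L) V₀ (k i) (v i) = 0) :
    ∀ i ∈ s, grClass (L := L) V₀ (k i) (v i) = 0 := by
  classical
  intro i hi
  have hc : ∀ j, DirectSum.component F ℕ (GrPiece F L V₀) (k i) (grClass V₀ (k j) (v j)) =
      if j = i then DirectSum.component F ℕ (GrPiece F L V₀) (k i) (grClass V₀ (k i) (v i))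
      else 0 := by
    intro j
    split_ifs with hj
    · rw [hj]
    · rw [grClass]
      split_ifs
      · rw [DirectSum.component.of, dif_neg fun e => hj (hk e)]
      · rw [map_zero]
  have h' := congrArg (DirectSum.component F ℕ (GrPiece F L V₀) (k i)) h
  rw [map_sum, Finset.sum_congr rfl fun j _ => hc j, Finset.sum_ite_eq' s i, if_pos hi,
    map_zero] at h'
  rw [grClass] at h' ⊢
  split_ifs at h' ⊢ with hm
  · rw [DirectSum.component.lof_self] at h'
    rw [h', map_zero]
  · rfl

end Filtration

/-! ### Decomposition of the symmetric algebra into its degrees. -/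

section Symmetric

variable {F : Type*} {L : Type*} [Field F] [LieRing L] [LieAlgebra F L]

lemma iSup_symPiece : ⨆ k, symPiece F L k = ⊤ := by
  rw [eq_top_iff]
  intro s _
  have hmul : ∀ a ∈ ⨆ k, symPiece F L k, ∀ b ∈ ⨆ k, symPiece F L k,
      a * b ∈ ⨆ k, symPiece F L k := by
    intro a ha b hb
    have := Submodule.mul_mem_mul ha hb
    rw [Submodule.iSup_mul] at this
    refine (iSup_le fun i => ?_ : _ ≤ ⨆ k, symPiece F L k) this
    rw [Submodule.mul_iSup]
    refine iSup_le fun j => ?_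
    refine le_trans ?_ (le_iSup (symPiece F L) (i + j))
    rw [symPiece, symPiece, symPiece, pow_add]
  induction s using SymmetricAlgebra.induction with
  | algebraMap r =>
    refine Submodule.mem_iSup_of_mem 0 ?_
    rw [symPiece, pow_zero]
    exact Submodule.algebraMap_mem r
  | ι ξ =>
    refine Submodule.mem_iSup_of_mem 1 ?_
    rw [symPiece, pow_one]
    exact ⟨ξ, rfl⟩
  | mul a b ha hb => exact hmul a (ha trivial) b (hb trivial)
  | add a b ha hb => exact add_mem (ha trivial) (hb trivial)

lemma exists_sum_symPiece (s : SymmetricAlgebra F L) :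
    ∃ c : ℕ →₀ SymmetricAlgebra F L, (∀ k, c k ∈ symPiece F L k) ∧ ∑ k ∈ c.support, c k = s := by
  have hs : s ∈ ⨆ k, symPiece F L k := iSup_symPiece (F := F) (L := L) ▸ Submodule.mem_top
  obtain ⟨c, hc, h⟩ := (Submodule.mem_iSup_iff_exists_finsupp _ _).mp hs
  exact ⟨c, hc, h⟩

end Symmetric

/-! ### The radical of the annihilator is the kernel of the symbol map. -/

section Symbols

variable {F : Type*} {L : Type*} [Field F] [LieRing L] [LieAlgebra F L]
variable {V : Type*} [AddCommGroup V] [Module F V] [LieRingModule L V] [LieModule F L V]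
variable {σ : Type*}

/-- A realization of an `L`-module in a polynomial ring in which every `ξ ∈ L` acts, up to terms of
lower degree, as multiplication by a quadratic form `sym ξ`. -/
structure QuadRealization (inc : V →ₗ[F] MvPolynomial σ F) (sym : L →ₗ[F] MvPolynomial σ F) :
    Prop where
  injective : Function.Injective inc
  homogeneous : ∀ ξ, (sym ξ).IsHomogeneous 2
  act : ∀ (ξ : L) (v : V) (d : ℤ), inc v ∈ degLE F σ d →
    inc ⁅ξ, v⁆ - sym ξ * inc v ∈ degLE F σ (d + 1)

variable {inc : V →ₗ[F] MvPolynomial σ F} {sym : L →ₗ[F] MvPolynomial σ F} {V₀ : Submodule F V}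

lemma QuadRealization.lie_mem (H : QuadRealization inc sym) (ξ : L) {v : V} {d : ℤ}
    (hv : inc v ∈ degLE F σ d) : inc ⁅ξ, v⁆ ∈ degLE F σ (d + 2) := by
  have h1 := degLE_mono (F := F) (σ := σ) (by omega : d + 1 ≤ d + 2) (H.act ξ v d hv)
  have h2 := degLE_mul (H.homogeneous ξ).mem_degLE hv
  rw [Nat.cast_ofNat, add_comm] at h2
  simpa using add_mem h1 h2

lemma QuadRealization.filt_le_degLE (H : QuadRealization inc sym) {d : ℤ}
    (hd : ∀ v ∈ V₀, inc v ∈ degLE F σ d) (i : ℤ) {v : V} (hv : v ∈ filtZ L V₀ i) :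
    inc v ∈ degLE F σ (d + 2 * i) := by
  rcases lt_or_ge i 0 with hi | hi
  · rw [filtZ_of_neg hi, Submodule.mem_bot] at hv
    rw [hv, map_zero]
    exact zero_mem _
  · obtain ⟨k, rfl⟩ := Int.eq_ofNat_of_zero_le hi
    have := filt_le (L := L) (V₀ := V₀)
      (P := fun k : ℕ => (degLE F σ (d + 2 * (k : ℤ))).comap inc)
      (fun a b h => Submodule.comap_mono (degLE_mono (by omega)))
      (fun v hv => by simpa using hd v hv)
      (fun ξ k v hv => by
        have := H.lie_mem ξ (show inc v ∈ degLE F σ (d + 2 * (k : ℤ)) from hv)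
        rw [Submodule.mem_comap]
        exact degLE_mono (by push_cast; omega) this) k
    rw [filtZ_natCast] at hv
    exact this hv

/-- `T` is an operator on `V` that induces the action of `s ∈ S^k(L)` on the associated graded
module, and whose leading part is the multiplication by the symbol of `s`. -/
structure IsLift (V₀ : Submodule F V) (inc : V →ₗ[F] MvPolynomial σ F)
    (sym : L →ₗ[F] MvPolynomial σ F) (k : ℕ) (s : SymmetricAlgebra F L) (T : Module.End F V) :
    Prop where
  homogeneous : (SymmetricAlgebra.lift sym s).IsHomogeneous (2 * k)
  filt_mem : ∀ j, ∀ v ∈ filt F L V₀ j, T v ∈ filt F L V₀ (j + k)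
  act_grClass : ∀ j, ∀ v ∈ filt F L V₀ j,
    symAct V₀ s (grClass V₀ j v) = grClass V₀ (j + k) (T v)
  symbol : ∀ (v : V) (d : ℤ), inc v ∈ degLE F σ d →
    inc (T v) - SymmetricAlgebra.lift sym s * inc v ∈ degLE F σ (d + 2 * k - 1)

lemma IsLift.degLE {k : ℕ} {s : SymmetricAlgebra F L} {T : Module.End F V}
    (h : IsLift V₀ inc sym k s T) {v : V} {d : ℤ} (hv : inc v ∈ degLE F σ d) :
    inc (T v) ∈ degLE F σ (d + 2 * k) := by
  have h1 := degLE_mono (F := F) (σ := σ) (by omega : d + 2 * k - 1 ≤ d + 2 * k) (h.symbol v d hv)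
  have h2 := degLE_mul h.homogeneous.mem_degLE hv
  rw [add_comm, Nat.cast_mul, Nat.cast_ofNat] at h2
  simpa using add_mem h1 h2

lemma IsLift.algebraMap (c : F) :
    IsLift V₀ inc sym 0 (algebraMap F (SymmetricAlgebra F L) c) (c • 1) where
  homogeneous := by
    rw [AlgHom.commutes, MvPolynomial.algebraMap_eq, mul_zero]
    exact isHomogeneous_C σ c
  filt_mem j v hv := Submodule.smul_mem _ c hv
  act_grClass j v hv := by
    rw [AlgHom.commutes, Module.algebraMap_end_apply]
    exact (grClass_smul c hv).symm
  symbol v d hv := by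
    rw [AlgHom.commutes, MvPolynomial.algebraMap_eq, LinearMap.smul_apply, Module.End.one_apply,
      map_smul, C_mul', sub_self]
    exact zero_mem _

lemma IsLift.add {k : ℕ} {s s' : SymmetricAlgebra F L} {T T' : Module.End F V}
    (h : IsLift V₀ inc sym k s T) (h' : IsLift V₀ inc sym k s' T') :
    IsLift V₀ inc sym k (s + s') (T + T') where
  homogeneous := by
    rw [map_add]
    exact h.homogeneous.add h'.homogeneous
  filt_mem j v hv := Submodule.add_mem _ (h.filt_mem j v hv) (h'.filt_mem j v hv)
  act_grClass j v hv := by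
    rw [map_add, LinearMap.add_apply, LinearMap.add_apply, h.act_grClass j v hv,
      h'.act_grClass j v hv, grClass_add (h.filt_mem j v hv) (h'.filt_mem j v hv)]
  symbol v d hv := by
    have := add_mem (h.symbol v d hv) (h'.symbol v d hv)
    rw [map_add, LinearMap.add_apply, map_add, add_mul, add_sub_add_comm]
    exact this

lemma IsLift.mul {k k' : ℕ} {s s' : SymmetricAlgebra F L} {T T' : Module.End F V}
    (h : IsLift V₀ inc sym k s T) (h' : IsLift V₀ inc sym k' s' T') :
    IsLift V₀ inc sym (k + k') (s * s') (T * T') where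
  homogeneous := by
    rw [map_mul, mul_add]
    exact h.homogeneous.mul h'.homogeneous
  filt_mem j v hv := by
    have := h.filt_mem _ _ (h'.filt_mem j v hv)
    rw [add_assoc, add_comm k'] at this
    exact this
  act_grClass j v hv := by
    rw [map_mul, Module.End.mul_apply, Module.End.mul_apply, h'.act_grClass j v hv,
      h.act_grClass _ _ (h'.filt_mem j v hv), add_assoc, add_comm k']
  symbol v d hv := by
    have h1 := h.symbol _ _ (h'.degLE hv)
    have h2 := degLE_mul h.homogeneous.mem_degLE (h'.symbol v d hv)
    have := add_mem (degLE_mono (by push_cast; omega : d + 2 * k' + 2 * k - 1 ≤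
      d + 2 * ((k + k' : ℕ) : ℤ) - 1) h1) (degLE_mono (by push_cast; omega) h2)
    rw [map_mul, Module.End.mul_apply]
    convert! this using 1
    ring

lemma IsLift.ι (H : QuadRealization inc sym) (ξ : L) :
    IsLift V₀ inc sym 1 (SymmetricAlgebra.ι F L ξ) (LieModule.toEnd F L V ξ) where
  homogeneous := by
    rw [SymmetricAlgebra.lift_ι_apply]
    exact H.homogeneous ξ
  filt_mem j v hv := filt_step V₀ ξ j hv
  act_grClass j v hv := by
    rw [symAct_ι]
    exact grOp_grClass ξ hv
  symbol v d hv := by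
    rw [SymmetricAlgebra.lift_ι_apply]
    have := H.act ξ v d hv
    rwa [show d + 2 * ((1 : ℕ) : ℤ) - 1 = d + 1 by push_cast; ring]

lemma IsLift.pow {k : ℕ} {s : SymmetricAlgebra F L} {T : Module.End F V}
    (h : IsLift V₀ inc sym k s T) (m : ℕ) : IsLift V₀ inc sym (m * k) (s ^ m) (T ^ m) := by
  induction m with
  | zero => simpa using IsLift.algebraMap (V₀ := V₀) (inc := inc) (sym := sym) 1
  | succ m ih =>
    rw [pow_succ, pow_succ, add_mul, one_mul]
    exact ih.mul h

lemma exists_isLift (V₀ : Submodule F V) (H : QuadRealization inc sym) {k : ℕ}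
    {s : SymmetricAlgebra F L} (hs : s ∈ symPiece F L k) : ∃ T, IsLift V₀ inc sym k s T := by
  rw [symPiece] at hs
  induction hs using Submodule.pow_induction_on_left' with
  | algebraMap c => exact ⟨_, IsLift.algebraMap c⟩
  | add x y i hx hy ihx ihy =>
    obtain ⟨T, hT⟩ := ihx
    obtain ⟨T', hT'⟩ := ihy
    exact ⟨_, hT.add hT'⟩
  | mem_mul x hx i y hy ih =>
    obtain ⟨ξ, rfl⟩ := hx
    obtain ⟨T, hT⟩ := ih
    refine ⟨LieModule.toEnd F L V ξ * T, ?_⟩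
    have := (IsLift.ι (V₀ := V₀) H ξ).mul hT
    rwa [add_comm 1 i] at this

/-- The homogeneous components of an element of the annihilator of the associated graded module
belong to it. -/
lemma symAct_component_eq_zero (H : QuadRealization inc sym) (c : ℕ →₀ SymmetricAlgebra F L)
    (hc : ∀ k, c k ∈ symPiece F L k) (h : symAct V₀ (∑ k ∈ c.support, c k) = 0) (k : ℕ) :
    symAct V₀ (c k) = 0 := by
  by_cases hk : k ∈ c.support
  swap
  · rw [Finsupp.notMem_support_iff.mp hk, map_zero]
  -- The summand of degree k sends a class of degree j to degree j + k, so different summands land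
  -- in different graded pieces and must vanish separately.
  choose T hT using fun k => exists_isLift V₀ H (hc k)
  refine end_gr_eq_zero fun j v hv => ?_
  have h' := LinearMap.congr_fun h (grClass V₀ j v)
  rw [map_sum, LinearMap.sum_apply, LinearMap.zero_apply,
    Finset.sum_congr rfl fun k _ => (hT k).act_grClass j v hv] at h'
  rw [(hT k).act_grClass j v hv]
  exact eq_zero_of_sum_grClass _ (fun k => j + k) (add_right_injective j) _ h' k hk

lemma lift_component_eq_zero (H : QuadRealization inc sym) (c : ℕ →₀ SymmetricAlgebra F L)
    (hc : ∀ k, c k ∈ symPiece F L k) (h : SymmetricAlgebra.lift sym (∑ k ∈ c.support, c k) = 0)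
    (k : ℕ) : SymmetricAlgebra.lift sym (c k) = 0 := by
  by_cases hk : k ∈ c.support
  swap
  · rw [Finsupp.notMem_support_iff.mp hk, map_zero]
  -- Only the homogeneity of the symbol of degree 2k is wanted from the lift, so any V₀ will do.
  choose T hT using fun k => exists_isLift (⊥ : Submodule F V) H (hc k)
  have h' := congrArg (homogeneousComponent (2 * k)) h
  rw [map_sum, map_sum, map_zero, Finset.sum_eq_single k] at h'
  · rwa [homogeneousComponent_eq_self (hT k).homogeneous] at h'
  · intro j _ hj
    rw [homogeneousComponent_of_mem (hT j).homogeneous, if_neg (by omega)]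
  · exact fun h => absurd hk h

/-- A comparison of growth. If s kills the graded module, each application of a lift T gains at most
k - 1 filtration steps, hence degree at most 2(k - 1) on average. If the symbol p of s were nonzero,
the leading form of T^m v would be p^m times that of v, so each application would gain degree
exactly 2k. -/
lemma lift_eq_zero_of_symAct_eq_zero [FiniteDimensional F V₀] (H : QuadRealization inc sym)
    (hV₀ : V₀ ≠ ⊥) {k : ℕ} {s : SymmetricAlgebra F L} (hs : s ∈ symPiece F L k)
    (h : symAct V₀ s = 0) : SymmetricAlgebra.lift sym s = 0 := by
  obtain ⟨T, hT⟩ := exists_isLift V₀ H hs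
  obtain ⟨v, hv, hv0⟩ := Submodule.exists_mem_ne_zero_of_ne_bot hV₀
  have hinc : inc v ≠ 0 := fun e => hv0 (H.injective (e.trans (map_zero inc).symm))
  obtain ⟨d, hd, hd0⟩ := exists_homogeneousComponent_ne_zero hinc
  obtain ⟨e, he⟩ : ∃ e : ℕ, ∀ v ∈ V₀, inc v ∈ degLE F σ e := by
    obtain ⟨t, ht⟩ := Module.Finite.iff_fg.mp (inferInstance : FiniteDimensional F V₀)
    choose e he using fun v : V => exists_mem_degLE (inc v)
    refine ⟨t.sup e, fun v hv => ?_⟩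
    have hle : V₀ ≤ (degLE F σ (t.sup e : ℕ)).comap inc := by
      rw [← ht, Submodule.span_le]
      exact fun v hv => degLE_mono (by exact_mod_cast Finset.le_sup hv) (he v)
    exact hle hv
  by_contra hne
  have hstep : ∀ i : ℤ, ∀ w ∈ filtZ L V₀ i, T w ∈ filtZ L V₀ (i + k - 1) := by
    intro i w hw
    rcases lt_or_ge i 0 with hi | hi
    · rw [filtZ_of_neg hi, Submodule.mem_bot] at hw
      rw [hw, map_zero]
      exact zero_mem _
    · obtain ⟨j, rfl⟩ := Int.eq_ofNat_of_zero_le hi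
      rw [filtZ_natCast] at hw
      have h1 := hT.act_grClass j w hw
      rw [h, LinearMap.zero_apply, eq_comm, grClass_eq_zero_iff (hT.filt_mem j w hw)] at h1
      exact_mod_cast h1
  -- For k = 0 and m > 0 the index is negative and the claim is that T^m v = 0; this is the reason
  -- for indexing by integers.
  have hpow : ∀ m : ℕ, (T ^ m) v ∈ filtZ L V₀ (m * ((k : ℤ) - 1)) := by
    intro m
    induction m with
    | zero =>
      rw [Nat.cast_zero, zero_mul]
      exact (filtZ_natCast (L := L) (V₀ := V₀) 0).symm ▸ le_filt V₀ 0 hv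
    | succ m ih =>
      rw [pow_succ', Module.End.mul_apply]
      have := hstep _ _ ih
      convert! this using 2
      push_cast
      ring
  have htop : ∀ m : ℕ, homogeneousComponent (d + m * (2 * k)) (inc ((T ^ m) v)) ≠ 0 := by
    intro m
    have hl := hT.pow m
    have h1 := hl.symbol v d hd
    have h2 : homogeneousComponent (d + m * (2 * k))
        (inc ((T ^ m) v) - SymmetricAlgebra.lift sym (s ^ m) * inc v) = 0 :=
      homogeneousComponent_of_degLE h1 (by push_cast; linarith)
    have h3 := homogeneousComponent_mul_of_homogeneous hl.homogeneous d (inc v)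
    rw [map_sub, sub_eq_zero, show d + m * (2 * k) = d + 2 * (m * k) by ring, h3] at h2
    rw [show d + m * (2 * k) = d + 2 * (m * k) by ring, h2, map_pow]
    exact mul_ne_zero (pow_ne_zero _ hne) hd0
  -- At m = e + 1 the degree is at most e + 2(e + 1)(k - 1), which is less than 2(e + 1)k.
  refine htop (e + 1) (homogeneousComponent_of_degLE
    (H.filt_le_degLE he _ (hpow (e + 1))) ?_)
  push_cast
  linarith [Int.natCast_nonneg d]

/-- If the degree filtration of the realization is cofinal to the standard filtration, then the
annihilator of the associated graded module has the same radical as the kernel of the symbol map. -/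
theorem radical_annGr_eq_ker [FiniteDimensional F V₀] (H : QuadRealization inc sym)
    (hV₀ : V₀ ≠ ⊥) {c : ℤ} (hc : ∀ (i : ℤ) (v : V), inc v ∈ degLE F σ (2 * i) →
      v ∈ filtZ L V₀ (i + c)) :
    (annGr (L := L) V₀).radical = RingHom.ker (SymmetricAlgebra.lift sym) := by
  apply le_antisymm
  -- The kernel is prime because the polynomial ring is a domain, so the annihilator itself may
  -- replace its radical.
  · rw [Ideal.IsPrime.radical_le_iff (RingHom.ker_isPrime _)]
    intro s hs
    obtain ⟨b, hb, rfl⟩ := exists_sum_symPiece s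
    have hs' := symAct_component_eq_zero H b hb hs
    rw [RingHom.mem_ker, map_sum]
    exact Finset.sum_eq_zero fun k _ => lift_eq_zero_of_symAct_eq_zero H hV₀ (hb k) (hs' k)
  · intro s hs
    obtain ⟨b, hb, rfl⟩ := exists_sum_symPiece s
    have hs' := lift_component_eq_zero H b hb hs
    refine Ideal.sum_mem _ fun k _ => ?_
    obtain ⟨T, hT⟩ := exists_isLift V₀ H (hb k)
    obtain ⟨e, he⟩ : ∃ e : ℕ, ∀ v ∈ V₀, inc v ∈ degLE F σ (2 * e) := by
      obtain ⟨t, ht⟩ := Module.Finite.iff_fg.mp (inferInstance : FiniteDimensional F V₀)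
      choose e he using fun v : V => exists_mem_degLE (inc v)
      refine ⟨t.sup e, fun v hv => ?_⟩
      have hle : V₀ ≤ (degLE F σ (2 * (t.sup e : ℕ))).comap inc := by
        rw [← ht, Submodule.span_le]
        intro v hv
        have : e v ≤ t.sup e := Finset.le_sup hv
        exact degLE_mono (by omega) (he v)
      exact hle hv
    -- With a vanishing symbol each application of T gains degree at most 2k - 1, one less than
    -- expected.
    have hdrop : ∀ m : ℕ, ∀ (v : V) (d : ℤ), inc v ∈ degLE F σ d →
        inc ((T ^ m) v) ∈ degLE F σ (d + m * (2 * k - 1)) := by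
      intro m
      induction m with
      | zero =>
        intro v d hv
        simpa using hv
      | succ m ih =>
        intro v d hv
        have h1 := hT.symbol v d hv
        rw [hs' k, zero_mul, sub_zero] at h1
        have h2 := ih _ _ h1
        rw [pow_succ, Module.End.mul_apply]
        refine degLE_mono (le_of_eq ?_) h2
        push_cast
        ring
    -- After 2m applications the degree is 2(e + j + m(2k - 1)), so the filtration index is at most
    -- j + 2mk - m + e + c. This m makes it at most j + 2mk - 1. The exponent is even so that the
    -- degree bound stays even, as `hc` demands.
    set m := (e + c + 1).toNat with hm
    refine ⟨2 * m, ?_⟩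
    change symAct V₀ (b k ^ (2 * m)) = 0
    refine end_gr_eq_zero fun j v hv => ?_
    have hl := hT.pow (2 * m)
    rw [hl.act_grClass j v hv, grClass_eq_zero_iff (hl.filt_mem j v hv)]
    have h1 := H.filt_le_degLE he j (by rwa [filtZ_natCast])
    have h2 := hdrop (2 * m) v _ h1
    have h3 := hc (e + j + m * (2 * k - 1)) _ (degLE_mono (le_of_eq (by push_cast; ring)) h2)
    refine filtZ_mono ?_ h3
    have : (e : ℤ) + c + 1 ≤ m := Int.self_le_toNat _
    push_cast
    linarith

lemma map_symPiece (sym : L →ₗ[F] MvPolynomial σ F) (k : ℕ) :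
    (symPiece F L k).map (SymmetricAlgebra.lift sym).toLinearMap = LinearMap.range sym ^ k := by
  rw [symPiece, Submodule.map_pow, ← LinearMap.range_comp]
  congr 2
  exact SymmetricAlgebra.lift_comp_ι sym

/-- The quotient by the kernel embeds into the polynomial ring, and the image of S^k(L) there is the
span of products of k symbols. -/
lemma finrank_quotHilbertSeries (sym : L →ₗ[F] MvPolynomial σ F) :
    quotHilbertSeries (RingHom.ker (SymmetricAlgebra.lift sym)) =
      PowerSeries.mk fun k => (Module.finrank F ↥(LinearMap.range sym ^ k) : ℚ) := by
  rw [quotHilbertSeries]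
  congr 1
  funext k
  congr 1
  set φ := SymmetricAlgebra.lift sym
  have hcomp : ((symPiece F L k).map (Ideal.Quotient.mkₐ F (RingHom.ker φ)).toLinearMap).map
      (Ideal.kerLiftAlg φ).toLinearMap = LinearMap.range sym ^ k := by
    rw [← map_symPiece, ← Submodule.map_comp]
    rfl
  rw [← hcomp]
  exact (Submodule.equivMapOfInjective (Ideal.kerLiftAlg φ).toLinearMap
    (Ideal.kerLiftAlg_injective φ) _).finrank_eq

end Symbols

/-! ### Comparison of the degree filtration with the standard filtration. -/

section Cofinal

variable {F : Type*} {L : Type*} [Field F] [LieRing L] [LieAlgebra F L]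
variable {V : Type*} [AddCommGroup V] [Module F V] [LieRingModule L V] [LieModule F L V]
variable {σ : Type*}
variable {inc : V →ₗ[F] MvPolynomial σ F} {sym : L →ₗ[F] MvPolynomial σ F} {V₀ : Submodule F V}

/-- The leading forms of degree `d` of the elements of `V`. -/
def leadForms (inc : V →ₗ[F] MvPolynomial σ F) (d : ℕ) : Submodule F (MvPolynomial σ F) :=
  ((degLE F σ d).comap inc).map (homogeneousComponent d ∘ₗ inc)

lemma isHomogeneous_of_mem_leadForms {d : ℕ} {f : MvPolynomial σ F} (hf : f ∈ leadForms inc d) :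
    f.IsHomogeneous d := by
  obtain ⟨v, -, rfl⟩ := hf
  exact homogeneousComponent_isHomogeneous d _

lemma QuadRealization.sym_mul_homogeneousComponent (H : QuadRealization inc sym) (ξ : L) {d : ℕ}
    {v : V} (hv : inc v ∈ degLE F σ d) :
    homogeneousComponent (d + 2) (inc ⁅ξ, v⁆) = sym ξ * homogeneousComponent d (inc v) := by
  have h := homogeneousComponent_of_degLE (d := d + 2) (H.act ξ v d hv) (by push_cast; omega)
  rw [map_sub, sub_eq_zero] at h
  rw [h, homogeneousComponent_mul_of_homogeneous (H.homogeneous ξ)]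

lemma QuadRealization.sym_mul_mem_leadForms (H : QuadRealization inc sym) (ξ : L) {d : ℕ}
    {f : MvPolynomial σ F} (hf : f ∈ leadForms inc d) : sym ξ * f ∈ leadForms inc (d + 2) := by
  obtain ⟨v, hv, rfl⟩ := hf
  refine ⟨⁅ξ, v⁆, ?_, H.sym_mul_homogeneousComponent ξ hv⟩
  have := H.lie_mem ξ (show inc v ∈ degLE F σ d from hv)
  exact_mod_cast this

/-- The subalgebra generated by the symbols. -/
abbrev symbolAlgebra (sym : L →ₗ[F] MvPolynomial σ F) : Subalgebra F (MvPolynomial σ F) :=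
  Algebra.adjoin F (Set.range sym)

lemma symbolAlgebra_isNoetherianRing [FiniteDimensional F L] (sym : L →ₗ[F] MvPolynomial σ F) :
    IsNoetherianRing (symbolAlgebra sym) := by
  apply isNoetherianRing_of_fg
  obtain ⟨t, ht⟩ := Module.Finite.iff_fg.mp
    (inferInstance : FiniteDimensional F (LinearMap.range sym))
  refine ⟨t, ?_⟩
  rw [← Algebra.adjoin_span, ht]
  rfl

/-- The module over the symbol algebra of the polynomials all of whose homogeneous components are
leading forms. -/
def leadModule (H : QuadRealization inc sym) :
    Submodule (symbolAlgebra sym) (MvPolynomial σ F) where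
  carrier := {f | ∀ d, homogeneousComponent d f ∈ leadForms inc d}
  add_mem' hf hg d := by
    rw [map_add]
    exact add_mem (hf d) (hg d)
  zero_mem' d := by
    rw [map_zero]
    exact zero_mem _
  smul_mem' b f hf := by
    obtain ⟨b, hb⟩ := b
    change ∀ d, homogeneousComponent d (b * f) ∈ leadForms inc d
    induction hb using Algebra.adjoin_induction generalizing f with
    | mem x hx =>
      obtain ⟨ξ, rfl⟩ := hx
      intro d
      rcases lt_or_ge d 2 with hd | hd
      · rw [homogeneousComponent_mul_of_homogeneous_of_lt (H.homogeneous ξ) hd]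
        exact zero_mem _
      · obtain ⟨d, rfl⟩ := Nat.exists_eq_add_of_le' hd
        rw [homogeneousComponent_mul_of_homogeneous (H.homogeneous ξ)]
        exact H.sym_mul_mem_leadForms ξ (hf d)
    | algebraMap r =>
      intro d
      rw [← Algebra.smul_def, map_smul]
      exact Submodule.smul_mem _ _ (hf d)
    | add x y hx hy ihx ihy =>
      intro d
      rw [add_mul, map_add]
      exact add_mem (ihx f hf d) (ihy f hf d)
    | mul x y hx hy ihx ihy =>
      rw [mul_assoc]
      exact ihx _ (ihy f hf)

lemma mem_leadModule_of_mem_leadForms (H : QuadRealization inc sym) {d : ℕ}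
    {f : MvPolynomial σ F} (hf : f ∈ leadForms inc d) : f ∈ leadModule H := by
  intro e
  rw [homogeneousComponent_of_mem (isHomogeneous_of_mem_leadForms hf)]
  split_ifs with h
  · exact h ▸ hf
  · exact zero_mem _

/-- The symbol algebra is Noetherian, so the module of leading forms, lying in a finitely generated
module, is finitely generated. The homogeneous components of its generators are again leading forms,
and their degrees are bounded. -/
lemma exists_leadModule_le_span [FiniteDimensional F L] (H : QuadRealization inc sym)
    {S : Submodule F (MvPolynomial σ F)} (hS : S.FG)
    (hle : ∀ d, leadForms inc d ≤ Subalgebra.toSubmodule (symbolAlgebra sym) * S) :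
    ∃ e : ℕ, leadModule H ≤ Submodule.span (symbolAlgebra sym)
      (⋃ d ∈ Finset.range (e + 1), (leadForms inc d : Set (MvPolynomial σ F))) := by
  have := symbolAlgebra_isNoetherianRing sym
  obtain ⟨t, ht⟩ := hS
  set N := Submodule.span (symbolAlgebra sym) (t : Set (MvPolynomial σ F)) with hN
  have hSN : S ≤ N.restrictScalars F := by
    rw [← ht, Submodule.span_le]
    exact Submodule.subset_span
  have hBN : Subalgebra.toSubmodule (symbolAlgebra sym) * S ≤ N.restrictScalars F :=
    Submodule.mul_le.mpr fun b hb s hs =>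
      N.smul_mem (⟨b, hb⟩ : symbolAlgebra sym) (hSN hs)
  have hGN : leadModule H ≤ N := fun f hf =>
    mem_of_homogeneousComponent_mem (N.restrictScalars F) fun d => hBN (hle d (hf d))
  have : IsNoetherian (symbolAlgebra sym) N :=
    isNoetherian_span_of_finite (symbolAlgebra sym) t.finite_toSet
  obtain ⟨g, hg⟩ := isNoetherian_submodule.mp this _ hGN
  choose e he using fun f : MvPolynomial σ F => exists_mem_degLE f
  refine ⟨g.sup e, ?_⟩
  rw [← hg, Submodule.span_le]
  intro f hf
  set P := Submodule.span (symbolAlgebra sym)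
      (⋃ d ∈ Finset.range (g.sup e + 1), (leadForms inc d : Set (MvPolynomial σ F)))
  refine mem_of_homogeneousComponent_mem (P.restrictScalars F) fun d => ?_
  by_cases hd : d ≤ e f
  · have hfG : f ∈ leadModule H := hg ▸ Submodule.subset_span hf
    refine Submodule.subset_span (Set.mem_biUnion (x := d) ?_ (hfG d))
    have : e f ≤ g.sup e := Finset.le_sup hf
    exact Finset.mem_coe.mpr (Finset.mem_range.mpr (by omega))
  · rw [homogeneousComponent_of_degLE (he f) (by omega)]
    exact zero_mem _

/-- Beyond the degrees of the generators, a leading form needs at least one factor from the symbols,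
and what remains is a leading form of degree two less. -/
lemma exists_leadForms_le [FiniteDimensional F L] (H : QuadRealization inc sym)
    {S : Submodule F (MvPolynomial σ F)} (hS : S.FG)
    (hle : ∀ d, leadForms inc d ≤ Subalgebra.toSubmodule (symbolAlgebra sym) * S) :
    ∃ e : ℕ, ∀ d, e < d + 2 → leadForms inc (d + 2) ≤ LinearMap.range sym * leadForms inc d := by
  obtain ⟨e, he⟩ := exists_leadModule_le_span H hS hle
  refine ⟨e, fun d hd f hf => ?_⟩
  -- Membership in `leadModule` is carried along because multiplication by a symbol uses that the
  -- component of degree d of the old element is a leading form.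
  have key : ∀ g ∈ Submodule.span (symbolAlgebra sym)
      (⋃ d ∈ Finset.range (e + 1), (leadForms inc d : Set (MvPolynomial σ F))),
      g ∈ leadModule H ∧ ∀ d, e < d + 2 →
        homogeneousComponent (d + 2) g ∈ LinearMap.range sym * leadForms inc d := by
    intro g hg
    induction hg using Submodule.span_induction with
    | mem g hg =>
      obtain ⟨i, hi, hgi⟩ := Set.mem_iUnion₂.mp hg
      refine ⟨mem_leadModule_of_mem_leadForms H hgi, fun d hd => ?_⟩
      have := Finset.mem_range.mp hi
      rw [homogeneousComponent_of_mem (isHomogeneous_of_mem_leadForms hgi), if_neg (by omega)]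
      exact zero_mem _
    | zero =>
      refine ⟨zero_mem _, fun d _ => ?_⟩
      rw [map_zero]
      exact zero_mem _
    | add x y _ _ hx hy =>
      refine ⟨add_mem hx.1 hy.1, fun d hd => ?_⟩
      rw [map_add]
      exact add_mem (hx.2 d hd) (hy.2 d hd)
    | smul b x _ hx =>
      refine ⟨Submodule.smul_mem _ b hx.1, ?_⟩
      obtain ⟨b, hb⟩ := b
      change ∀ d, e < d + 2 →
        homogeneousComponent (d + 2) (b * x) ∈ LinearMap.range sym * leadForms inc d
      obtain ⟨hx1, hx2⟩ := hx
      clear hf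
      induction hb using Algebra.adjoin_induction generalizing x with
      | mem z hz =>
        obtain ⟨ξ, rfl⟩ := hz
        intro d _
        rw [homogeneousComponent_mul_of_homogeneous (H.homogeneous ξ)]
        exact Submodule.mul_mem_mul ⟨ξ, rfl⟩ (hx1 d)
      | algebraMap r =>
        intro d hd
        rw [← Algebra.smul_def, map_smul]
        exact Submodule.smul_mem _ _ (hx2 d hd)
      | add y z _ _ ihy ihz =>
        intro d hd
        rw [add_mul, map_add]
        exact add_mem (ihy x ‹_› hx1 hx2 d hd) (ihz x ‹_› hx1 hx2 d hd)
      | mul y z hy hz ihy ihz =>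
        rw [mul_assoc]
        exact ihy (z * x) (Submodule.smul_mem _ (⟨z, hz⟩ : symbolAlgebra sym) ‹_›)
          ((leadModule H).smul_mem (⟨z, hz⟩ : symbolAlgebra sym) hx1) (ihz x ‹_› hx1 hx2)
  have := (key f (he (mem_leadModule_of_mem_leadForms H hf))).2 d hd
  rwa [homogeneousComponent_eq_self (isHomogeneous_of_mem_leadForms hf)] at this

/-- If the leading forms lie in a finitely generated module over the symbol algebra, then the degree
filtration is cofinal to the standard filtration. -/
theorem exists_mem_filtZ_of_degLE [Finite σ] [FiniteDimensional F L] (H : QuadRealization inc sym)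
    (hgen : Generates F L V₀) {S : Submodule F (MvPolynomial σ F)} (hS : S.FG)
    (hle : ∀ d, leadForms inc d ≤ Subalgebra.toSubmodule (symbolAlgebra sym) * S) :
    ∃ c : ℤ, ∀ (i : ℤ) (v : V), inc v ∈ degLE F σ (2 * i) → v ∈ filtZ L V₀ (i + c) := by
  obtain ⟨e, he⟩ := exists_leadForms_le H hS hle
  -- Symbols raise the degree by 2, so the induction needs both parities, e and e + 1, as its base.
  have : FiniteDimensional F ((degLE F σ ((e + 1 : ℕ) : ℤ)).comap inc) := by
    refine Module.Finite.of_injective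
      ((inc.restrict fun v hv => hv :
        (degLE F σ ((e + 1 : ℕ) : ℤ)).comap inc →ₗ[F] degLE F σ ((e + 1 : ℕ) : ℤ))) ?_
    intro v w hvw
    exact Subtype.ext (H.injective (congrArg Subtype.val hvw))
  obtain ⟨c, hc⟩ := exists_le_filt hgen ((degLE F σ ((e + 1 : ℕ) : ℤ)).comap inc)
  have hlift : ∀ (d k : ℕ), (degLE F σ d).comap inc ≤ filt F L V₀ k →
      ∀ f ∈ LinearMap.range sym * leadForms inc d, ∃ v ∈ filt F L V₀ (k + 1),
        inc v ∈ degLE F σ ((d + 2 : ℕ) : ℤ) ∧ homogeneousComponent (d + 2) (inc v) = f := by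
    intro d k hk f hf
    induction hf using Submodule.mul_induction_on' with
    | mem_mul_mem x hx y hy =>
      obtain ⟨ξ, rfl⟩ := hx
      obtain ⟨w, hw, rfl⟩ := hy
      refine ⟨⁅ξ, w⁆, filt_step V₀ ξ k (hk hw), ?_, H.sym_mul_homogeneousComponent ξ hw⟩
      have := H.lie_mem ξ (show inc w ∈ degLE F σ d from hw)
      exact_mod_cast this
    | add x _ y _ hx hy =>
      obtain ⟨v, hv, hv', rfl⟩ := hx
      obtain ⟨w, hw, hw', rfl⟩ := hy
      refine ⟨v + w, add_mem hv hw, ?_, ?_⟩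
      · rw [map_add]
        exact add_mem hv' hw'
      · rw [map_add, map_add]
  -- One filtration step realizes every leading form of degree d + 2; subtracting such a realization
  -- leaves an element of degree at most d + 1.
  have hstep : ∀ (d k : ℕ), e < d + 2 → (degLE F σ d).comap inc ≤ filt F L V₀ k →
      (degLE F σ ((d + 2 : ℕ) - 1 : ℤ)).comap inc ≤ filt F L V₀ (k + 1) →
      (degLE F σ ((d + 2 : ℕ) : ℤ)).comap inc ≤ filt F L V₀ (k + 1) := by
    intro d k hd hk hk' v hv
    obtain ⟨w, hw, hw', hvw⟩ := hlift d k hk _ (he d hd ⟨v, hv, rfl⟩)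
    have hsub : v - w ∈ filt F L V₀ (k + 1) := by
      refine hk' ?_
      rw [Submodule.mem_comap, map_sub]
      refine mem_degLE_pred (sub_mem hv hw') ?_
      rw [map_sub, hvw]
      exact sub_self _
    simpa using add_mem hsub hw
  -- Two degrees cost one filtration step. Degrees e + 2 + 2i and e + 3 + 2i are reached in turn
  -- from e + 2i and e + 1 + 2i, both with index c + i + 1.
  have hmain : ∀ i : ℕ, (degLE F σ ((e + 1 + 2 * i : ℕ) : ℤ)).comap inc ≤ filt F L V₀ (c + i) := by
    intro i
    induction i with
    | zero => exact hc
    | succ i ih =>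
      have hlow : (degLE F σ ((e + 2 * i : ℕ) : ℤ)).comap inc ≤ filt F L V₀ (c + i) :=
        (Submodule.comap_mono (degLE_mono (by push_cast; omega))).trans ih
      have h1 := hstep (e + 2 * i) (c + i) (by omega) hlow
        ((Submodule.comap_mono (degLE_mono (by push_cast; omega))).trans
          (ih.trans (filt_mono V₀ (by omega))))
      exact hstep (e + 1 + 2 * i) (c + i) (by omega) ih
        ((Submodule.comap_mono (degLE_mono (by push_cast; omega))).trans h1)
  refine ⟨c, fun i v hv => ?_⟩
  rcases lt_or_ge i 0 with hi | hi
  · have h0 : inc v = 0 := degLE_of_neg (by omega) hv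
    rw [H.injective (h0.trans (map_zero inc).symm)]
    exact zero_mem _
  · obtain ⟨i, rfl⟩ := Int.eq_ofNat_of_zero_le hi
    have := hmain i (degLE_mono (F := F) (σ := σ) (by push_cast; omega) hv)
    rw [← filtZ_natCast] at this
    rwa [add_comm, ← Nat.cast_add]

end Cofinal

end AssocVar

/-! ### Surjectivity of the raising operator of sl₂. -/

section SlTwo

variable {F V : Type*} [Field F] [AddCommGroup V] [Module F V] {e f h : Module.End F V}

/-- The commutator of e^(m+1) with f is (m + 1) e^m (h + m), evaluated on a vector of weight c. -/
lemma sl2_pow_apply (hef : e * f = f * e + h) (hhe : h * e = e * h + (2 : F) • e) (m : ℕ) {y : V}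
    {c : F} (hy : h y = c • y) :
    (e ^ (m + 1)) (f y) = f ((e ^ (m + 1)) y) + ((m + 1 : F) * (c + m)) • (e ^ m) y := by
  induction m generalizing y c with
  | zero =>
    have := LinearMap.congr_fun hef y
    simp only [Module.End.mul_apply, LinearMap.add_apply] at this
    simp [this, hy]
  | succ m ih =>
    have h1 := LinearMap.congr_fun hef y
    have h2 := LinearMap.congr_fun hhe y
    simp only [Module.End.mul_apply, LinearMap.add_apply, LinearMap.smul_apply] at h1 h2
    have h3 : h (e y) = (c + 2) • e y := by
      rw [h2, hy, map_smul, ← add_smul]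
    have h4 : (e ^ m) (e y) = (e ^ (m + 1)) y := by rw [pow_succ, Module.End.mul_apply]
    rw [pow_succ, Module.End.mul_apply, Module.End.mul_apply, h1, map_add, ih h3, hy, map_smul, h4,
      add_assoc, ← add_smul]
    congr 2
    push_cast
    ring

/-- In a representation of `sl₂`, the raising operator maps onto the vectors of weight `c` on which
it is nilpotent, provided that `c + N ≠ 0` for all natural `N`. -/
lemma sl2_exists_raising_eq (hef : e * f = f * e + h) (hhe : h * e = e * h + (2 : F) • e)
    (hhf : h * f = f * h - (2 : F) • f) [CharZero F] {P Q : Submodule F V}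
    (he : ∀ x ∈ Q, e x ∈ P) (hf : ∀ y ∈ P, f y ∈ Q) {c : F} (hc : ∀ N : ℕ, c + N ≠ 0) (N : ℕ) :
    ∀ y ∈ P, h y = c • y → (e ^ N) y = 0 → ∃ x ∈ Q, e x = y := by
  induction N with
  | zero =>
    intro y _ _ hy
    rw [pow_zero, Module.End.one_apply] at hy
    exact ⟨0, zero_mem _, by rw [map_zero, hy]⟩
  | succ N ih =>
    intro y hyP hyc hy
    -- If e^(N+1) y = 0, then e^(N+1) f y = k e^N y, so e f y - k y is killed already by e^N. By
    -- induction it is e x, whence y = e(f y - x) / k.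
    set k : F := (N + 1 : F) * (c + N) with hk
    have hk0 : k ≠ 0 := mul_ne_zero (Nat.cast_add_one_ne_zero N) (hc N)
    have h1 : h (e (f y)) = c • e (f y) := by
      have h2 := LinearMap.congr_fun hhe (f y)
      have h3 := LinearMap.congr_fun hhf y
      simp only [Module.End.mul_apply, LinearMap.add_apply, LinearMap.sub_apply,
        LinearMap.smul_apply] at h2 h3
      rw [h2, h3, hyc, map_sub, map_smul, map_smul, map_smul]
      abel
    obtain ⟨x, hx, hxy⟩ := ih (e (f y) - k • y)
      (P.sub_mem (he _ (hf y hyP)) (P.smul_mem _ hyP))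
      (by rw [map_sub, map_smul, h1, hyc, smul_sub, smul_comm])
      (by
        have := sl2_pow_apply hef hhe N hyc
        rw [hy, map_zero, zero_add] at this
        rw [map_sub, map_smul, ← this, ← Module.End.mul_apply (e ^ N), ← pow_succ, sub_self])
    refine ⟨k⁻¹ • (f y - x), Q.smul_mem _ (Q.sub_mem (hf y hyP) hx), ?_⟩
    rw [map_smul, map_sub, hxy, sub_sub_cancel, inv_smul_smul₀ hk0]

end SlTwo

/-! ### Polarization operators, their sl₂-relations and Capelli's identity. -/

namespace MvPolynomial

variable {F : Type*} [Field F] {σ : Type*}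

lemma pderiv_comm (s t : σ) (f : MvPolynomial σ F) :
    pderiv s (pderiv t f) = pderiv t (pderiv s f) := by
  classical
  have h : ⁅(pderiv s : Derivation F (MvPolynomial σ F) (MvPolynomial σ F)),
      (pderiv t : Derivation F (MvPolynomial σ F) (MvPolynomial σ F))⁆ = 0 := by
    refine MvPolynomial.derivation_ext fun i => ?_
    rw [Derivation.commutator_apply, pderiv_X, pderiv_X]
    by_cases h1 : t = i <;> by_cases h2 : s = i <;> simp [h1, h2]
  have := congrArg (fun D : Derivation F (MvPolynomial σ F) (MvPolynomial σ F) => D f) h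
  simp only [Derivation.commutator_apply, Derivation.zero_apply] at this
  exact sub_eq_zero.mp this

/-- The truncated subtraction is harmless: a nonzero coefficient of the derivative forces w s ≤ p.
-/
lemma IsWeightedHomogeneous.pderiv_sub {w : σ → ℕ} {p : ℕ} {f : MvPolynomial σ F}
    (hf : IsWeightedHomogeneous w f p) (s : σ) :
    IsWeightedHomogeneous w (pderiv s f) (p - w s) := by
  intro m hm
  have h : coeff (m + Finsupp.single s 1) f ≠ 0 := by
    intro h0
    rw [coeff_pderiv, h0, zero_mul] at hm
    exact hm rfl
  have h' := hf h
  rw [map_add, Finsupp.weight_single, one_smul] at h'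
  omega

lemma IsWeightedHomogeneous.pderiv_eq_zero {w : σ → ℕ} {p : ℕ} {f : MvPolynomial σ F}
    (hf : IsWeightedHomogeneous w f p) {s : σ} (h : p < w s) : pderiv s f = 0 := by
  ext m
  rw [coeff_pderiv, coeff_zero]
  by_contra hm
  have h' := hf (left_ne_zero_of_mul hm)
  rw [map_add, Finsupp.weight_single, one_smul] at h'
  omega

/-- Injectivity of φ keeps the images of different components apart. This allows statements about
kernels and images of T to be checked on homogeneous elements. -/
lemma weightedHomogeneousComponent_map {M : Type*} [AddCommMonoid M] (w : σ → M)
    (T : Module.End F (MvPolynomial σ F)) (φ : M → M) (hφ : Function.Injective φ)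
    (hT : ∀ m f, IsWeightedHomogeneous w f m → IsWeightedHomogeneous w (T f) (φ m))
    (m : M) (f : MvPolynomial σ F) :
    weightedHomogeneousComponent w (φ m) (T f) = T (weightedHomogeneousComponent w m f) := by
  classical
  have hfin := weightedHomogeneousComponent_finsupp (w := w) f
  have hsum : T f = ∑ i ∈ hfin.toFinset, T (weightedHomogeneousComponent w i f) := by
    conv_lhs => rw [← sum_weightedHomogeneousComponent w f, finsum_eq_sum _ hfin]
    rw [map_sum]
  rw [hsum, map_sum]
  have h1 : ∀ i, weightedHomogeneousComponent w (φ m) (T (weightedHomogeneousComponent w i f)) =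
      if i = m then T (weightedHomogeneousComponent w m f) else 0 := by
    intro i
    rw [weightedHomogeneousComponent_of_mem
      (hT i _ (weightedHomogeneousComponent_isWeightedHomogeneous ..))]
    by_cases h : i = m
    · rw [if_pos h, if_pos (congrArg φ h.symm), h]
    · rw [if_neg h, if_neg fun e => h (hφ e.symm)]
  rw [Finset.sum_congr rfl fun i _ => h1 i, Finset.sum_ite_eq']
  split_ifs with h
  · rfl
  · have h0 : weightedHomogeneousComponent w m f = 0 := by
      by_contra hne
      exact h ((Set.Finite.mem_toFinset hfin).mpr hne)
    rw [h0, map_zero]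

lemma mem_of_weightedHomogeneousComponent_mem {M : Type*} [AddCommMonoid M] (w : σ → M)
    (G : Submodule F (MvPolynomial σ F)) {f : MvPolynomial σ F}
    (h : ∀ m, weightedHomogeneousComponent w m f ∈ G) : f ∈ G := by
  have hfin := weightedHomogeneousComponent_finsupp (w := w) f
  rw [← sum_weightedHomogeneousComponent w f, finsum_eq_sum _ hfin]
  exact Submodule.sum_mem _ fun m _ => h m

lemma IsWeightedHomogeneous.weightedHomogeneousComponent {M N : Type*} [AddCommMonoid M]
    [AddCommMonoid N] {w : σ → M} {w' : σ → N} {m : M} {f : MvPolynomial σ F}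
    (hf : IsWeightedHomogeneous w f m) (k : N) :
    IsWeightedHomogeneous w (weightedHomogeneousComponent w' k f) m := by
  classical
  intro d hd
  rw [coeff_weightedHomogeneousComponent] at hd
  split_ifs at hd with h
  · exact hf hd
  · exact absurd rfl hd

section Polarization

variable {κ : Type*} [Fintype κ] (u v : κ → σ)

variable (F) in
/-- The polarization operator `∑ u_i ∂_{v_i}`. -/
def polar : Module.End F (MvPolynomial σ F) :=
  ∑ i, LinearMap.mulLeft F (X (u i)) ∘ₗ (pderiv (v i)).toLinearMap

lemma polar_apply (f : MvPolynomial σ F) : polar F u v f = ∑ i, X (u i) * pderiv (v i) f := by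
  simp [polar]

open Classical in
/-- The weight that counts the variables `u_i`. -/
def countWt (s : σ) : ℕ := ∑ i, if u i = s then 1 else 0

lemma countWt_apply (hu : Function.Injective u) (i : κ) : countWt u (u i) = 1 := by
  classical
  rw [countWt, Finset.sum_eq_single i] <;> simp +contextual [hu.eq_iff]

lemma countWt_of_ne {s : σ} (h : ∀ i, u i ≠ s) : countWt u s = 0 :=
  Finset.sum_eq_zero fun i _ => if_neg (h i)

lemma polar_self_of_homogeneous [Fintype σ] {f : MvPolynomial σ F} {p : ℕ}
    (hf : IsWeightedHomogeneous (countWt u) f p) : polar F u u f = (p : F) • f := by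
  classical
  rw [Nat.cast_smul_eq_nsmul, ← hf.sum_weight_X_mul_pderiv, polar_apply]
  simp only [countWt, Finset.sum_smul]
  rw [Finset.sum_comm]
  refine Finset.sum_congr rfl fun i _ => ?_
  rw [Finset.sum_eq_single (u i)]
  · rw [if_pos rfl, one_smul]
  · intro s _ hs
    rw [if_neg hs.symm, zero_smul]
  · exact fun h => absurd (Finset.mem_univ _) h

variable {u v}

lemma polar_weight {M : Type*} [AddCommMonoid M] {w : σ → M} {φ : M → M}
    {f : MvPolynomial σ F} {m : M}
    (h : ∀ i, IsWeightedHomogeneous w (X (u i) * pderiv (v i) f) (φ m)) :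
    IsWeightedHomogeneous w (polar F u v f) (φ m) := by
  rw [polar_apply]
  exact IsWeightedHomogeneous.sum _ _ _ fun i _ => h i

lemma pderiv_polar_fst (hu : Function.Injective u) (j : κ)
    (f : MvPolynomial σ F) :
    pderiv (u j) (polar F u v f) = pderiv (v j) f + polar F u v (pderiv (u j) f) := by
  classical
  rw [polar_apply, polar_apply, map_sum]
  have h : ∀ i, pderiv (u j) (X (u i) * pderiv (v i) f) =
      (if i = j then pderiv (v i) f else 0) + X (u i) * pderiv (v i) (pderiv (u j) f) := by
    intro i
    rw [pderiv_mul, pderiv_X, pderiv_comm (u j) (v i)]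
    by_cases hij : i = j
    · subst hij
      simp
    · rw [Pi.single_eq_of_ne (hu.ne hij), if_neg hij, zero_mul]
  rw [Finset.sum_congr rfl fun i _ => h i, Finset.sum_add_distrib, Finset.sum_ite_eq',
    if_pos (Finset.mem_univ j)]

lemma pderiv_polar_snd (huv : ∀ i j, u i ≠ v j) (j : κ) (f : MvPolynomial σ F) :
    pderiv (v j) (polar F u v f) = polar F u v (pderiv (v j) f) := by
  classical
  rw [polar_apply, polar_apply, map_sum]
  refine Finset.sum_congr rfl fun i _ => ?_
  rw [pderiv_mul, pderiv_X, pderiv_comm (v j) (v i), Pi.single_eq_of_ne (huv i j), zero_mul,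
    zero_add]

lemma polar_X_mul_fst (huv : ∀ i j, u i ≠ v j) (j : κ) (f : MvPolynomial σ F) :
    polar F u v (X (u j) * f) = X (u j) * polar F u v f := by
  classical
  rw [polar_apply, polar_apply, Finset.mul_sum]
  refine Finset.sum_congr rfl fun i _ => ?_
  rw [pderiv_mul, pderiv_X, Pi.single_eq_of_ne (huv j i)]
  ring

lemma polar_X_mul_snd (hv : Function.Injective v) (j : κ) (f : MvPolynomial σ F) :
    polar F u v (X (v j) * f) = X (u j) * f + X (v j) * polar F u v f := by
  classical
  rw [polar_apply, polar_apply, Finset.mul_sum]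
  have h : ∀ i, X (u i) * pderiv (v i) (X (v j) * f) =
      (if i = j then X (u i) * f else 0) + X (v j) * (X (u i) * pderiv (v i) f) := by
    intro i
    rw [pderiv_mul, pderiv_X]
    by_cases hij : i = j
    · subst hij
      simp only [Pi.single_eq_same, if_true]
      ring
    · rw [Pi.single_eq_of_ne (hv.ne (Ne.symm hij)), if_neg hij]
      ring
  rw [Finset.sum_congr rfl fun i _ => h i, Finset.sum_add_distrib, Finset.sum_ite_eq',
    if_pos (Finset.mem_univ j)]

/-- The relation [e, f] = h of sl₂, where h is the degree in the u_i minus the degree in the v_i.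
The next two lemmas supply the relations of h with e and f. -/
lemma polar_mul_polar (hu : Function.Injective u) (hv : Function.Injective v) :
    polar F u v * polar F v u = polar F v u * polar F u v + (polar F u u - polar F v v) := by
  have h1 : ∀ f, polar F u v (polar F v u f) = polar F u u f +
      ∑ j, X (v j) * polar F u v (pderiv (u j) f) := by
    intro f
    rw [polar_apply v u, map_sum, polar_apply u u, ← Finset.sum_add_distrib]
    exact Finset.sum_congr rfl fun j _ => polar_X_mul_snd hv j _
  have h2 : ∀ f, polar F v u (polar F u v f) = polar F v v f +
      ∑ j, X (v j) * polar F u v (pderiv (u j) f) := by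
    intro f
    rw [polar_apply v u, polar_apply v v, ← Finset.sum_add_distrib]
    refine Finset.sum_congr rfl fun j _ => ?_
    rw [pderiv_polar_fst hu, mul_add]
  refine LinearMap.ext fun f => ?_
  rw [LinearMap.add_apply, LinearMap.sub_apply, Module.End.mul_apply, Module.End.mul_apply, h1, h2]
  abel

lemma polar_self_mul (hu : Function.Injective u) (huv : ∀ i j, u i ≠ v j) :
    polar F u u * polar F u v = polar F u v * polar F u u + polar F u v := by
  have h1 : ∀ f, polar F u v (polar F u u f) =
      ∑ j, X (u j) * polar F u v (pderiv (u j) f) := by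
    intro f
    rw [polar_apply u u, map_sum]
    exact Finset.sum_congr rfl fun j _ => polar_X_mul_fst huv j _
  have h2 : ∀ f, polar F u u (polar F u v f) = polar F u v f +
      ∑ j, X (u j) * polar F u v (pderiv (u j) f) := by
    intro f
    rw [polar_apply u u, polar_apply u v, ← Finset.sum_add_distrib]
    refine Finset.sum_congr rfl fun j _ => ?_
    rw [← polar_apply, pderiv_polar_fst hu, mul_add]
  refine LinearMap.ext fun f => ?_
  rw [LinearMap.add_apply, Module.End.mul_apply, Module.End.mul_apply, h1, h2]
  abel

lemma polar_self_mul' (hv : Function.Injective v) (huv : ∀ i j, u i ≠ v j) :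
    polar F v v * polar F u v = polar F u v * polar F v v - polar F u v := by
  have h1 : ∀ f, polar F u v (polar F v v f) = polar F u v f +
      ∑ j, X (v j) * polar F u v (pderiv (v j) f) := by
    intro f
    rw [polar_apply v v, map_sum, polar_apply u v f, ← Finset.sum_add_distrib]
    exact Finset.sum_congr rfl fun j _ => polar_X_mul_snd hv j _
  have h2 : ∀ f, polar F v v (polar F u v f) =
      ∑ j, X (v j) * polar F u v (pderiv (v j) f) := by
    intro f
    rw [polar_apply v v]
    refine Finset.sum_congr rfl fun j _ => ?_
    rw [pderiv_polar_snd huv]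
  refine LinearMap.ext fun f => ?_
  rw [LinearMap.sub_apply, Module.End.mul_apply, Module.End.mul_apply, h1, h2]
  abel

/-- Cayley's operator `∂_{u_i} ∂_{v_j} - ∂_{u_j} ∂_{v_i}`. -/
def cayley (u v : κ → σ) (i j : κ) (f : MvPolynomial σ F) : MvPolynomial σ F :=
  pderiv (u i) (pderiv (v j) f) - pderiv (u j) (pderiv (v i) f)

/-- On the kernel, E ∂_{u_i} ∂_{v_j} f = -∂_{v_i} ∂_{v_j} f for E = ∑ u_k ∂_{v_k}; this is symmetric
in i and j and cancels in the antisymmetrization. -/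
lemma polar_cayley (hu : Function.Injective u) (huv : ∀ i j, u i ≠ v j) (i j : κ)
    {f : MvPolynomial σ F} (hf : polar F u v f = 0) : polar F u v (cayley u v i j f) = 0 := by
  have h : ∀ i j, polar F u v (pderiv (u i) (pderiv (v j) f)) =
      - pderiv (v i) (pderiv (v j) f) := by
    intro i j
    have := pderiv_polar_fst (v := v) hu i (pderiv (v j) f)
    rw [← pderiv_polar_snd huv, hf, map_zero, map_zero] at this
    exact (neg_eq_of_add_eq_zero_right this.symm).symm
  rw [cayley, map_sub, h, h, pderiv_comm (v i)]
  abel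

/-- Capelli's identity, for polynomials that are annihilated by the polarization operator. -/
lemma sum_minor_mul_cayley (hu : Function.Injective u) (huv : ∀ i j, u i ≠ v j)
    {f : MvPolynomial σ F} (hf : polar F u v f = 0) {p q : F}
    (hp : polar F u u f = p • f) (hq : polar F v v f = q • f) :
    ∑ i, ∑ j, (X (u i) * X (v j) - X (u j) * X (v i)) * cayley u v i j f
      = (2 * q * (p + 1)) • f := by
  have hA : ∑ i, ∑ j, X (u i) * X (v j) * pderiv (u i) (pderiv (v j) f) = (p * q) • f := by
    have h : ∀ i, ∑ j, X (u i) * X (v j) * pderiv (u i) (pderiv (v j) f) =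
        q • (X (u i) * pderiv (u i) f) := by
      intro i
      have hvu : ∀ j k, v j ≠ u k := fun j k => (huv k j).symm
      have h1 : pderiv (u i) (polar F v v f) = ∑ j, X (v j) * pderiv (u i) (pderiv (v j) f) := by
        classical
        rw [polar_apply, map_sum]
        refine Finset.sum_congr rfl fun j _ => ?_
        rw [pderiv_mul, pderiv_X, Pi.single_eq_of_ne (hvu j i), zero_mul, zero_add]
      rw [hq, (pderiv (u i)).map_smul] at h1
      rw [← mul_smul_comm, h1, Finset.mul_sum]
      exact Finset.sum_congr rfl fun j _ => mul_assoc _ _ _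
    rw [Finset.sum_congr rfl fun i _ => h i, ← Finset.smul_sum, ← polar_apply, hp, smul_smul,
      mul_comm]
  -- Expand ∑ v_j ∂_{u_j} applied to ∑ u_i ∂_{v_i} f = 0: the sum in question appears next to the
  -- Euler operator in the v_i, which contributes q f.
  have hB : ∑ i, ∑ j, X (u i) * X (v j) * pderiv (u j) (pderiv (v i) f) = -(q • f) := by
    have h1 : polar F v u (polar F u v f) =
        polar F v v f + ∑ j, ∑ i, X (u i) * X (v j) * pderiv (u j) (pderiv (v i) f) := by
      rw [polar_apply v u, polar_apply v v, ← Finset.sum_add_distrib]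
      refine Finset.sum_congr rfl fun j _ => ?_
      rw [pderiv_polar_fst hu, mul_add, polar_apply, Finset.mul_sum]
      congr 1
      refine Finset.sum_congr rfl fun i _ => ?_
      rw [pderiv_comm (v i)]
      ring
    rw [hf, map_zero, hq, Finset.sum_comm] at h1
    exact (neg_eq_of_add_eq_zero_right h1.symm).symm
  have hsymm : ∀ g : κ → κ → MvPolynomial σ F, ∑ i, ∑ j, g i j = ∑ i, ∑ j, g j i :=
    fun g => Finset.sum_comm
  have hsplit : ∑ i, ∑ j, (X (u i) * X (v j) - X (u j) * X (v i)) * cayley u v i j f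
      = (∑ i, ∑ j, X (u i) * X (v j) * pderiv (u i) (pderiv (v j) f)
          + ∑ i, ∑ j, X (u j) * X (v i) * pderiv (u j) (pderiv (v i) f))
        - (∑ i, ∑ j, X (u i) * X (v j) * pderiv (u j) (pderiv (v i) f)
          + ∑ i, ∑ j, X (u j) * X (v i) * pderiv (u i) (pderiv (v j) f)) := by
    simp only [← Finset.sum_add_distrib, ← Finset.sum_sub_distrib]
    refine Finset.sum_congr rfl fun i _ => Finset.sum_congr rfl fun j _ => ?_
    rw [cayley]
    ring
  -- Each of the two sums occurs twice, so the constant is 2(pq + q).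
  rw [hsplit, ← hsymm fun i j => X (u i) * X (v j) * pderiv (u i) (pderiv (v j) f),
    ← hsymm fun i j => X (u i) * X (v j) * pderiv (u j) (pderiv (v i) f), hA, hB]
  simp only [← neg_smul, ← add_smul, ← sub_smul]
  congr 1
  ring

end Polarization

end MvPolynomial

namespace Osc

attribute [local instance 100] LieRing.ofAssociativeRing

/-! ### Symbols -/

section Realization

variable {F : Type*} [Field F] {n : ℕ}

/-- `T` equals the multiplication by the form `p` of degree `e`, up to terms of lower degree. -/
def HasSymbol (T : Module.End F (Poly F n)) (e : ℕ) (p : Poly F n) : Prop :=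
  p.IsHomogeneous e ∧ ∀ (d : ℤ) (f : Poly F n), f ∈ degLE F (Fin n ⊕ Fin n) d →
    T f - p * f ∈ degLE F (Fin n ⊕ Fin n) (d + e - 1)

lemma HasSymbol.degLE {T : Module.End F (Poly F n)} {e : ℕ} {p : Poly F n} (h : HasSymbol T e p)
    {d : ℤ} {f : Poly F n} (hf : f ∈ degLE F (Fin n ⊕ Fin n) d) :
    T f ∈ MvPolynomial.degLE F (Fin n ⊕ Fin n) (d + e) := by
  have h1 := degLE_mono (F := F) (σ := Fin n ⊕ Fin n) (by omega : d + e - 1 ≤ d + e) (h.2 d f hf)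
  have h2 := degLE_mul h.1.mem_degLE hf
  rw [add_comm] at h2
  simpa using add_mem h1 h2

lemma HasSymbol.mul {T T' : Module.End F (Poly F n)} {e e' : ℕ} {p p' : Poly F n}
    (h : HasSymbol T e p) (h' : HasSymbol T' e' p') : HasSymbol (T * T') (e + e') (p * p') := by
  refine ⟨h.1.mul h'.1, fun d f hf => ?_⟩
  have h1 := h.2 _ _ (h'.degLE hf)
  have h2 := degLE_mul h.1.mem_degLE (h'.2 d f hf)
  have := add_mem (degLE_mono (by push_cast; omega : d + e' + e - 1 ≤
    d + ((e + e' : ℕ) : ℤ) - 1) h1) (degLE_mono (by push_cast; omega) h2)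
  rw [Module.End.mul_apply]
  convert! this using 1
  ring

lemma HasSymbol.sub {T T' : Module.End F (Poly F n)} {e : ℕ} {p p' : Poly F n}
    (h : HasSymbol T e p) (h' : HasSymbol T' e p') : HasSymbol (T - T') e (p - p') := by
  refine ⟨h.1.sub h'.1, fun d f hf => ?_⟩
  have := sub_mem (h.2 d f hf) (h'.2 d f hf)
  rw [LinearMap.sub_apply]
  convert! this using 1
  ring

lemma HasSymbol.smul {T : Module.End F (Poly F n)} {e : ℕ} {p : Poly F n}
    (c : F) (h : HasSymbol T e p) : HasSymbol (c • T) e (c • p) := by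
  refine ⟨(homogeneousSubmodule _ F e).smul_mem c h.1, fun d f hf => ?_⟩
  rw [LinearMap.smul_apply, smul_mul_assoc, ← smul_sub]
  exact Submodule.smul_mem _ c (h.2 d f hf)

lemma HasSymbol.neg {T : Module.End F (Poly F n)} {e : ℕ} {p : Poly F n}
    (h : HasSymbol T e p) : HasSymbol (-T) e (-p) := by
  refine ⟨h.1.neg, fun d f hf => ?_⟩
  have := neg_mem (h.2 d f hf)
  rw [LinearMap.neg_apply]
  convert! this using 1
  ring

lemma HasSymbol.sum {ι : Type*} (s : Finset ι) {T : ι → Module.End F (Poly F n)} {e : ℕ}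
    {p : ι → Poly F n} (h : ∀ i, HasSymbol (T i) e (p i)) :
    HasSymbol (∑ i ∈ s, T i) e (∑ i ∈ s, p i) := by
  refine ⟨IsHomogeneous.sum _ _ _ fun i _ => (h i).1, fun d f hf => ?_⟩
  rw [LinearMap.sum_apply, Finset.sum_mul, ← Finset.sum_sub_distrib]
  exact Submodule.sum_mem _ fun i _ => (h i).2 d f hf

lemma hasSymbol_mulVar (s : Fin n ⊕ Fin n) : HasSymbol (mulVar F s) 1 (X s) := by
  refine ⟨isHomogeneous_X F s, fun d f _ => ?_⟩
  rw [mulVar, LinearMap.mulLeft_apply, sub_self]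
  exact zero_mem _

lemma pderiv_mem_degLE (s : Fin n ⊕ Fin n) {d : ℤ} {f : Poly F n}
    (hf : f ∈ degLE F (Fin n ⊕ Fin n) d) : pderiv s f ∈ degLE F (Fin n ⊕ Fin n) (d - 1) := by
  intro m hm
  rw [coeff_pderiv] at hm
  have := hf _ (left_ne_zero_of_mul hm)
  rw [map_add, Finsupp.degree_single] at this
  push_cast at this
  omega

/-- A derivative counts as an operator of degree 1 with vanishing leading part, so that all the
quadratic expressions in `unitOp` get the same degree 2. -/
lemma hasSymbol_der (s : Fin n ⊕ Fin n) : HasSymbol (der F s) 1 0 := by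
  refine ⟨isHomogeneous_zero _ _ _, fun d f hf => ?_⟩
  rw [zero_mul, sub_zero]
  exact degLE_mono (by push_cast; omega) (pderiv_mem_degLE s hf)

variable (F n) in
/-- The symbol of the operator by which `E_{i,j}` acts. -/
def unitSym (n₁ n₂ : ℕ) (i j : Fin n) : Poly F n :=
  (if (i : ℕ) < n₁ then 0 else X (.inl i)) * (if (j : ℕ) < n₁ then -X (.inl j) else 0) -
    (if n₂ ≤ (j : ℕ) then 0 else X (.inr j)) * (if n₂ ≤ (i : ℕ) then -X (.inr i) else 0)

lemma hasSymbol_unitOp (n₁ n₂ : ℕ) (i j : Fin n) :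
    HasSymbol (unitOp F n₁ n₂ i j) 2 (unitSym F n n₁ n₂ i j) := by
  have h1 : HasSymbol (opX F n₁ i) 1 (if (i : ℕ) < n₁ then 0 else X (.inl i)) := by
    unfold opX
    split_ifs
    exacts [hasSymbol_der _, hasSymbol_mulVar _]
  have h2 : HasSymbol (opDX F n₁ j) 1 (if (j : ℕ) < n₁ then -X (.inl j) else 0) := by
    unfold opDX
    split_ifs
    exacts [(hasSymbol_mulVar _).neg, hasSymbol_der _]
  have h3 : HasSymbol (opY F n₂ j) 1 (if n₂ ≤ (j : ℕ) then 0 else X (.inr j)) := by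
    unfold opY
    split_ifs
    exacts [hasSymbol_der _, hasSymbol_mulVar _]
  have h4 : HasSymbol (opDY F n₂ i) 1 (if n₂ ≤ (i : ℕ) then -X (.inr i) else 0) := by
    unfold opDY
    split_ifs
    exacts [(hasSymbol_mulVar _).neg, hasSymbol_der _]
  exact (h1.mul h2).sub (h3.mul h4)

variable (F n) in
/-- The symbol map on `sl(n)`. -/
def matSym (n₁ n₂ : ℕ) : LieAlgebra.SpecialLinear.sl (Fin n) F →ₗ[F] Poly F n where
  toFun A := ∑ i, ∑ j, A.val i j • unitSym F n n₁ n₂ i j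
  map_add' A B := by
    simp [add_smul, Finset.sum_add_distrib]
  map_smul' c A := by
    simp [Finset.smul_sum, mul_smul]

variable (F n) in
/-- The inclusion of `ℋ_⟨ℓ₁,ℓ₂⟩` into the polynomial ring. -/
def harmonicIncl (n₁ n₂ : ℕ) (ℓ₁ ℓ₂ : ℤ) : harmonic F n n₁ n₂ ℓ₁ ℓ₂ →ₗ[F] Poly F n where
  toFun v := v.1
  map_add' _ _ := rfl
  map_smul' _ _ := rfl

lemma quadRealization_harmonic (n₁ n₂ : ℕ) (ℓ₁ ℓ₂ : ℤ) :
    AssocVar.QuadRealization (harmonicIncl F n n₁ n₂ ℓ₁ ℓ₂) (matSym F n n₁ n₂) := by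
  have hs : ∀ A : LieAlgebra.SpecialLinear.sl (Fin n) F,
      HasSymbol (matOp F n n₁ n₂ A.val) 2 (matSym F n n₁ n₂ A) := fun A =>
    HasSymbol.sum _ fun i => HasSymbol.sum _ fun j => (hasSymbol_unitOp n₁ n₂ i j).smul _
  refine ⟨Subtype.val_injective, fun A => (hs A).1, fun A v d hv => ?_⟩
  have := (hs A).2 d _ hv
  exact degLE_mono (by push_cast; omega) this

/-- Only off-diagonal E_{i,j} have trace zero; their symbols suffice for all membership proofs
below. -/
lemma unitSym_mem_range (n₁ n₂ : ℕ) {i j : Fin n} (h : i ≠ j) :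
    unitSym F n n₁ n₂ i j ∈ LinearMap.range (matSym F n n₁ n₂) := by
  classical
  refine ⟨LieAlgebra.SpecialLinear.single i j h 1, ?_⟩
  change ∑ k, ∑ l, (Matrix.single i j (1 : F)) k l • unitSym F n n₁ n₂ k l = _
  rw [Finset.sum_eq_single i, Finset.sum_eq_single j]
  · simp
  · intro l _ hl
    simp [hl.symm]
  · simp
  · intro k _ hk
    refine Finset.sum_eq_zero fun l _ => ?_
    simp [hk.symm]
  · simp

end Realization

/-! ### The leading part of the Laplace operator -/

section Leading

variable (n n₁ n₂ : ℕ)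

/-- The indices in `J₁ ∪ J₃`. -/
abbrev OuterIdx : Type := {i : Fin n // (i : ℕ) < n₁ ∨ n₂ ≤ (i : ℕ)}

variable {n n₁ n₂}

/-- The variable `x_i` for `i ∈ J₁` and `y_i` for `i ∈ J₃`. -/
def uVar (i : OuterIdx n n₁ n₂) : Fin n ⊕ Fin n := if (i.1 : ℕ) < n₁ then .inl i else .inr i

/-- The variable `y_i` for `i ∈ J₁` and `x_i` for `i ∈ J₃`. -/
def vVar (i : OuterIdx n n₁ n₂) : Fin n ⊕ Fin n := if (i.1 : ℕ) < n₁ then .inr i else .inl i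

lemma uVar_injective : Function.Injective (uVar (n := n) (n₁ := n₁) (n₂ := n₂)) := by
  intro i j h
  unfold uVar at h
  split_ifs at h <;> simp_all [Subtype.ext_iff]

lemma vVar_injective : Function.Injective (vVar (n := n) (n₁ := n₁) (n₂ := n₂)) := by
  intro i j h
  unfold vVar at h
  split_ifs at h <;> simp_all [Subtype.ext_iff]

lemma uVar_ne_vVar (i j : OuterIdx n n₁ n₂) : uVar i ≠ vVar j := by
  intro h
  unfold uVar vVar at h
  split_ifs at h with h1 h2 h2 <;> simp at h
  · rw [h] at h1
    exact h2 h1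
  · rw [h] at h1
    exact h1 h2

/-- Hence ∑ u_i ∂_{v_i} shifts the ℤ²-degree by (-1, -1), and both terms of the minor u_i v_j - u_j
v_i have the same degree. -/
lemma wt_uVar (h : n₁ ≤ n₂) (i : OuterIdx n n₁ n₂) :
    wt n n₁ n₂ (vVar i) = wt n n₁ n₂ (uVar i) + (1, 1) := by
  obtain ⟨i, hi⟩ := i
  unfold uVar vVar
  by_cases h1 : (i : ℕ) < n₁
  · have h2 : ¬ n₂ ≤ (i : ℕ) := by omega
    simp [wt, h1, h2]
  · have h2 : n₂ ≤ (i : ℕ) := by omega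
    simp [wt, h1, h2]

variable {F : Type*} [Field F]

/-- The polarization preserves the total degree, while the sum over J₂ lowers it by 2: the former is
the leading part. -/
lemma laplace_apply (h : n₁ ≤ n₂) (f : Poly F n) : laplace F n n₁ n₂ f =
    polar F (uVar (n := n) (n₁ := n₁) (n₂ := n₂)) vVar f -
      ∑ i ∈ Finset.univ.filter (fun i : Fin n => n₁ ≤ (i : ℕ) ∧ (i : ℕ) < n₂),
        pderiv (.inl i) (pderiv (.inr i) f) := by
  have hp : polar F (uVar (n := n) (n₁ := n₁) (n₂ := n₂)) vVar f =
      ∑ i ∈ Finset.univ.filter (fun i : Fin n => (i : ℕ) < n₁ ∨ n₂ ≤ (i : ℕ)), if (i : ℕ) < n₁ then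
        X (.inl i) * pderiv (.inr i) f else X (.inr i) * pderiv (.inl i) f := by
    rw [polar_apply, Finset.sum_subtype (p := fun i : Fin n => (i : ℕ) < n₁ ∨ n₂ ≤ (i : ℕ))
      (s := Finset.univ.filter _) (by simp)]
    refine Finset.sum_congr rfl fun i _ => ?_
    unfold uVar vVar
    split_ifs <;> rfl
  rw [hp, laplace_eq F n₁ n₂ h, LinearMap.sum_apply, Finset.sum_filter, Finset.sum_filter,
    ← Finset.sum_sub_distrib]
  refine Finset.sum_congr rfl fun i _ => ?_
  by_cases h1 : (i : ℕ) < n₁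
  · rw [if_pos h1, if_pos (Or.inl h1), if_pos h1, if_neg (by omega), sub_zero]
    rfl
  · by_cases h2 : (i : ℕ) < n₂
    · rw [if_neg h1, if_pos h2, if_neg (by omega), if_pos (by omega), zero_sub]
      rfl
    · rw [if_neg h1, if_neg h2, if_pos (by omega), if_neg h1, if_neg (by omega), sub_zero]
      rfl

lemma polar_isHomogeneous {d : ℕ} {f : Poly F n} (hf : f.IsHomogeneous d) :
    (polar F (uVar (n := n) (n₁ := n₁) (n₂ := n₂)) vVar f).IsHomogeneous d := by
  refine polar_weight (φ := id) (w := (1 : Fin n ⊕ Fin n → ℕ)) fun i => ?_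
  rcases Nat.eq_zero_or_pos d with rfl | hd
  · rw [IsWeightedHomogeneous.pderiv_eq_zero hf (by simp), mul_zero]
    exact isWeightedHomogeneous_zero _ _ _
  · have := (isHomogeneous_X F (uVar i)).mul (hf.pderiv (i := vVar i))
    rwa [show 1 + (d - 1) = d by omega] at this

lemma polar_mem_degLE {d : ℤ} {f : Poly F n} (hf : f ∈ degLE F _ d) :
    polar F (uVar (n := n) (n₁ := n₁) (n₂ := n₂)) vVar f ∈ degLE F _ d := by
  rw [polar_apply]
  refine Submodule.sum_mem _ fun i _ => ?_
  have := degLE_mul (isHomogeneous_X F (uVar i)).mem_degLE (pderiv_mem_degLE (vVar i) hf)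
  exact degLE_mono (by push_cast; omega) this

/-- The leading forms of the elements of `ℋ_⟨ℓ₁,ℓ₂⟩` are annihilated by the leading part of the
Laplace operator. -/
lemma polar_leadForm_eq_zero (h : n₁ ≤ n₂) {f : Poly F n} (hf : laplace F n n₁ n₂ f = 0) {d : ℕ}
    (hd : f ∈ degLE F _ d) :
    polar F (uVar (n := n) (n₁ := n₁) (n₂ := n₂)) vVar (homogeneousComponent d f) = 0 := by
  refine degLE_eq_zero_of_homogeneous
    (polar_isHomogeneous (homogeneousComponent_isHomogeneous d f)) ?_
  rw [laplace_apply h, sub_eq_zero] at hf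
  -- Applied to the leading form, the polarization gives a form of degree d; since the lower terms
  -- of f and the sum over J₂ only produce degree below d, it vanishes.
  have h1 := polar_mem_degLE (n₁ := n₁) (n₂ := n₂) (sub_homogeneousComponent_mem hd)
  have h2 : (∑ i ∈ Finset.univ.filter (fun i : Fin n => n₁ ≤ (i : ℕ) ∧ (i : ℕ) < n₂),
      pderiv (.inl i) (pderiv (.inr i) f)) ∈ degLE F (Fin n ⊕ Fin n) ((d : ℤ) - 1) :=
    Submodule.sum_mem _ fun i _ =>
      degLE_mono (by omega) (pderiv_mem_degLE _ (pderiv_mem_degLE _ hd))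
  rw [map_sub, hf] at h1
  simpa using sub_mem h2 h1

end Leading

/-! ### Products of homogeneous generators -/

section GradedProducts

variable {F R ι M : Type*} [Field F] [CommRing R] [Algebra F R] [Fintype ι]
  [AddCommMonoid M]

/-- The products of `e k` elements of `S k` for all `k`. -/
def genProd (S : ι → Submodule F R) (e : ι → ℕ) : Submodule F R := ∏ k, S k ^ e k

lemma genProd_add (S : ι → Submodule F R) (e e' : ι → ℕ) :
    genProd S (e + e') = genProd S e * genProd S e' := by
  simp [genProd, pow_add, Finset.prod_mul_distrib]

lemma genProd_zero (S : ι → Submodule F R) : genProd S 0 = 1 := by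
  simp [genProd]

lemma genProd_single [DecidableEq ι] (S : ι → Submodule F R) (k : ι) (m : ℕ) :
    genProd S (Pi.single k m) = S k ^ m := by
  rw [genProd, Finset.prod_eq_single k]
  · rw [Pi.single_eq_same]
  · intro j _ hj
    rw [Pi.single_eq_of_ne hj, pow_zero]
  · exact fun h => absurd (Finset.mem_univ k) h

/-- The weight of the products in `genProd S e`. -/
def genWt (w : ι → M) (e : ι → ℕ) : M := ∑ k, e k • w k

lemma genWt_add (w : ι → M) (e e' : ι → ℕ) : genWt w (e + e') = genWt w e + genWt w e' := by
  simp [genWt, add_smul, Finset.sum_add_distrib]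

lemma genWt_single [DecidableEq ι] (w : ι → M) (k : ι) (m : ℕ) :
    genWt w (Pi.single k m) = m • w k := by
  rw [genWt, Finset.sum_eq_single k]
  · rw [Pi.single_eq_same]
  · intro j _ hj
    rw [Pi.single_eq_of_ne hj, zero_smul]
  · exact fun h => absurd (Finset.mem_univ k) h

/-- The span over the subalgebra `B` of the products of generators of total weight `d`. -/
def weightSpan (B : Subalgebra F R) (S : ι → Submodule F R) (w : ι → M) (d : M) : Submodule F R :=
  ⨆ (e : ι → ℕ) (_ : genWt w e = d), Subalgebra.toSubmodule B * genProd S e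

variable {B : Subalgebra F R} {S : ι → Submodule F R} {w : ι → M}

lemma mul_mem_weightSpan_of_mem {d : M} {b f : R} (hb : b ∈ B) (hf : f ∈ weightSpan B S w d) :
    b * f ∈ weightSpan B S w d := by
  have h : Subalgebra.toSubmodule B * weightSpan B S w d ≤ weightSpan B S w d := by
    rw [weightSpan]
    simp only [Submodule.mul_iSup]
    refine iSup₂_mono fun e _ => ?_
    rw [← mul_assoc, Subalgebra.isIdempotentElem_toSubmodule B]
  exact h (Submodule.mul_mem_mul hb hf)

lemma mul_mem_weightSpan {d : M} {k : ι} {g f : R} (hg : g ∈ S k) (hf : f ∈ weightSpan B S w d) :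
    g * f ∈ weightSpan B S w (w k + d) := by
  classical
  have h : S k * weightSpan B S w d ≤ weightSpan B S w (w k + d) := by
    rw [weightSpan]
    simp only [Submodule.mul_iSup]
    refine iSup₂_le fun e he => ?_
    have := le_iSup₂_of_le (f := fun (e : ι → ℕ) (_ : genWt w e = w k + d) =>
      Subalgebra.toSubmodule B * genProd S e) (Pi.single k 1 + e)
      (by rw [genWt_add, genWt_single, one_smul, he]) le_rfl
    refine le_trans (le_of_eq ?_) this
    rw [genProd_add, genProd_single, pow_one, mul_left_comm]
  exact h (Submodule.mul_mem_mul hg hf)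

lemma genProd_le_weightSpan {d : M} {e : ι → ℕ} (he : genWt w e = d) :
    genProd S e ≤ weightSpan B S w d := by
  have := le_iSup₂_of_le (f := fun (e : ι → ℕ) (_ : genWt w e = d) =>
      Subalgebra.toSubmodule B * genProd S e) e he le_rfl
  refine le_trans ?_ this
  calc genProd S e = 1 * genProd S e := (one_mul _).symm
    _ ≤ _ := mul_le_mul' (Submodule.one_le.mpr B.one_mem) le_rfl

variable [DecidableEq ι]

/-- The sum of the products of generators with at most `K` factors of each kind. -/
def boundedProd (S : ι → Submodule F R) (K : ℕ) : Submodule F R :=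
  ⨆ e ∈ Fintype.piFinset fun _ : ι => Finset.range (K + 1), genProd S e

lemma boundedProd_fg (hS : ∀ k, (S k).FG) (K : ℕ) : (boundedProd S K).FG := by
  refine Submodule.fg_biSup _ _ fun e _ => ?_
  rw [genProd]
  have : ∀ s : Finset ι, (∏ k ∈ s, S k ^ e k).FG := by
    intro s
    induction s using Finset.induction_on with
    | empty => exact ⟨{1}, by simp [Submodule.one_eq_span]⟩
    | insert k s hk ih =>
      rw [Finset.prod_insert hk]
      exact ((hS k).pow _).mul ih
  exact this _

lemma boundedProd_zero : boundedProd S 0 = 1 := by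
  have : (Fintype.piFinset fun _ : ι => Finset.range (0 + 1)) = {0} := by
    ext e
    simp [funext_iff]
  rw [boundedProd, this]
  simp [genProd_zero]

/-- If every sufficiently long product of generators of weight `d` contains a factor that belongs to
`B`, then the bounded products generate over `B`. -/
lemma weightSpan_le {d : M} {K : ℕ} (E : Set (ι → ℕ)) (hE : ∀ e ∈ E, genWt w e = 0)
    (hE0 : ∀ e ∈ E, ∑ k, e k ≠ 0)
    (hEB : ∀ e ∈ E, genProd S e ≤ Subalgebra.toSubmodule B)
    (hK : ∀ e : ι → ℕ, genWt w e = d → K < ∑ k, e k → ∃ e' ∈ E, e' ≤ e) :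
    weightSpan B S w d ≤ Subalgebra.toSubmodule B * boundedProd S K := by
  -- Induction on the number of factors: a subproduct of weight zero lying in B is split off and
  -- absorbed, as B · B = B.
  have key : ∀ N : ℕ, ∀ e : ι → ℕ, ∑ k, e k = N → genWt w e = d →
      genProd S e ≤ Subalgebra.toSubmodule B * boundedProd S K := by
    intro N
    induction N using Nat.strong_induction_on with
    | _ N ih =>
      intro e hN he
      by_cases h : K < ∑ k, e k
      · obtain ⟨e', he', hle⟩ := hK e he h
        have hsplit : e = e' + (e - e') := (add_tsub_cancel_of_le hle).symm
        have hw : genWt w (e - e') = d := by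
          rw [hsplit, genWt_add, hE e' he', zero_add] at he
          exact he
        have hs : ∑ k, (e - e') k < N := by
          have h1 : ∑ k, e k = ∑ k, e' k + ∑ k, (e - e') k := by
            conv_lhs => rw [hsplit]
            simp [Finset.sum_add_distrib]
          have := hE0 e' he'
          omega
        rw [hsplit, genProd_add]
        refine (mul_le_mul' (hEB e' he') (ih _ hs _ rfl hw)).trans ?_
        rw [← mul_assoc, Subalgebra.isIdempotentElem_toSubmodule B]
      · have hmem : e ∈ Fintype.piFinset fun _ : ι => Finset.range (K + 1) := by
          rw [Fintype.mem_piFinset]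
          intro k
          have : e k ≤ ∑ k, e k := Finset.single_le_sum (fun _ _ => Nat.zero_le _)
            (Finset.mem_univ k)
          exact Finset.mem_range.mpr (by omega)
        have h1 : genProd S e ≤ boundedProd S K :=
          le_iSup₂_of_le (f := fun (e : ι → ℕ)
            (_ : e ∈ Fintype.piFinset fun _ : ι => Finset.range (K + 1)) => genProd S e)
            e hmem le_rfl
        calc genProd S e = 1 * genProd S e := (one_mul _).symm
          _ ≤ _ := mul_le_mul' (Submodule.one_le.mpr B.one_mem) h1
  refine iSup₂_le fun e he => ?_
  refine (mul_le_mul' le_rfl (key _ e rfl he)).trans ?_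
  rw [← mul_assoc, Subalgebra.isIdempotentElem_toSubmodule B]

end GradedProducts

/-! ### The kernel of the leading part of the Laplace operator -/

section Kernel

variable (F : Type*) [Field F] (n n₁ n₂ : ℕ)

/-- Generators of the kernel of the leading part of the Laplace operator. -/
def kerGen : Fin 6 → Set (Poly F n)
  | 0 => {f | ∃ i : Fin n, (i : ℕ) < n₁ ∧ f = X (.inl i)}
  | 1 => {f | ∃ i : Fin n, n₂ ≤ (i : ℕ) ∧ f = X (.inr i)}
  | 2 => {f | ∃ i : Fin n, (n₁ ≤ (i : ℕ) ∧ (i : ℕ) < n₂) ∧ f = X (.inl i)}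
  | 3 => {f | ∃ i : Fin n, (n₁ ≤ (i : ℕ) ∧ (i : ℕ) < n₂) ∧ f = X (.inr i)}
  | 4 => {f | ∃ i j : Fin n, ((i : ℕ) < n₁ ∧ (j : ℕ) < n₁) ∧
      f = X (.inl i) * X (.inr j) - X (.inl j) * X (.inr i)}
  | 5 => {f | ∃ i j : Fin n, (n₂ ≤ (i : ℕ) ∧ n₂ ≤ (j : ℕ)) ∧
      f = X (.inr i) * X (.inl j) - X (.inr j) * X (.inl i)}

/-- The degrees of the generators. -/
def kerWt : Fin 6 → ℤ × ℤ := ![(-1, 0), (0, -1), (1, 0), (0, 1), (-1, 1), (1, -1)]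

/-- The spans of the generators of each kind. -/
def kerSpan (k : Fin 6) : Submodule F (Poly F n) := Submodule.span F (kerGen F n n₁ n₂ k)

lemma kerGen_finite (k : Fin 6) : (kerGen F n n₁ n₂ k).Finite := by
  have h1 : ∀ (P : Fin n → Prop) (g : Fin n → Poly F n), {f | ∃ i, P i ∧ f = g i}.Finite :=
    fun P g => (Set.finite_range g).subset (by rintro _ ⟨i, -, rfl⟩; exact ⟨i, rfl⟩)
  have h2 : ∀ (P : Fin n → Fin n → Prop) (g : Fin n → Fin n → Poly F n),
      {f | ∃ i j, P i j ∧ f = g i j}.Finite := fun P g =>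
    (Set.finite_range fun p : Fin n × Fin n => g p.1 p.2).subset
      (by rintro _ ⟨i, j, -, rfl⟩; exact ⟨(i, j), rfl⟩)
  fin_cases k
  exacts [h1 _ _, h1 _ _, h1 _ _, h1 _ _, h2 _ _, h2 _ _]

lemma kerSpan_fg (k : Fin 6) : (kerSpan F n n₁ n₂ k).FG :=
  Submodule.fg_span (kerGen_finite F n n₁ n₂ k)

variable {F n n₁ n₂}

lemma unitSym_mem_symbolAlgebra {i j : Fin n} (h : i ≠ j) :
    unitSym F n n₁ n₂ i j ∈ AssocVar.symbolAlgebra (matSym F n n₁ n₂) :=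
  Algebra.subset_adjoin (unitSym_mem_range n₁ n₂ h)

lemma mul_mem_symbolAlgebra_x {i j : Fin n} (hi : (i : ℕ) < n₁) (hj : n₁ ≤ (j : ℕ))
    (hj' : (j : ℕ) < n₂) :
    (X (.inl i) * X (.inl j) : Poly F n) ∈ AssocVar.symbolAlgebra (matSym F n n₁ n₂) := by
  have := neg_mem (unitSym_mem_symbolAlgebra (F := F) (n₁ := n₁) (n₂ := n₂) (i := j) (j := i)
    (by rintro rfl; omega))
  rw [unitSym, if_neg (by omega), if_pos hi, if_neg (by omega), if_neg (by omega)] at this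
  convert! this using 1
  ring

lemma mul_mem_symbolAlgebra_y {i j : Fin n} (hi : n₂ ≤ (i : ℕ)) (hj : n₁ ≤ (j : ℕ))
    (hj' : (j : ℕ) < n₂) :
    (X (.inr i) * X (.inr j) : Poly F n) ∈ AssocVar.symbolAlgebra (matSym F n n₁ n₂) := by
  have := unitSym_mem_symbolAlgebra (F := F) (n₁ := n₁) (n₂ := n₂) (i := i) (j := j)
    (by rintro rfl; omega)
  rw [unitSym, if_neg (by omega), if_neg (by omega), if_neg (by omega), if_pos hi] at this
  convert! this using 1
  ring

/-- In the variables u, v this is the minor u_j v_i - u_i v_j with one index in J₁ and one in J₃: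
mixed minors are symbols. -/
lemma sub_mem_symbolAlgebra (h : n₁ ≤ n₂) {i j : Fin n} (hi : (i : ℕ) < n₁) (hj : n₂ ≤ (j : ℕ)) :
    (X (.inr i) * X (.inr j) - X (.inl i) * X (.inl j) : Poly F n) ∈
      AssocVar.symbolAlgebra (matSym F n n₁ n₂) := by
  have := unitSym_mem_symbolAlgebra (F := F) (n₁ := n₁) (n₂ := n₂) (i := j) (j := i)
    (by rintro rfl; omega)
  rw [unitSym, if_neg (by omega), if_pos hi, if_neg (by omega), if_pos hj] at this
  convert! this using 1
  ring

/-- The minimal collections of generators of total degree zero. -/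
def kerRel : Set (Fin 6 → ℕ) :=
  {![1, 0, 1, 0, 0, 0], ![0, 1, 0, 1, 0, 0], ![0, 0, 0, 0, 1, 1], ![0, 1, 1, 0, 1, 0],
    ![1, 0, 0, 1, 0, 1]}

lemma genWt_kerWt (e : Fin 6 → ℕ) : genWt kerWt e =
    (-(e 0 : ℤ) + e 2 - e 4 + e 5, -(e 1 : ℤ) + e 3 + e 4 - e 5) := by
  simp only [genWt, kerWt, Fin.sum_univ_six]
  ext <;> simp <;> ring

/-- The two products of pairs of variables are symbols up to sign. The other three products are 2 ×
2 determinants of symbols, by Plücker type relations: for instance, a minor from J₁ times a minor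
from J₃ is a determinant of mixed minors. -/
lemma genProd_kerRel_le (h : n₁ ≤ n₂) {e : Fin 6 → ℕ} (he : e ∈ kerRel) :
    genProd (kerSpan F n n₁ n₂) e ≤
      Subalgebra.toSubmodule (AssocVar.symbolAlgebra (matSym F n n₁ n₂)) := by
  set B := AssocVar.symbolAlgebra (matSym F n n₁ n₂) with hB
  have h2 : ∀ s t : Set (Poly F n), (∀ f ∈ s, ∀ g ∈ t, f * g ∈ B) →
      Submodule.span F s * Submodule.span F t ≤ Subalgebra.toSubmodule B := by
    intro s t hst
    rw [Submodule.span_mul_span, Submodule.span_le]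
    rintro _ ⟨f, hf, g, hg, rfl⟩
    exact hst f hf g hg
  have h3 : ∀ s t r : Set (Poly F n), (∀ f ∈ s, ∀ g ∈ t, ∀ k ∈ r, f * g * k ∈ B) →
      Submodule.span F s * Submodule.span F t * Submodule.span F r ≤
        Subalgebra.toSubmodule B := by
    intro s t r hst
    rw [Submodule.span_mul_span]
    refine h2 _ _ ?_
    rintro _ ⟨f, hf, g, hg, rfl⟩ k hk
    exact hst f hf g hg k hk
  simp only [kerRel, Set.mem_insert_iff, Set.mem_singleton_iff] at he
  rcases he with rfl | rfl | rfl | rfl | rfl <;> simp only [genProd, Fin.prod_univ_six] <;>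
    simp only [Matrix.cons_val, pow_zero, pow_one, one_mul, mul_one]
  · refine h2 _ _ ?_
    rintro _ ⟨i, hi, rfl⟩ _ ⟨j, ⟨hj, hj'⟩, rfl⟩
    exact mul_mem_symbolAlgebra_x hi hj hj'
  · refine h2 _ _ ?_
    rintro _ ⟨i, hi, rfl⟩ _ ⟨j, ⟨hj, hj'⟩, rfl⟩
    exact mul_mem_symbolAlgebra_y hi hj hj'
  · refine h2 _ _ ?_
    rintro _ ⟨i, j, ⟨hi, hj⟩, rfl⟩ _ ⟨s, t, ⟨hs, ht⟩, rfl⟩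
    have := sub_mem (mul_mem (sub_mem_symbolAlgebra (F := F) h hi hs)
      (sub_mem_symbolAlgebra h hj ht))
      (mul_mem (sub_mem_symbolAlgebra (F := F) h hi ht) (sub_mem_symbolAlgebra h hj hs))
    convert! this using 1
    ring
  · refine h3 _ _ _ ?_
    rintro _ ⟨s, hs, rfl⟩ _ ⟨r, ⟨hr, hr'⟩, rfl⟩ _ ⟨i, j, ⟨hi, hj⟩, rfl⟩
    have := sub_mem (mul_mem (mul_mem_symbolAlgebra_x (F := F) hi hr hr')
      (sub_mem_symbolAlgebra h hj hs))
      (mul_mem (mul_mem_symbolAlgebra_x (F := F) hj hr hr') (sub_mem_symbolAlgebra h hi hs))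
    convert! this using 1
    ring
  · refine h3 _ _ _ ?_
    rintro _ ⟨i, hi, rfl⟩ _ ⟨r, ⟨hr, hr'⟩, rfl⟩ _ ⟨s, t, ⟨hs, ht⟩, rfl⟩
    have := sub_mem (mul_mem (mul_mem_symbolAlgebra_y (F := F) ht hr hr')
      (sub_mem_symbolAlgebra h hi hs))
      (mul_mem (mul_mem_symbolAlgebra_y (F := F) hs hr hr') (sub_mem_symbolAlgebra h hi ht))
    convert! this using 1
    ring

/-- If no member of `kerRel` divides the product, at most one generator kind of each opposite pair
occurs, and a surviving minor cannot be balanced by variables in both coordinates. Too little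
cancellation is left, and |d| bounds the number of factors. -/
lemma exists_kerRel_le {e : Fin 6 → ℕ} {d : ℤ × ℤ} (he : genWt kerWt e = d)
    (h : 2 * d.1.natAbs + 2 * d.2.natAbs < ∑ k, e k) : ∃ e' ∈ kerRel, e' ≤ e := by
  by_contra! hcon
  simp only [kerRel, Set.mem_insert_iff, Set.mem_singleton_iff, forall_eq_or_imp, forall_eq,
    Pi.le_def, Fin.forall_fin_succ] at hcon
  simp at hcon
  rw [genWt_kerWt] at he
  rw [Fin.sum_univ_six] at h
  have h1 := congrArg Prod.fst he
  have h2 := congrArg Prod.snd he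
  simp only at h1 h2
  omega

lemma weightSpan_kerSpan_le (h : n₁ ≤ n₂) (d : ℤ × ℤ) :
    weightSpan (AssocVar.symbolAlgebra (matSym F n n₁ n₂)) (kerSpan F n n₁ n₂) kerWt d ≤
      Subalgebra.toSubmodule (AssocVar.symbolAlgebra (matSym F n n₁ n₂)) *
        boundedProd (kerSpan F n n₁ n₂) (2 * d.1.natAbs + 2 * d.2.natAbs) := by
  refine weightSpan_le kerRel ?_ ?_ (fun e he => genProd_kerRel_le h he)
    fun e he hK => exists_kerRel_le he hK
  · intro e he
    rw [genWt_kerWt]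
    simp only [kerRel, Set.mem_insert_iff, Set.mem_singleton_iff] at he
    rcases he with rfl | rfl | rfl | rfl | rfl <;> simp
  · intro e he
    rw [Fin.sum_univ_six]
    simp only [kerRel, Set.mem_insert_iff, Set.mem_singleton_iff] at he
    rcases he with rfl | rfl | rfl | rfl | rfl <;> simp

end Kernel

/-! ### The first fundamental theorem for the kernel, and its consequence for the radical. -/

section Kernel

variable {F : Type*} [Field F] {n n₁ n₂ : ℕ}

variable (F n n₁ n₂) in
/-- The span over the symbol algebra of the products of the generators of total degree `d`. -/
abbrev kerWeightSpan (d : ℤ × ℤ) : Submodule F (Poly F n) :=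
  weightSpan (AssocVar.symbolAlgebra (matSym F n n₁ n₂)) (kerSpan F n n₁ n₂) kerWt d

/-- Minors with both indices in J₁ or both in J₃ are generators of kind 4 or 5; mixed ones have
weight zero and lie in the symbol algebra. -/
lemma minor_mul_mem_kerWeightSpan (h : n₁ ≤ n₂) (i j : OuterIdx n n₁ n₂) {d : ℤ × ℤ} {f : Poly F n}
    (hf : f ∈ kerWeightSpan F n n₁ n₂ d) :
    (X (uVar i) * X (vVar j) - X (uVar j) * X (vVar i)) * f ∈
      kerWeightSpan F n n₁ n₂ (wt n n₁ n₂ (uVar i) + wt n n₁ n₂ (vVar j) + d) := by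
  obtain ⟨i, hi⟩ := i
  obtain ⟨j, hj⟩ := j
  unfold uVar vVar
  by_cases hi1 : (i : ℕ) < n₁ <;> by_cases hj1 : (j : ℕ) < n₁
  · have hj2 : ¬ n₂ ≤ (j : ℕ) := by omega
    simp only [hi1, hj1, if_true]
    have hg : (X (.inl i) * X (.inr j) - X (.inl j) * X (.inr i) : Poly F n) ∈
        kerSpan F n n₁ n₂ 4 := Submodule.subset_span ⟨i, j, ⟨hi1, hj1⟩, rfl⟩
    have hw : wt n n₁ n₂ (.inl i) + wt n n₁ n₂ (.inr j) = kerWt 4 := by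
      simp [wt, hi1, hj2, kerWt]
    rw [hw]
    exact mul_mem_weightSpan hg hf
  · have hj2 : n₂ ≤ (j : ℕ) := by omega
    simp only [hi1, hj1, if_true, if_false]
    have := mul_mem_weightSpan_of_mem (neg_mem (sub_mem_symbolAlgebra h hi1 hj2)) hf
    have hw : wt n n₁ n₂ (.inl i) + wt n n₁ n₂ (.inl j) = 0 := by
      simp [wt, hi1, hj1]
    rw [hw, zero_add]
    convert! this using 1
    ring
  · have hi2 : n₂ ≤ (i : ℕ) := by omega
    have hj2 : ¬ n₂ ≤ (j : ℕ) := by omega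
    simp only [hi1, hj1, if_true, if_false]
    have := mul_mem_weightSpan_of_mem (sub_mem_symbolAlgebra h hj1 hi2) hf
    have hw : wt n n₁ n₂ (.inr i) + wt n n₁ n₂ (.inr j) = 0 := by
      simp [wt, hi2, hj2]
    rw [hw, zero_add]
    convert! this using 1
    ring
  · have hi2 : n₂ ≤ (i : ℕ) := by omega
    have hj2 : n₂ ≤ (j : ℕ) := by omega
    simp only [hi1, hj1, if_false]
    have hg : (X (.inr i) * X (.inl j) - X (.inr j) * X (.inl i) : Poly F n) ∈
        kerSpan F n n₁ n₂ 5 := Submodule.subset_span ⟨i, j, ⟨hi2, hj2⟩, rfl⟩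
    have hw : wt n n₁ n₂ (.inr i) + wt n n₁ n₂ (.inl j) = kerWt 5 := by
      simp [wt, hi2, hj1, kerWt]
    rw [hw]
    exact mul_mem_weightSpan hg hf

lemma exists_X_mem_kerSpan {s : Fin n ⊕ Fin n}
    (hs : ∀ i : OuterIdx n n₁ n₂, vVar i ≠ s) :
    ∃ k, kerWt k = wt n n₁ n₂ s ∧ (X s : Poly F n) ∈ kerSpan F n n₁ n₂ k := by
  rcases s with i | i
  · by_cases h1 : (i : ℕ) < n₁
    · exact ⟨0, by simp [kerWt, wt, h1], Submodule.subset_span ⟨i, h1, rfl⟩⟩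
    · by_cases h2 : (i : ℕ) < n₂
      · exact ⟨2, by simp [kerWt, wt, h1], Submodule.subset_span ⟨i, ⟨by omega, h2⟩, rfl⟩⟩
      · exact absurd (by simp [vVar, h1]) (hs ⟨i, Or.inr (by omega)⟩)
  · by_cases h2 : n₂ ≤ (i : ℕ)
    · exact ⟨1, by simp [kerWt, wt, h2], Submodule.subset_span ⟨i, h2, rfl⟩⟩
    · by_cases h1 : (i : ℕ) < n₁
      · exact absurd (by simp [vVar, h1]) (hs ⟨i, Or.inl h1⟩)
      · exact ⟨3, by simp [kerWt, wt, h2], Submodule.subset_span ⟨i, ⟨by omega, by omega⟩, rfl⟩⟩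

lemma exists_monomial_mem_genProd (m : Fin n ⊕ Fin n →₀ ℕ)
    (hm : ∀ i : OuterIdx n n₁ n₂, m (vVar i) = 0) :
    ∃ e, genWt kerWt e = Finsupp.weight (wt n n₁ n₂) m ∧
      monomial m (1 : F) ∈ genProd (kerSpan F n n₁ n₂) e := by
  induction m using Finsupp.induction_linear with
  | zero =>
    refine ⟨0, by simp [genWt], ?_⟩
    rw [genProd_zero]
    exact Submodule.one_le.mp le_rfl
  | add m m' ih ih' =>
    obtain ⟨e, he, hme⟩ := ih fun i => by
      have := hm i
      rw [Finsupp.add_apply] at this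
      omega
    obtain ⟨e', he', hme'⟩ := ih' fun i => by
      have := hm i
      rw [Finsupp.add_apply] at this
      omega
    refine ⟨e + e', by rw [genWt_add, he, he', map_add], ?_⟩
    have := Submodule.mul_mem_mul hme hme'
    rwa [monomial_mul, one_mul, ← genProd_add] at this
  | single s k =>
    rcases Nat.eq_zero_or_pos k with rfl | hk
    · refine ⟨0, by simp [genWt], ?_⟩
      rw [genProd_zero, Finsupp.single_zero]
      exact Submodule.one_le.mp le_rfl
    · obtain ⟨l, hl, hX⟩ := exists_X_mem_kerSpan (F := F) (s := s) fun i hi => by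
        have := hm i
        rw [hi, Finsupp.single_eq_same] at this
        omega
      refine ⟨Pi.single l k, by rw [genWt_single, hl, Finsupp.weight_single], ?_⟩
      rw [genProd_single, ← X_pow_eq_monomial]
      exact Submodule.pow_mem_pow _ hX k

lemma cayley_isWeightedHomogeneous (h : n₁ ≤ n₂) {d : ℤ × ℤ} {f : Poly F n}
    (hf : IsWeightedHomogeneous (wt n n₁ n₂) f d) (i j : OuterIdx n n₁ n₂) :
    IsWeightedHomogeneous (wt n n₁ n₂) (cayley uVar vVar i j f)
      (d - (wt n n₁ n₂ (uVar i) + wt n n₁ n₂ (vVar j))) := by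
  have h1 := der_homog F n₁ n₂ (uVar i) _ (der_homog F n₁ n₂ (vVar j) d hf)
  have h2 := der_homog F n₁ n₂ (uVar j) _ (der_homog F n₁ n₂ (vVar i) d hf)
  refine IsWeightedHomogeneous.sub ?_ ?_
  · convert! h1 using 1
    abel
  · convert! h2 using 1
    rw [wt_uVar h, wt_uVar h]
    abel

lemma countWt_uVar_vVar (i : OuterIdx n n₁ n₂) :
    countWt (uVar (n := n) (n₁ := n₁) (n₂ := n₂)) (vVar i) = 0 :=
  countWt_of_ne _ fun j => uVar_ne_vVar j i

lemma countWt_vVar_uVar (i : OuterIdx n n₁ n₂) :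
    countWt (vVar (n := n) (n₁ := n₁) (n₂ := n₂)) (uVar i) = 0 :=
  countWt_of_ne _ fun j => (uVar_ne_vVar i j).symm

/-- Induction on the degree q in the v_i. For q = 0 only variables that are generators occur.
Otherwise Capelli's identity writes f through minors times Cayley derivatives of f, which remain in
the kernel and have degree q - 1 in the v_i. -/
lemma mem_kerWeightSpan_of_bihomogeneous [CharZero F] (h : n₁ ≤ n₂) (q : ℕ) :
    ∀ (p : ℕ) (d : ℤ × ℤ) (f : Poly F n), IsWeightedHomogeneous (wt n n₁ n₂) f d →
      IsWeightedHomogeneous (countWt (uVar (n := n) (n₁ := n₁) (n₂ := n₂))) f p →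
      IsWeightedHomogeneous (countWt (vVar (n := n) (n₁ := n₁) (n₂ := n₂))) f q →
      polar F (uVar (n := n) (n₁ := n₁) (n₂ := n₂)) vVar f = 0 →
      f ∈ kerWeightSpan F n n₁ n₂ d := by
  induction q with
  | zero =>
    intro p d f hd hp hq hf
    rw [f.as_sum]
    refine Submodule.sum_mem _ fun m hm => ?_
    rw [mem_support_iff] at hm
    have hv : ∀ i : OuterIdx n n₁ n₂, m (vVar i) = 0 := by
      intro i
      have h0 := hq hm
      rw [Finsupp.weight_apply, Finsupp.sum, Finset.sum_eq_zero_iff] at h0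
      by_contra hne
      have := h0 (vVar i) (Finsupp.mem_support_iff.mpr hne)
      rw [countWt_apply _ vVar_injective, smul_eq_mul, mul_one] at this
      exact hne this
    obtain ⟨e, he, hme⟩ := exists_monomial_mem_genProd (F := F) m hv
    rw [← mul_one (coeff m f), ← smul_eq_mul, ← smul_monomial]
    exact Submodule.smul_mem _ _ (genProd_le_weightSpan (he.trans (hd hm)) hme)
  | succ q ih =>
    intro p d f hd hp hq hf
    have hcap := sum_minor_mul_cayley uVar_injective uVar_ne_vVar hf
      (polar_self_of_homogeneous _ hp) (polar_self_of_homogeneous _ hq)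
    -- The constant of Capelli's identity is invertible in characteristic zero.
    have hc : (2 * ((q + 1 : ℕ) : F) * (p + 1)) ≠ 0 :=
      mul_ne_zero (mul_ne_zero two_ne_zero (Nat.cast_ne_zero.mpr (by omega)))
        (Nat.cast_add_one_ne_zero p)
    rw [← inv_smul_smul₀ hc f, ← hcap]
    refine Submodule.smul_mem _ _ (Submodule.sum_mem _ fun i _ => Submodule.sum_mem _ fun j _ => ?_)
    have hu : ∀ i j : OuterIdx n n₁ n₂, IsWeightedHomogeneous
        (countWt (uVar (n := n) (n₁ := n₁) (n₂ := n₂)))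
        (pderiv (uVar i) (pderiv (vVar j) f)) (p - 1) := by
      intro i j
      have := (hp.pderiv_sub (vVar j)).pderiv_sub (uVar i)
      rwa [countWt_uVar_vVar, countWt_apply _ uVar_injective, Nat.sub_zero] at this
    have hv : ∀ i j : OuterIdx n n₁ n₂, IsWeightedHomogeneous
        (countWt (vVar (n := n) (n₁ := n₁) (n₂ := n₂)))
        (pderiv (uVar i) (pderiv (vVar j) f)) q := by
      intro i j
      have := (hq.pderiv_sub (vVar j)).pderiv_sub (uVar i)
      rwa [countWt_vVar_uVar, countWt_apply _ vVar_injective, Nat.sub_zero,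
        Nat.add_sub_cancel] at this
    have := minor_mul_mem_kerWeightSpan h i j
      (ih (p - 1) _ _ (cayley_isWeightedHomogeneous h hd i j)
      ((hu i j).sub (hu j i)) ((hv i j).sub (hv j i))
      (polar_cayley uVar_injective uVar_ne_vVar i j hf))
    rwa [add_sub_cancel] at this

/-- The weight that records the degree in the `u_i` and the total degree in the `u_i` and `v_i`. -/
def biWt (n n₁ n₂ : ℕ) (s : Fin n ⊕ Fin n) : ℕ × ℕ :=
  (countWt (uVar (n := n) (n₁ := n₁) (n₂ := n₂)) s,
    countWt (uVar (n := n) (n₁ := n₁) (n₂ := n₂)) s +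
      countWt (vVar (n := n) (n₁ := n₁) (n₂ := n₂)) s)

lemma weight_biWt (m : Fin n ⊕ Fin n →₀ ℕ) : Finsupp.weight (biWt n n₁ n₂) m =
    (Finsupp.weight (countWt (uVar (n := n) (n₁ := n₁) (n₂ := n₂))) m,
      Finsupp.weight (countWt (uVar (n := n) (n₁ := n₁) (n₂ := n₂))) m +
        Finsupp.weight (countWt (vVar (n := n) (n₁ := n₁) (n₂ := n₂))) m) := by
  simp only [Finsupp.weight_apply, Finsupp.sum, biWt]
  ext
  · simp [Prod.fst_sum]
  · simp [Prod.snd_sum, mul_add, Finset.sum_add_distrib]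

/-- The truncation in t - p causes no loss: if p > t, then f = 0. -/
lemma bihomogeneous_of_biWt {f : Poly F n} {p t : ℕ}
    (hf : IsWeightedHomogeneous (biWt n n₁ n₂) f (p, t)) :
    IsWeightedHomogeneous (countWt (uVar (n := n) (n₁ := n₁) (n₂ := n₂))) f p ∧
      IsWeightedHomogeneous (countWt (vVar (n := n) (n₁ := n₁) (n₂ := n₂))) f (t - p) := by
  constructor <;> intro m hm <;> have := hf hm <;> rw [weight_biWt, Prod.mk.injEq] at this <;> omega

lemma polar_biWt {p t : ℕ} {f : Poly F n} (hf : IsWeightedHomogeneous (biWt n n₁ n₂) f (p, t)) :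
    IsWeightedHomogeneous (biWt n n₁ n₂)
      (polar F (uVar (n := n) (n₁ := n₁) (n₂ := n₂)) vVar f) (p + 1, t) := by
  refine polar_weight (φ := fun a : ℕ × ℕ => (a.1 + 1, a.2)) (m := (p, t)) fun i => ?_
  intro m hm
  rw [mul_comm, coeff_mul_X'] at hm
  split_ifs at hm with hs
  · rw [coeff_pderiv] at hm
    have h1 := hf (left_ne_zero_of_mul hm)
    have h2 : Finsupp.weight (biWt n n₁ n₂) m = Finsupp.weight (biWt n n₁ n₂)
        (m - Finsupp.single (uVar i) 1) + biWt n n₁ n₂ (uVar i) := by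
      have hle : Finsupp.single (uVar i) 1 ≤ m := by
        rw [Finsupp.single_le_iff]
        have := Finsupp.mem_support_iff.mp hs
        omega
      conv_lhs => rw [← tsub_add_cancel_of_le hle, map_add, Finsupp.weight_single, one_smul]
    rw [map_add, Finsupp.weight_single, one_smul] at h1
    rw [h2]
    simp only [biWt, countWt_apply _ uVar_injective, countWt_apply _ vVar_injective,
      countWt_uVar_vVar, countWt_vVar_uVar] at h1 ⊢
    rw [Prod.ext_iff] at h1 ⊢
    simp only [Prod.fst_add, Prod.snd_add] at h1 ⊢
    omega
  · exact absurd rfl hm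

/-- The first fundamental theorem: the polynomials annihilated by the leading part of the Laplace
operator are combinations of products of the generators. -/
theorem mem_kerWeightSpan [CharZero F] (h : n₁ ≤ n₂) {d : ℤ × ℤ} {f : Poly F n}
    (hd : IsWeightedHomogeneous (wt n n₁ n₂) f d)
    (hf : polar F (uVar (n := n) (n₁ := n₁) (n₂ := n₂)) vVar f = 0) :
    f ∈ kerWeightSpan F n n₁ n₂ d := by
  refine mem_of_weightedHomogeneousComponent_mem (biWt n n₁ n₂) _ fun pt => ?_
  obtain ⟨h1, h2⟩ := bihomogeneous_of_biWt (p := pt.1) (t := pt.2)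
    (weightedHomogeneousComponent_isWeightedHomogeneous (w := biWt n n₁ n₂) (n := pt) (φ := f))
  refine mem_kerWeightSpan_of_bihomogeneous h _ _ d _ (hd.weightedHomogeneousComponent pt) h1 h2 ?_
  -- Recording the total degree in place of the degree in the v_i turns the effect of the
  -- polarization into the injective shift (p, t) ↦ (p + 1, t), free of subtraction.
  have := weightedHomogeneousComponent_map (biWt n n₁ n₂)
    (polar F (uVar (n := n) (n₁ := n₁) (n₂ := n₂)) vVar) (fun a : ℕ × ℕ => (a.1 + 1, a.2))
    (fun a b hab => by
      simp only [Prod.mk.injEq] at hab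
      exact Prod.ext (by omega) hab.2)
    (fun m g hg => polar_biWt hg) pt f
  rw [← this, hf, map_zero]

/-- In degree (0, 0) the bound on the number of remaining generators is zero, so only the empty
product is left. -/
lemma mem_symbolAlgebra_of_polar_eq_zero [CharZero F] (h : n₁ ≤ n₂) {f : Poly F n}
    (hd : IsWeightedHomogeneous (wt n n₁ n₂) f 0)
    (hf : polar F (uVar (n := n) (n₁ := n₁) (n₂ := n₂)) vVar f = 0) :
    f ∈ AssocVar.symbolAlgebra (matSym F n n₁ n₂) := by
  have := weightSpan_kerSpan_le h 0 (mem_kerWeightSpan h hd hf)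
  simpa [boundedProd_zero] using this

/-- The radical of the annihilator of the associated graded module of `ℋ_⟨ℓ₁,ℓ₂⟩` is the kernel of
the symbol map. -/
theorem radical_annGr_harmonic [CharZero F] (h : n₁ ≤ n₂) {ℓ₁ ℓ₂ : ℤ}
    {M₀ : Submodule F (harmonic F n n₁ n₂ ℓ₁ ℓ₂)} [FiniteDimensional F M₀] (hM₀ : M₀ ≠ ⊥)
    (hgen : AssocVar.Generates F (LieAlgebra.SpecialLinear.sl (Fin n) F) M₀) :
    (AssocVar.annGr (L := LieAlgebra.SpecialLinear.sl (Fin n) F) M₀).radical =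
      RingHom.ker (SymmetricAlgebra.lift (matSym F n n₁ n₂)) := by
  have H := quadRealization_harmonic (F := F) (n := n) n₁ n₂ ℓ₁ ℓ₂
  have hle : ∀ d, AssocVar.leadForms (harmonicIncl F n n₁ n₂ ℓ₁ ℓ₂) d ≤
      Subalgebra.toSubmodule (AssocVar.symbolAlgebra (matSym F n n₁ n₂)) *
        boundedProd (kerSpan F n n₁ n₂) (2 * ℓ₁.natAbs + 2 * ℓ₂.natAbs) := by
    rintro d _ ⟨v, hv, rfl⟩
    have hhom : IsWeightedHomogeneous (wt n n₁ n₂) (harmonicIncl F n n₁ n₂ ℓ₁ ℓ₂ v) (ℓ₁, ℓ₂) :=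
      v.2.1
    have hlap : laplace F n n₁ n₂ (harmonicIncl F n n₁ n₂ ℓ₁ ℓ₂ v) = 0 := v.2.2
    -- Leading forms inherit the ℤ²-degree (ℓ₁, ℓ₂) and lie in the kernel of the leading part, so
    -- one finitely generated module contains them for all d.
    exact weightSpan_kerSpan_le h (ℓ₁, ℓ₂) (mem_kerWeightSpan h
      (hhom.weightedHomogeneousComponent (w' := 1) d) (polar_leadForm_eq_zero h hlap hv))
  obtain ⟨c, hc⟩ := AssocVar.exists_mem_filtZ_of_degLE H hgen
    (boundedProd_fg (kerSpan_fg F n n₁ n₂) _) hle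
  exact AssocVar.radical_annGr_eq_ker H hM₀ hc

end Kernel

end Osc

/-! ### Graded pieces of the symbol algebra. -/

namespace AssocVar

attribute [local instance 100] LieRing.ofAssociativeRing

variable {F : Type*} {L : Type*} [Field F] [LieRing L] [LieAlgebra F L]

lemma isHomogeneous_of_mem_range_pow {σ : Type*} {sym : L →ₗ[F] MvPolynomial σ F} {e : ℕ}
    (h : ∀ ξ, (sym ξ).IsHomogeneous e) {k : ℕ} {f : MvPolynomial σ F}
    (hf : f ∈ LinearMap.range sym ^ k) : f.IsHomogeneous (e * k) := by
  induction hf using Submodule.pow_induction_on_left' with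
  | algebraMap r =>
    rw [mul_zero]
    exact isHomogeneous_C _ r
  | add x y i _ _ hx hy => exact hx.add hy
  | mem_mul m hm i x _ hx =>
    obtain ⟨ξ, rfl⟩ := hm
    have := (h ξ).mul hx
    rwa [show e + e * i = e * (i + 1) by ring] at this

/-- Lift f to S(L) and split the lift by degree; as the symbols are forms of degree e ≠ 0, only the
part in S^k(L) contributes to polynomial degree ek. -/
lemma mem_range_pow_of_mem_symbolAlgebra {σ : Type*} {sym : L →ₗ[F] MvPolynomial σ F} {e : ℕ}
    (he : e ≠ 0) (h : ∀ ξ, (sym ξ).IsHomogeneous e) {k : ℕ} {f : MvPolynomial σ F}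
    (hf : f ∈ symbolAlgebra sym) (hk : f.IsHomogeneous (e * k)) :
    f ∈ LinearMap.range sym ^ k := by
  have hle : symbolAlgebra sym ≤ (SymmetricAlgebra.lift sym).range := by
    refine Algebra.adjoin_le ?_
    rintro _ ⟨ξ, rfl⟩
    exact ⟨SymmetricAlgebra.ι F L ξ, SymmetricAlgebra.lift_ι_apply sym ξ⟩
  obtain ⟨s, hs⟩ := hle hf
  obtain ⟨c, hc, rfl⟩ := exists_sum_symPiece s
  have hc' : ∀ j, SymmetricAlgebra.lift sym (c j) ∈ LinearMap.range sym ^ j := fun j => by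
    rw [← map_symPiece]
    exact ⟨_, hc j, rfl⟩
  rw [← homogeneousComponent_eq_self hk, ← hs]
  change homogeneousComponent (e * k) (SymmetricAlgebra.lift sym _) ∈ _
  rw [map_sum, map_sum]
  refine Submodule.sum_mem _ fun j _ => ?_
  rw [homogeneousComponent_of_mem (isHomogeneous_of_mem_range_pow h (hc' j))]
  split_ifs with hj
  · rw [Nat.eq_of_mul_eq_mul_left (Nat.pos_of_ne_zero he) hj]
    exact hc' j
  · exact zero_mem _

end AssocVar

/-! ### Dimensions of the graded pieces by sl₂-theory. -/

namespace Osc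

attribute [local instance 100] LieRing.ofAssociativeRing

variable {F : Type*} [Field F] {n n₁ n₂ : ℕ}

variable (F n n₁ n₂) in
/-- The space of the forms of degree `e` and weight `d`. -/
def formSpace (d : ℤ × ℤ) (e : ℕ) : Submodule F (Poly F n) :=
  weightedHomogeneousSubmodule F (wt n n₁ n₂) d ⊓ homogeneousSubmodule (Fin n ⊕ Fin n) F e

lemma polar_mul_eq_zero {κ : Type*} [Fintype κ] {σ : Type*} {u v : κ → σ} {f g : MvPolynomial σ F}
    (hf : polar F u v f = 0) (hg : polar F u v g = 0) : polar F u v (f * g) = 0 := by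
  have : polar F u v (f * g) = g * polar F u v f + f * polar F u v g := by
    simp only [polar_apply, Finset.mul_sum, ← Finset.sum_add_distrib, pderiv_mul]
    exact Finset.sum_congr rfl fun i _ => by ring
  rw [this, hf, hg, mul_zero, mul_zero, add_zero]

lemma polar_X {κ : Type*} [Fintype κ] {σ : Type*} {u v : κ → σ} (hv : Function.Injective v)
    (i : κ) : polar F u v (X (v i)) = X (u i) := by
  classical
  rw [polar_apply, Finset.sum_eq_single i]
  · simp
  · intro j _ hj
    rw [pderiv_X, Pi.single_eq_of_ne (hv.ne hj.symm), mul_zero]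
  · simp

lemma polar_X_of_ne {κ : Type*} [Fintype κ] {σ : Type*} {u v : κ → σ} {s : σ}
    (hs : ∀ i, v i ≠ s) : polar F u v (X s) = 0 := by
  classical
  rw [polar_apply]
  refine Finset.sum_eq_zero fun i _ => ?_
  rw [pderiv_X, Pi.single_eq_of_ne (hs i).symm, mul_zero]

lemma polar_X_inl (h : n₁ ≤ n₂) (i : Fin n) :
    polar F (uVar (n := n) (n₁ := n₁) (n₂ := n₂)) vVar (X (.inl i)) =
      if n₂ ≤ (i : ℕ) then X (.inr i) else 0 := by
  split_ifs with h2
  · have := polar_X (F := F) (u := uVar (n := n) (n₁ := n₁) (n₂ := n₂)) vVar_injective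
      ⟨i, Or.inr h2⟩
    simpa [uVar, vVar, show ¬ (i : ℕ) < n₁ by omega] using this
  · refine polar_X_of_ne fun j hj => ?_
    obtain ⟨j, hj'⟩ := j
    unfold vVar at hj
    split_ifs at hj with h1
    simp only [Sum.inl.injEq] at hj
    have hji : (j : ℕ) = i := congrArg _ hj
    simp only at h1
    omega

lemma polar_X_inr (i : Fin n) :
    polar F (uVar (n := n) (n₁ := n₁) (n₂ := n₂)) vVar (X (.inr i)) =
      if (i : ℕ) < n₁ then X (.inl i) else 0 := by
  split_ifs with h2
  · have := polar_X (F := F) (u := uVar (n := n) (n₁ := n₁) (n₂ := n₂)) vVar_injective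
      ⟨i, Or.inl h2⟩
    simpa [uVar, vVar, h2] using this
  · refine polar_X_of_ne fun j hj => ?_
    obtain ⟨j, hj'⟩ := j
    unfold vVar at hj
    split_ifs at hj with h1
    simp only [Sum.inr.injEq] at hj
    have hji : (j : ℕ) = i := congrArg _ hj
    simp only at h1
    omega

lemma polar_X_mul_X {κ : Type*} [Fintype κ] {σ : Type*} {u v : κ → σ} (s t : σ) :
    polar F u v (X s * X t) = X t * polar F u v (X s) + X s * polar F u v (X t) := by
  simp only [polar_apply, Finset.mul_sum, ← Finset.sum_add_distrib, pderiv_mul]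
  exact Finset.sum_congr rfl fun i _ => by ring

/-- A nonzero symbol is, up to sign, a mixed minor or the product of some u_i with a variable
indexed by J₂; all of these are killed. -/
lemma polar_unitSym (h : n₁ ≤ n₂) (i j : Fin n) :
    polar F (uVar (n := n) (n₁ := n₁) (n₂ := n₂)) vVar (unitSym F n n₁ n₂ i j) = 0 := by
  unfold unitSym
  split_ifs <;>
    simp only [zero_mul, mul_zero, mul_neg, map_neg, map_sub, map_zero, sub_zero, polar_X_mul_X,
      polar_X_inl h, polar_X_inr, *, if_true, if_false] <;> first | omega | ring

lemma unitSym_mem_formSpace (i j : Fin n) :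
    unitSym F n n₁ n₂ i j ∈ formSpace F n n₁ n₂ 0 2 := by
  have hX : ∀ s t, wt n n₁ n₂ s + wt n n₁ n₂ t = 0 →
      (X s * X t : Poly F n) ∈ formSpace F n n₁ n₂ 0 2 := fun s t hst =>
    ⟨hst ▸ (isWeightedHomogeneous_X F _ s).mul (isWeightedHomogeneous_X F _ t),
      (isHomogeneous_X F s).mul (isHomogeneous_X F t)⟩
  unfold unitSym
  refine sub_mem ?_ ?_
  · split_ifs with h1 h2 h2
    · rw [zero_mul]; exact zero_mem _
    · rw [zero_mul]; exact zero_mem _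
    · rw [mul_neg]
      exact neg_mem (hX _ _ (by simp [wt, h1, h2]))
    · rw [mul_zero]; exact zero_mem _
  · split_ifs with h1 h2 h2
    · rw [zero_mul]; exact zero_mem _
    · rw [zero_mul]; exact zero_mem _
    · rw [mul_neg]
      exact neg_mem (hX _ _ (by simp [wt, h1, h2]))
    · rw [mul_zero]; exact zero_mem _

lemma matSym_isHomogeneous (A : LieAlgebra.SpecialLinear.sl (Fin n) F) :
    (matSym F n n₁ n₂ A).IsHomogeneous 2 :=
  (quadRealization_harmonic (F := F) n₁ n₂ 0 0).homogeneous A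

/-- The forms of degree `k` in the symbols. -/
lemma range_matSym_pow [CharZero F] (h : n₁ ≤ n₂) (k : ℕ) :
    LinearMap.range (matSym F n n₁ n₂) ^ k = formSpace F n n₁ n₂ 0 (2 * k) ⊓
      LinearMap.ker (polar F (uVar (n := n) (n₁ := n₁) (n₂ := n₂)) vVar) := by
  apply le_antisymm
  · intro f hf
    have h1 : (matSym F n n₁ n₂).range ≤ formSpace F n n₁ n₂ 0 2 ⊓
        LinearMap.ker (polar F (uVar (n := n) (n₁ := n₁) (n₂ := n₂)) vVar) := by
      rintro _ ⟨A, rfl⟩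
      change ∑ i, ∑ j, A.val i j • unitSym F n n₁ n₂ i j ∈ _
      refine Submodule.sum_mem _ fun i _ => Submodule.sum_mem _ fun j _ =>
        Submodule.smul_mem _ _ ?_
      exact ⟨unitSym_mem_formSpace i j, polar_unitSym h i j⟩
    refine ⟨⟨?_, AssocVar.isHomogeneous_of_mem_range_pow matSym_isHomogeneous hf⟩, ?_⟩
    · change IsWeightedHomogeneous (wt n n₁ n₂) f 0
      induction hf using Submodule.pow_induction_on_left' with
      | algebraMap r => exact isWeightedHomogeneous_C _ r
      | add x y i _ _ hx hy => exact hx.add hy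
      | mem_mul m hm i x _ hx =>
        have h2 : IsWeightedHomogeneous (wt n n₁ n₂) m 0 := (h1 hm).1.1
        simpa using h2.mul hx
    · change polar F (uVar (n := n) (n₁ := n₁) (n₂ := n₂)) vVar f = 0
      induction hf using Submodule.pow_induction_on_left' with
      | algebraMap r =>
        rw [polar_apply]
        exact Finset.sum_eq_zero fun i _ => by rw [algebraMap_eq, pderiv_C, mul_zero]
      | add x y i _ _ hx hy => rw [map_add, hx, hy, add_zero]
      | mem_mul m hm i x _ hx => exact polar_mul_eq_zero (h1 hm).2 hx
  · rintro f ⟨⟨h1, h2⟩, h3⟩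
    exact AssocVar.mem_range_pow_of_mem_symbolAlgebra two_ne_zero matSym_isHomogeneous
      (mem_symbolAlgebra_of_polar_eq_zero h h1 h3) h2

lemma polar_mem_formSpace (h : n₁ ≤ n₂) {d : ℤ × ℤ} {e : ℕ} {f : Poly F n}
    (hf : f ∈ formSpace F n n₁ n₂ d e) :
    polar F (uVar (n := n) (n₁ := n₁) (n₂ := n₂)) vVar f ∈
      formSpace F n n₁ n₂ (d - (1, 1)) e := by
  refine ⟨?_, polar_isHomogeneous hf.2⟩
  refine polar_weight (φ := fun d => d - (1, 1)) fun i => ?_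
  have := mulVar_homog F n₁ n₂ (uVar i) _ (der_homog F n₁ n₂ (vVar i) d hf.1)
  rw [wt_uVar h] at this
  convert! this using 1
  abel

lemma polar_swap_mem_formSpace (h : n₁ ≤ n₂) {d : ℤ × ℤ} {e : ℕ} {f : Poly F n}
    (hf : f ∈ formSpace F n n₁ n₂ d e) :
    polar F (vVar (n := n) (n₁ := n₁) (n₂ := n₂)) uVar f ∈
      formSpace F n n₁ n₂ (d + (1, 1)) e := by
  refine ⟨?_, ?_⟩
  · refine polar_weight (φ := fun d => d + (1, 1)) fun i => ?_
    have := mulVar_homog F n₁ n₂ (vVar i) _ (der_homog F n₁ n₂ (uVar i) d hf.1)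
    rw [wt_uVar h] at this
    convert! this using 1
    abel
  · refine polar_weight (φ := id) (w := (1 : Fin n ⊕ Fin n → ℕ)) fun i => ?_
    have hf2 : f.IsHomogeneous e := hf.2
    rcases Nat.eq_zero_or_pos e with rfl | he
    · rw [IsWeightedHomogeneous.pderiv_eq_zero hf2 (by simp), mul_zero]
      exact isWeightedHomogeneous_zero _ _ _
    · have := (isHomogeneous_X F (vVar i)).mul (hf2.pderiv (i := uVar i))
      rwa [show 1 + (e - 1) = e by omega] at this

/-- Equality holds for the u_i and the v_i, and the variables indexed by J₂ leave a slack of 1.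
Summed over a monomial of weight (-1, -1), this shows that its degree in the v_i is at least 2 below
that in the u_i. -/
lemma countWt_vVar_le (h : n₁ ≤ n₂) (s : Fin n ⊕ Fin n) :
    (countWt (vVar (n := n) (n₁ := n₁) (n₂ := n₂)) s : ℤ) ≤
      (wt n n₁ n₂ s).1 + (wt n n₁ n₂ s).2 +
        countWt (uVar (n := n) (n₁ := n₁) (n₂ := n₂)) s := by
  by_cases hu : ∃ i : OuterIdx n n₁ n₂, uVar i = s
  · obtain ⟨i, rfl⟩ := hu
    rw [countWt_apply _ uVar_injective, countWt_vVar_uVar]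
    rcases i with ⟨i, hi⟩
    by_cases h1 : (i : ℕ) < n₁
    · simp [uVar, wt, h1]
    · simp [uVar, wt, h1, show n₂ ≤ (i : ℕ) by omega]
  · rw [countWt_of_ne uVar (by simpa using hu)]
    have hw : (wt n n₁ n₂ s).1 + (wt n n₁ n₂ s).2 = 1 := by
      rcases s with i | i
      · by_cases h1 : (i : ℕ) < n₁
        · exact absurd ⟨⟨i, Or.inl h1⟩, by simp [uVar, h1]⟩ hu
        · simp [wt, h1]
      · by_cases h1 : n₂ ≤ (i : ℕ)
        · exact absurd ⟨⟨i, Or.inr h1⟩, by simp [uVar, show ¬ (i : ℕ) < n₁ by omega]⟩ hu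
        · simp [wt, h1]
    rw [hw]
    by_cases hv : ∃ i : OuterIdx n n₁ n₂, vVar i = s
    · obtain ⟨i, rfl⟩ := hv
      simp [countWt_apply _ vVar_injective]
    · simp [countWt_of_ne vVar (by simpa using hv)]

lemma weight_countWt_vVar_le (h : n₁ ≤ n₂) (m : Fin n ⊕ Fin n →₀ ℕ) :
    (Finsupp.weight (countWt (vVar (n := n) (n₁ := n₁) (n₂ := n₂))) m : ℤ) ≤
      (Finsupp.weight (wt n n₁ n₂) m).1 + (Finsupp.weight (wt n n₁ n₂) m).2 +
        Finsupp.weight (countWt (uVar (n := n) (n₁ := n₁) (n₂ := n₂))) m := by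
  simp only [Finsupp.weight_apply, Finsupp.sum, Prod.fst_sum, Prod.snd_sum, Prod.smul_fst,
    Prod.smul_snd, Nat.cast_sum, ← Finset.sum_add_distrib]
  refine Finset.sum_le_sum fun s _ => ?_
  have := mul_le_mul_of_nonneg_left (countWt_vVar_le (n := n) h s) (Int.natCast_nonneg (m s))
  simp only [smul_eq_mul, nsmul_eq_mul, Nat.cast_mul]
  linarith

/-- The polarization is the raising operator of an sl₂ and is nilpotent on each form. On forms of
ℤ²-degree (-1, -1) the sl₂-weight is positive, so every such form lies in the image. -/
lemma polar_map_formSpace [CharZero F] (h : n₁ ≤ n₂) (e : ℕ) :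
    (formSpace F n n₁ n₂ 0 e).map (polar F (uVar (n := n) (n₁ := n₁) (n₂ := n₂)) vVar) =
      formSpace F n n₁ n₂ (-1, -1) e := by
  have hraise : ∀ f ∈ formSpace F n n₁ n₂ 0 e,
      polar F (uVar (n := n) (n₁ := n₁) (n₂ := n₂)) vVar f ∈ formSpace F n n₁ n₂ (-1, -1) e := by
    intro f hf
    simpa using polar_mem_formSpace h hf
  have hlower : ∀ f ∈ formSpace F n n₁ n₂ (-1, -1) e,
      polar F (vVar (n := n) (n₁ := n₁) (n₂ := n₂)) uVar f ∈ formSpace F n n₁ n₂ 0 e := by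
    intro f hf
    have := polar_swap_mem_formSpace h hf
    rwa [show ((-1, -1) : ℤ × ℤ) + (1, 1) = 0 from rfl] at this
  refine le_antisymm (Submodule.map_le_iff_le_comap.mpr hraise) fun f hf => ?_
  refine mem_of_weightedHomogeneousComponent_mem (biWt n n₁ n₂) _ fun pt => ?_
  have hg : weightedHomogeneousComponent (biWt n n₁ n₂) pt f ∈ formSpace F n n₁ n₂ (-1, -1) e :=
    ⟨IsWeightedHomogeneous.weightedHomogeneousComponent hf.1 pt,
      IsWeightedHomogeneous.weightedHomogeneousComponent (w := 1) hf.2 pt⟩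
  have hbi : IsWeightedHomogeneous (biWt n n₁ n₂)
      (weightedHomogeneousComponent (biWt n n₁ n₂) pt f) pt :=
    weightedHomogeneousComponent_isWeightedHomogeneous ..
  generalize weightedHomogeneousComponent (biWt n n₁ n₂) pt f = g at hg hbi
  obtain ⟨p, t⟩ := pt
  by_cases h0 : g = 0
  · rw [h0]
    exact zero_mem _
  obtain ⟨m, hm⟩ := ne_zero_iff.mp h0
  have hpq : t - p < p := by
    have h1 := hbi hm
    have h2 : Finsupp.weight (wt n n₁ n₂) m = (-1, -1) := hg.1 hm
    have h3 := weight_countWt_vVar_le h m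
    rw [weight_biWt, Prod.mk.injEq] at h1
    rw [h2] at h3
    omega
  obtain ⟨hp, hq⟩ := bihomogeneous_of_biWt hbi
  have hnil : ∀ N, IsWeightedHomogeneous (biWt n n₁ n₂)
      ((polar F (uVar (n := n) (n₁ := n₁) (n₂ := n₂)) vVar ^ N) g) (p + N, t) := by
    intro N
    induction N with
    | zero => simpa using hbi
    | succ N ih =>
      rw [pow_succ', Module.End.mul_apply]
      exact polar_biWt ih
  -- The degree in the u_i would become p + t + 1, which exceeds the degree t in all the u_i and
  -- v_i.
  have hnil' : (polar F (uVar (n := n) (n₁ := n₁) (n₂ := n₂)) vVar ^ (t + 1)) g = 0 := by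
    by_contra hne
    obtain ⟨m, hm⟩ := ne_zero_iff.mp hne
    have := hnil (t + 1) hm
    rw [weight_biWt, Prod.mk.injEq] at this
    omega
  have hc : ∀ N : ℕ, ((p - (t - p) : ℕ) : F) + N ≠ 0 := by
    intro N
    rw [← Nat.cast_add, Nat.cast_ne_zero]
    omega
  obtain ⟨x, hx, hxg⟩ := sl2_exists_raising_eq
    (e := polar F (uVar (n := n) (n₁ := n₁) (n₂ := n₂)) vVar) (f := polar F vVar uVar)
    (h := polar F uVar uVar - polar F vVar vVar)
    (polar_mul_polar uVar_injective vVar_injective)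
    (by
      rw [sub_mul, mul_sub, polar_self_mul uVar_injective uVar_ne_vVar,
        polar_self_mul' vVar_injective uVar_ne_vVar, two_smul]
      abel)
    (by
      rw [sub_mul, mul_sub, polar_self_mul vVar_injective fun i j => (uVar_ne_vVar j i).symm,
        polar_self_mul' uVar_injective fun i j => (uVar_ne_vVar j i).symm, two_smul]
      abel)
    hraise hlower hc (t + 1) g hg
    (by
      rw [LinearMap.sub_apply, polar_self_of_homogeneous _ hp, polar_self_of_homogeneous _ hq,
        ← sub_smul, Nat.cast_sub (by omega : t - p ≤ p)])
    hnil'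
  exact ⟨x, hx, hxg⟩

lemma formSpace_finiteDimensional (d : ℤ × ℤ) (e : ℕ) :
    FiniteDimensional F (formSpace F n n₁ n₂ d e) := by
  refine Submodule.finiteDimensional_of_le (S₂ := degLE F (Fin n ⊕ Fin n) e) fun f hf => ?_
  exact IsHomogeneous.mem_degLE hf.2

/-- Rank and nullity of the polarization on forms of weight (0, 0): its kernel is the span of the
products of k symbols, its image is everything of weight (-1, -1). -/
lemma finrank_range_matSym_pow [CharZero F] (h : n₁ ≤ n₂) (k : ℕ) :
    Module.finrank F (formSpace F n n₁ n₂ 0 (2 * k)) =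
      Module.finrank F (formSpace F n n₁ n₂ (-1, -1) (2 * k)) +
        Module.finrank F ↥(LinearMap.range (matSym F n n₁ n₂) ^ k) := by
  have := formSpace_finiteDimensional (F := F) (n := n) (n₁ := n₁) (n₂ := n₂) 0 (2 * k)
  set T := polar F (uVar (n := n) (n₁ := n₁) (n₂ := n₂)) vVar with hT
  have h1 := (T.domRestrict (formSpace F n n₁ n₂ 0 (2 * k))).finrank_range_add_finrank_ker
  rw [LinearMap.range_domRestrict, polar_map_formSpace h] at h1
  rw [← h1, range_matSym_pow h, LinearMap.ker_domRestrict]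
  congr 1
  have h2 : (LinearMap.ker T).comap (formSpace F n n₁ n₂ 0 (2 * k)).subtype =
      (formSpace F n n₁ n₂ 0 (2 * k) ⊓ LinearMap.ker T).comap
        (formSpace F n n₁ n₂ 0 (2 * k)).subtype := by
    rw [Submodule.comap_inf, Submodule.comap_subtype_self, top_inf_eq]
  rw [h2]
  exact (Submodule.comapSubtypeEquivOfLe inf_le_left).finrank_eq

end Osc

/-! ### Counting exponents with prescribed block sums. -/

section Count

variable {σ κ : Type*} [Fintype σ] [Fintype κ] [DecidableEq κ]

/-- The number of exponents with prescribed sums over the blocks of a partition. -/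
lemma card_blockSum (bl : σ → κ) (s : κ → ℕ) :
    Nat.card {m : σ →₀ ℕ // ∀ b, ∑ i : {i // bl i = b}, m i = s b} =
      ∏ b, Nat.multichoose (Fintype.card {i // bl i = b}) (s b) := by
  have e : {m : σ →₀ ℕ // ∀ b, ∑ i : {i // bl i = b}, m i = s b} ≃
      ((b : κ) → {P : {i // bl i = b} → ℕ // ∑ i, P i = s b}) :=
    { toFun := fun m b => ⟨fun i => m.1 i, m.2 b⟩
      invFun := fun P => ⟨Finsupp.equivFunOnFinite.symm fun i => (P (bl i)).1 ⟨i, rfl⟩, fun b => by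
        rw [← (P b).2]
        refine Finset.sum_congr rfl fun i _ => ?_
        obtain ⟨i, rfl⟩ := i
        rfl⟩
      left_inv := fun m => by
        ext i
        rfl
      right_inv := fun P => by
        funext b
        ext ⟨i, rfl⟩
        rfl }
  rw [Nat.card_congr e, Nat.card_pi]
  refine Finset.prod_congr rfl fun b _ => ?_
  classical
  rw [← Nat.card_congr (Sym.equivNatSumOfFintype _ _), Nat.card_eq_fintype_card,
    Sym.card_sym_eq_multichoose]

lemma finite_blockSum (bl : σ → κ) (s : κ → ℕ) :
    Finite {m : σ →₀ ℕ // ∀ b, ∑ i : {i // bl i = b}, m i = s b} := by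
  refine Set.Finite.subset (Finsupp.finite_of_degree_le (∑ b, s b)) fun m hm => ?_
  change m.degree ≤ _
  rw [Finsupp.degree_eq_sum, ← Fintype.sum_fiberwise bl]
  exact (Finset.sum_congr rfl fun b _ => hm b).le

/-- Injectivity of s makes the union over t disjoint. -/
lemma card_of_blockSum {T : Type*} (bl : σ → κ) (t : Finset T) (s : T → κ → ℕ)
    (hs : Function.Injective s) (S : Set (σ →₀ ℕ))
    (hS : ∀ m, m ∈ S ↔ ∃ p ∈ t, ∀ b, ∑ i : {i // bl i = b}, m i = s p b) :
    Nat.card S = ∑ p ∈ t, ∏ b, Nat.multichoose (Fintype.card {i // bl i = b}) (s p b) := by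
  have e : (Σ p : t, {m : σ →₀ ℕ // ∀ b, ∑ i : {i // bl i = b}, m i = s p b}) ≃ S := by
    refine Equiv.ofBijective (fun x => ⟨x.2.1, (hS _).mpr ⟨x.1, x.1.2, x.2.2⟩⟩) ⟨?_, ?_⟩
    · rintro ⟨p, m, hm⟩ ⟨q, m', hm'⟩ h
      simp only [Subtype.mk.injEq] at h
      subst h
      obtain rfl : p = q := Subtype.ext (hs (funext fun b => (hm b).symm.trans (hm' b)))
      rfl
    · rintro ⟨m, hm⟩
      obtain ⟨p, hp, h⟩ := (hS m).mp hm
      exact ⟨⟨⟨p, hp⟩, m, h⟩, rfl⟩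
  have := fun p : t => finite_blockSum bl (s p)
  rw [← Nat.card_congr e, Nat.card_sigma, ← Finset.sum_coe_sort t]
  exact Finset.sum_congr rfl fun p _ => card_blockSum bl (s p)

end Count

/-! ### Dimensions of the spaces of forms. -/

namespace Osc

variable {F : Type*} [Field F] {n n₁ n₂ : ℕ}

variable (n n₁ n₂) in
/-- The blocks of variables of the same weight. -/
def block : Fin n ⊕ Fin n → Fin 4
  | .inl i => if (i : ℕ) < n₁ then 0 else 1
  | .inr i => if n₂ ≤ (i : ℕ) then 2 else 3

lemma sum_ite_lt (h : n₁ ≤ n) : (∑ i : Fin n, if (i : ℕ) < n₁ then 1 else 0) = n₁ := by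
  rw [Fin.sum_univ_eq_sum_range (fun i => if i < n₁ then 1 else 0), ← Finset.card_filter]
  conv_rhs => rw [← Finset.card_range n₁]
  congr 1
  ext i
  simp only [Finset.mem_filter, Finset.mem_range]
  omega

lemma sum_ite_not_lt (h : n₁ ≤ n) :
    (∑ i : Fin n, if (i : ℕ) < n₁ then 0 else 1) = n - n₁ := by
  have h1 : (∑ i : Fin n, if (i : ℕ) < n₁ then 0 else 1) +
      (∑ i : Fin n, if (i : ℕ) < n₁ then 1 else 0) = n := by
    rw [← Finset.sum_add_distrib]
    refine (Finset.sum_congr rfl fun i _ => ?_).trans (b := ∑ i : Fin n, 1) (by simp)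
    split_ifs <;> rfl
  rw [sum_ite_lt h] at h1
  omega

lemma card_block (h₁ : n₁ ≤ n) (h₂ : n₂ ≤ n) (b : Fin 4) :
    Fintype.card {i // block n n₁ n₂ i = b} = ![n₁, n - n₁, n - n₂, n₂] b := by
  rw [Fintype.card_subtype, Finset.card_filter, Fintype.sum_sum_type]
  have h1 : ∀ i : Fin n, block n n₁ n₂ (.inl i) = if (i : ℕ) < n₁ then 0 else 1 := fun _ => rfl
  have h2 : ∀ i : Fin n, block n n₁ n₂ (.inr i) = if (i : ℕ) < n₂ then 3 else 2 := fun i => by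
    simp only [block]
    split_ifs <;> first | rfl | omega
  simp only [h1, h2]
  have key : ∀ (P : Prop) [Decidable P] (x y b : Fin 4),
      (if (if P then x else y) = b then 1 else 0) =
        if P then (if x = b then 1 else 0) else (if y = b then 1 else 0) := by
    intro P _ x y b
    split_ifs <;> rfl
  simp only [key]
  fin_cases b
  · simp only [Fin.reduceFinMk, Fin.reduceEq, if_true, if_false]
    simpa using sum_ite_lt h₁
  · simp only [Fin.reduceFinMk, Fin.reduceEq, if_true, if_false]
    rw [sum_ite_not_lt h₁]
    simp
  · simp only [Fin.reduceFinMk, Fin.reduceEq, if_true, if_false]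
    rw [sum_ite_not_lt h₂]
    simp
  · simp only [Fin.reduceFinMk, Fin.reduceEq, if_true, if_false]
    rw [sum_ite_lt h₂]
    simp

lemma weight_wt_eq (m : Fin n ⊕ Fin n →₀ ℕ) : Finsupp.weight (wt n n₁ n₂) m =
    (((∑ i : {i // block n n₁ n₂ i = 1}, m i : ℕ) : ℤ) -
        (∑ i : {i // block n n₁ n₂ i = 0}, m i : ℕ),
      ((∑ i : {i // block n n₁ n₂ i = 3}, m i : ℕ) : ℤ) -
        (∑ i : {i // block n n₁ n₂ i = 2}, m i : ℕ)) := by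
  have hw : ∀ s : Fin n ⊕ Fin n, wt n n₁ n₂ s =
      (![(-1, 0), (1, 0), (0, -1), (0, 1)] : Fin 4 → ℤ × ℤ) (block n n₁ n₂ s) := by
    rintro (i | i) <;> simp only [wt, block] <;> split_ifs <;> rfl
  have h : Finsupp.weight (wt n n₁ n₂) m = ∑ b, (∑ i : {i // block n n₁ n₂ i = b}, m i) •
      (![(-1, 0), (1, 0), (0, -1), (0, 1)] : Fin 4 → ℤ × ℤ) b := by
    rw [Finsupp.weight_apply, Finsupp.sum_fintype _ _ fun i => zero_smul ℕ (wt n n₁ n₂ i),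
      ← Fintype.sum_fiberwise (block n n₁ n₂)]
    refine Finset.sum_congr rfl fun b _ => ?_
    rw [Finset.sum_smul]
    refine Finset.sum_congr rfl fun i _ => ?_
    rw [hw, i.2]
  rw [h, Fin.sum_univ_four]
  generalize (∑ i : {i // block n n₁ n₂ i = 0}, m i) = a0
  generalize (∑ i : {i // block n n₁ n₂ i = 1}, m i) = a1
  generalize (∑ i : {i // block n n₁ n₂ i = 2}, m i) = a2
  generalize (∑ i : {i // block n n₁ n₂ i = 3}, m i) = a3
  ext <;> simp <;> ring

lemma weight_one_eq (m : Fin n ⊕ Fin n →₀ ℕ) : Finsupp.weight 1 m =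
    (∑ i : {i // block n n₁ n₂ i = 0}, m i) + (∑ i : {i // block n n₁ n₂ i = 1}, m i) +
      (∑ i : {i // block n n₁ n₂ i = 2}, m i) + (∑ i : {i // block n n₁ n₂ i = 3}, m i) := by
  have h : Finsupp.weight 1 m = m.degree :=
    congrArg (fun f => f m) Finsupp.degree_eq_weight_one.symm
  rw [h, Finsupp.degree_eq_sum, ← Fintype.sum_fiberwise (block n n₁ n₂), Fin.sum_univ_four]

lemma forall_fin_four {P : Fin 4 → Prop} : (∀ b, P b) ↔ P 0 ∧ P 1 ∧ P 2 ∧ P 3 := by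
  simp [Fin.forall_fin_succ]

lemma finrank_formSpace (d : ℤ × ℤ) (e : ℕ) : Module.finrank F (formSpace F n n₁ n₂ d e) =
    Nat.card {m : Fin n ⊕ Fin n →₀ ℕ |
      Finsupp.weight (wt n n₁ n₂) m = d ∧ Finsupp.weight 1 m = e} := by
  have h : formSpace F n n₁ n₂ d e = restrictSupport F {m : Fin n ⊕ Fin n →₀ ℕ |
      Finsupp.weight (wt n n₁ n₂) m = d ∧ Finsupp.weight 1 m = e} := by
    ext f
    rw [mem_restrictSupport_iff]
    constructor
    · rintro ⟨h1, h2⟩ m hm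
      have hm' := mem_support_iff.mp hm
      exact ⟨h1 hm', h2 hm'⟩
    · intro hf
      exact ⟨fun m hm => (hf (mem_support_iff.mpr hm)).1,
        fun m hm => (hf (mem_support_iff.mpr hm)).2⟩
  rw [h, Module.finrank_eq_nat_card_basis (basisRestrictSupport F _)]

/-- In weight (0, 0) the two blocks of x-variables have equal degrees p.1 and the two blocks of
y-variables equal degrees p.2, so degree 2k means p.1 + p.2 = k. -/
lemma finrank_formSpace_zero (h₁ : n₁ ≤ n) (h₂ : n₂ ≤ n) (k : ℕ) :
    Module.finrank F (formSpace F n n₁ n₂ 0 (2 * k)) =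
      ∑ p ∈ Finset.HasAntidiagonal.antidiagonal k,
        (n₁.multichoose p.1 * (n - n₁).multichoose p.1) *
          ((n - n₂).multichoose p.2 * n₂.multichoose p.2) := by
  rw [finrank_formSpace, card_of_blockSum (block n n₁ n₂)
    (Finset.HasAntidiagonal.antidiagonal k) (fun p => ![p.1, p.1, p.2, p.2])]
  · refine Finset.sum_congr rfl fun p _ => ?_
    simp only [card_block h₁ h₂]
    simp [Fin.prod_univ_four, mul_assoc]
  · intro p q hpq
    exact Prod.ext (congrFun hpq 0) (congrFun hpq 2)
  · intro m
    rw [Set.mem_ofPred_eq, weight_wt_eq, weight_one_eq (n₁ := n₁) (n₂ := n₂), Prod.ext_iff]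
    simp only [forall_fin_four, Finset.HasAntidiagonal.mem_antidiagonal, Prod.exists]
    generalize (∑ i : {i // block n n₁ n₂ i = 0}, m i) = a0
    generalize (∑ i : {i // block n n₁ n₂ i = 1}, m i) = a1
    generalize (∑ i : {i // block n n₁ n₂ i = 2}, m i) = a2
    generalize (∑ i : {i // block n n₁ n₂ i = 3}, m i) = a3
    constructor
    · rintro ⟨⟨h1, h2⟩, h3⟩
      simp only [Prod.fst_zero, Prod.snd_zero] at h1 h2
      refine ⟨a0, a2, by omega, ?_⟩
      simp
      omega
    · rintro ⟨a, c, hac, h⟩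
      simp at h ⊢
      omega

lemma finrank_formSpace_neg_one (h₁ : n₁ ≤ n) (h₂ : n₂ ≤ n) (k : ℕ) :
    Module.finrank F (formSpace F n n₁ n₂ (-1, -1) (2 * (k + 1))) =
      ∑ p ∈ Finset.HasAntidiagonal.antidiagonal k,
        (n₁.multichoose (p.1 + 1) * (n - n₁).multichoose p.1) *
          ((n - n₂).multichoose (p.2 + 1) * n₂.multichoose p.2) := by
  -- The variables of degree -1 now exceed their partners by one in both x and y; the total degree
  -- is 2(p.1 + p.2) + 2.
  rw [finrank_formSpace, card_of_blockSum (block n n₁ n₂)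
    (Finset.HasAntidiagonal.antidiagonal k) (fun p => ![p.1 + 1, p.1, p.2 + 1, p.2])]
  · refine Finset.sum_congr rfl fun p _ => ?_
    simp only [card_block h₁ h₂]
    simp [Fin.prod_univ_four, mul_assoc]
  · intro p q hpq
    exact Prod.ext (congrFun hpq 1) (congrFun hpq 3)
  · intro m
    rw [Set.mem_ofPred_eq, weight_wt_eq, weight_one_eq (n₁ := n₁) (n₂ := n₂), Prod.ext_iff]
    simp only [forall_fin_four, Finset.HasAntidiagonal.mem_antidiagonal, Prod.exists]
    generalize (∑ i : {i // block n n₁ n₂ i = 0}, m i) = a0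
    generalize (∑ i : {i // block n n₁ n₂ i = 1}, m i) = a1
    generalize (∑ i : {i // block n n₁ n₂ i = 2}, m i) = a2
    generalize (∑ i : {i // block n n₁ n₂ i = 3}, m i) = a3
    constructor
    · rintro ⟨⟨h1, h2⟩, h3⟩
      refine ⟨a1, a3, by omega, ?_⟩
      simp
      omega
    · rintro ⟨a, c, hac, h⟩
      simp at h ⊢
      omega

lemma finrank_formSpace_neg_one_zero :
    Module.finrank F (formSpace F n n₁ n₂ (-1, -1) (2 * 0)) = 0 := by
  rw [finrank_formSpace, Nat.card_eq_zero]
  left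
  rw [Set.isEmpty_coe_sort, Set.eq_empty_iff_forall_notMem]
  rintro m ⟨h1, h2⟩
  rw [weight_wt_eq, Prod.mk.injEq] at h1
  rw [weight_one_eq (n₁ := n₁) (n₂ := n₂)] at h2
  omega

/-! ### Generating functions and the explicit numerators. -/

/-- The generating function of the pairs of monomials of the same degree in `p` and `q`
variables. -/
def pairSeries (p q : ℕ) : PowerSeries ℚ :=
  PowerSeries.mk fun a => ((p.multichoose a * q.multichoose a : ℕ) : ℚ)

/-- The generating function of the pairs of monomials of degrees `a + 1` and `a` in `p` and `q`
variables. -/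
def shiftSeries (p q : ℕ) : PowerSeries ℚ :=
  PowerSeries.mk fun a => ((p.multichoose (a + 1) * q.multichoose a : ℕ) : ℚ)

/-- The numerator of `pairSeries`. -/
def pairNum (p q : ℕ) : PowerSeries ℚ :=
  PowerSeries.mk fun r => ((Ring.choose ((p : ℤ) - 1) r * Ring.choose ((q : ℤ) - 1) r : ℤ) : ℚ)

/-- The numerator of `shiftSeries`. -/
def shiftNum (p q : ℕ) : PowerSeries ℚ :=
  PowerSeries.mk fun r => ((Ring.choose (p : ℤ) (r + 1) * Ring.choose ((q : ℤ) - 2) r : ℤ) : ℚ)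

lemma pairSeries_comm (p q : ℕ) : pairSeries p q = pairSeries q p := by
  simp only [pairSeries, mul_comm]

/-- Pascal's rule for multiset coefficients. Together with `shiftSeries_succ` it determines both
families, and the numerators satisfy the matching recursions `pairNum_succ` and `shiftNum_succ`. -/
lemma pairSeries_succ (p q : ℕ) :
    pairSeries (p + 1) q = pairSeries p q + PowerSeries.X * shiftSeries q (p + 1) := by
  ext a
  rw [map_add]
  cases a with
  | zero => simp [pairSeries]
  | succ a =>
    rw [PowerSeries.coeff_succ_X_mul]
    simp only [pairSeries, shiftSeries, PowerSeries.coeff_mk, Nat.multichoose_succ_succ]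
    push_cast
    ring

lemma shiftSeries_succ (p q : ℕ) :
    shiftSeries (p + 1) q = shiftSeries p q + pairSeries (p + 1) q := by
  ext a
  simp only [map_add, pairSeries, shiftSeries, PowerSeries.coeff_mk, Nat.multichoose_succ_succ]
  push_cast
  ring

lemma choose_natCast_add_one (p r : ℕ) : Ring.choose ((p : ℤ) + 1) (r + 1) =
    Ring.choose (p : ℤ) r + Ring.choose (p : ℤ) (r + 1) := Ring.choose_succ_succ _ _

lemma choose_pred (a : ℤ) (r : ℕ) : Ring.choose a (r + 1) =
    Ring.choose (a - 1) r + Ring.choose (a - 1) (r + 1) := by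
  rw [← Ring.choose_succ_succ, sub_add_cancel]

lemma pairNum_succ (p q : ℕ) :
    pairNum (p + 1) (q + 1) = pairNum p (q + 1) + PowerSeries.X * shiftNum q (p + 1) := by
  ext r
  rw [map_add]
  cases r with
  | zero => simp [pairNum]
  | succ r =>
    rw [PowerSeries.coeff_succ_X_mul]
    simp only [pairNum, shiftNum, PowerSeries.coeff_mk]
    push_cast
    rw [add_sub_cancel_right, add_sub_cancel_right, choose_pred p,
      show (p : ℤ) + 1 - 2 = p - 1 by ring]
    push_cast
    ring

lemma shiftNum_succ (p q : ℕ) : shiftNum (q + 1) (p + 1) =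
    (1 - PowerSeries.X) * shiftNum q (p + 1) + pairNum (q + 1) (p + 1) := by
  ext r
  rw [sub_mul, one_mul, map_add, map_sub]
  cases r with
  | zero =>
    simp only [pairNum, shiftNum, PowerSeries.coeff_mk, PowerSeries.coeff_zero_X_mul]
    simp [add_comm]
  | succ r =>
    rw [PowerSeries.coeff_succ_X_mul]
    simp only [pairNum, shiftNum, PowerSeries.coeff_mk]
    push_cast
    rw [add_sub_cancel_right, add_sub_cancel_right, choose_pred p, choose_pred ((q : ℤ) + 1),
      add_sub_cancel_right, show (p : ℤ) + 1 - 2 = p - 1 by ring]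
    push_cast
    ring

lemma pairSeries_zero (q : ℕ) : pairSeries 0 q = 1 := by
  ext a
  cases a <;> simp [pairSeries, PowerSeries.coeff_one]

lemma shiftSeries_zero (q : ℕ) : shiftSeries 0 q = 0 := by
  ext a
  simp [shiftSeries]

/-- The binomial theorem, since C(-1, r) = (-1)^r. -/
lemma pairNum_zero (q : ℕ) : pairNum 0 (q + 1) = (1 - PowerSeries.X) ^ q := by
  induction q with
  | zero =>
    ext r
    cases r with
    | zero => simp [pairNum]
    | succ r => simp [pairNum, PowerSeries.coeff_one, Ring.choose_zero_succ]
  | succ q ih =>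
    rw [pow_succ', ← ih]
    ext r
    rw [sub_mul, one_mul, map_sub]
    cases r with
    | zero => simp [pairNum]
    | succ r =>
      rw [PowerSeries.coeff_succ_X_mul]
      simp only [pairNum, PowerSeries.coeff_mk]
      have h := choose_pred 0 r
      rw [Ring.choose_zero_succ, zero_sub] at h
      push_cast
      rw [add_sub_cancel_right, add_sub_cancel_right, choose_natCast_add_one,
        show Ring.choose (-1 : ℤ) (r + 1) = - Ring.choose (-1 : ℤ) r by linarith]
      push_cast
      ring

/-- One half of a joint induction on q: the pair identity for q + 1 follows from the shift identity
for q by induction on p, and `shiftSeries_mul` then derives the shift identity for q + 1 from both.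
-/
lemma pairSeries_mul_of (q : ℕ)
    (h : ∀ p, shiftSeries q (p + 1) * (1 - PowerSeries.X) ^ (p + q) = shiftNum q (p + 1)) (p : ℕ) :
    pairSeries p (q + 1) * (1 - PowerSeries.X) ^ (p + q) = pairNum p (q + 1) := by
  induction p with
  | zero => rw [pairSeries_zero, one_mul, zero_add, pairNum_zero]
  | succ p ih =>
    -- The shift series in the recursion contains the pair series itself; moving it to the left
    -- produces the factor 1 - X, which raises the exponent of the denominator by one.
    have h1 : (1 - PowerSeries.X) * pairSeries (p + 1) (q + 1) =
        pairSeries p (q + 1) + PowerSeries.X * shiftSeries q (p + 1) := by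
      have h1 := pairSeries_succ p (q + 1)
      rw [shiftSeries_succ, pairSeries_comm (q + 1)] at h1
      linear_combination h1
    rw [pairNum_succ, ← ih, ← h, show p + 1 + q = p + q + 1 by ring, pow_succ]
    linear_combination (1 - PowerSeries.X) ^ (p + q) * h1

lemma shiftSeries_mul (q : ℕ) : ∀ p,
    shiftSeries q (p + 1) * (1 - PowerSeries.X) ^ (p + q) = shiftNum q (p + 1) := by
  induction q with
  | zero =>
    intro p
    rw [shiftSeries_zero, zero_mul]
    ext r
    simp [shiftNum, Ring.choose_zero_succ]
  | succ q ih =>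
    intro p
    have h1 := pairSeries_mul_of q ih (p + 1)
    have h2 : pairNum (p + 1) (q + 1) = pairNum (q + 1) (p + 1) := by
      simp only [pairNum, mul_comm]
    rw [shiftNum_succ, ← ih, ← h2, ← h1, shiftSeries_succ, pairSeries_comm (q + 1)]
    ring

lemma pairSeries_mul (p q : ℕ) :
    pairSeries p (q + 1) * (1 - PowerSeries.X) ^ (p + q) = pairNum p (q + 1) :=
  pairSeries_mul_of q (shiftSeries_mul q) p

lemma binom_natCast (a : ℤ) (r : ℕ) : binom a r = Ring.choose a r := by
  simp [binom]

/-- The first row of the determinant depends only on r and the second only on s, so summation turns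
both diagonal products into products of series. The lower index r - 1, with value 0 at r = 0,
accounts for the factor X. -/
lemma numSeries_eq (n n₁ n₂ : ℕ) (hn₁ : 1 ≤ n₁) (hn₁₂ : n₁ ≤ n₂) (hn₂ : n₂ ≤ n) :
    numSeries n n₁ n₂ = pairNum (n₂ - 1) (n - n₂) * pairNum n₁ (n - n₁) -
      (PowerSeries.X * shiftNum (n - n₂) n₂) * shiftNum (n₁ - 1) (n - n₁) := by
  have hx : PowerSeries.X * shiftNum (n - n₂) n₂ = PowerSeries.mk fun r =>
      ((binom ((n₂ : ℤ) - 2) ((r : ℤ) - 1) * binom ((n : ℤ) - n₂) r : ℤ) : ℚ) := by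
    ext r
    cases r with
    | zero => simp [binom]
    | succ r =>
      rw [PowerSeries.coeff_succ_X_mul, PowerSeries.coeff_mk, shiftNum, PowerSeries.coeff_mk,
        binom_natCast, Nat.cast_sub hn₂]
      push_cast
      rw [add_sub_cancel_right, binom_natCast, mul_comm]
  rw [hx]
  ext k
  rw [map_sub, PowerSeries.coeff_mul, PowerSeries.coeff_mul, ← Finset.sum_sub_distrib, numSeries,
    PowerSeries.coeff_mk]
  refine Finset.sum_congr rfl fun p _ => ?_
  have h1 : ((n₂ - 1 : ℕ) : ℤ) - 1 = n₂ - 2 := by omega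
  have h2 : ((n - n₂ : ℕ) : ℤ) = n - n₂ := by omega
  have h3 : ((n - n₁ : ℕ) : ℤ) = n - n₁ := by omega
  have h4 : ((n₁ - 1 : ℕ) : ℤ) = n₁ - 1 := by omega
  have h5 : binom ((n₁ : ℤ) - 1) ((p.2 : ℤ) + 1) = Ring.choose ((n₁ : ℤ) - 1) (p.2 + 1) := by
    rw [← binom_natCast]
    push_cast
    rfl
  simp only [pairNum, shiftNum, PowerSeries.coeff_mk, numDet, Matrix.det_fin_two_of, h1, h2, h3, h4,
    h5, binom_natCast]
  push_cast
  ring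

/-- The Hilbert series of the algebra generated by the symbols. -/
def symSeries (n n₁ n₂ : ℕ) : PowerSeries ℚ :=
  pairSeries n₁ (n - n₁) * pairSeries (n - n₂) n₂ -
    PowerSeries.X * (shiftSeries n₁ (n - n₁) * shiftSeries (n - n₂) n₂)

/-- Write P and S for the pair and shift series. Substituting P(n₂, n - n₂) = P(n₂ - 1, n - n₂) + t
S(n - n₂, n₂) and S(n₁, n - n₁) = S(n₁ - 1, n - n₁) + P(n₁, n - n₁) cancels a common product. Each
remaining term has denominator exponents n - 1 and n - 2, with sum 2n - 3. -/
lemma symSeries_mul (n n₁ n₂ : ℕ) (hn₁ : 1 ≤ n₁) (hn₁₂ : n₁ ≤ n₂) (hn₂ : n₂ < n) :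
    symSeries n n₁ n₂ * (1 - PowerSeries.X) ^ (2 * n - 3) = numSeries n n₁ n₂ := by
  rw [numSeries_eq n n₁ n₂ hn₁ hn₁₂ hn₂.le, symSeries]
  obtain ⟨c, rfl⟩ : ∃ c, n = n₂ + (c + 1) := ⟨n - n₂ - 1, by omega⟩
  obtain ⟨b, rfl⟩ : ∃ b, n₂ = n₁ + b := ⟨n₂ - n₁, by omega⟩
  obtain ⟨a, rfl⟩ : ∃ a, n₁ = a + 1 := ⟨n₁ - 1, by omega⟩
  have e1 : a + 1 + b + (c + 1) - (a + 1) = (b + c) + 1 := by omega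
  have e2 : a + 1 + b + (c + 1) - (a + 1 + b) = c + 1 := by omega
  have e3 : 2 * (a + 1 + b + (c + 1)) - 3 = ((a + b) + c) + ((a + 1) + (b + c)) := by omega
  have e4 : a + 1 + b = (a + b) + 1 := by omega
  rw [e1, e2, e3, e4, Nat.add_sub_cancel, Nat.add_sub_cancel, ← pairSeries_mul, ← pairSeries_mul,
    ← shiftSeries_mul, ← shiftSeries_mul, pairSeries_comm (c + 1),
    pairSeries_succ (a + b), shiftSeries_succ a]
  ring

/-- For n₂ = n the set J₃ is empty: its pair series is 1, its shift series is 0, and one pair series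
remains. -/
lemma symSeries_self_mul (n n₁ : ℕ) (hn₁ : n₁ < n) :
    symSeries n n₁ n * (1 - PowerSeries.X) ^ (n - 1) = numSeries' n n₁ := by
  obtain ⟨c, rfl⟩ : ∃ c, n = n₁ + (c + 1) := ⟨n - n₁ - 1, by omega⟩
  rw [symSeries, Nat.sub_self, pairSeries_zero, shiftSeries_zero, mul_zero, mul_zero, sub_zero,
    mul_one, Nat.add_sub_cancel_left, ← add_assoc, Nat.add_sub_cancel, pairSeries_mul]
  ext r
  simp only [pairNum, numSeries', PowerSeries.coeff_mk, binom_natCast]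
  push_cast
  rw [mul_comm]
  congr 3
  ring

variable {F : Type*} [Field F] {n n₁ n₂ : ℕ}

lemma finrank_range_matSym_pow_eq [CharZero F] (h : n₁ ≤ n₂) (h₂ : n₂ ≤ n) :
    (PowerSeries.mk fun k => (Module.finrank F ↥(LinearMap.range (matSym F n n₁ n₂) ^ k) : ℚ)) =
      symSeries n n₁ n₂ := by
  ext k
  rw [PowerSeries.coeff_mk, symSeries, map_sub, PowerSeries.coeff_mul]
  have h0 := finrank_range_matSym_pow (F := F) (n := n) h k
  rw [finrank_formSpace_zero (h.trans h₂) h₂] at h0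
  rw [eq_sub_iff_add_eq]
  have h1 : ∑ p ∈ Finset.HasAntidiagonal.antidiagonal k,
      PowerSeries.coeff p.1 (pairSeries n₁ (n - n₁)) *
        PowerSeries.coeff p.2 (pairSeries (n - n₂) n₂) =
      ((∑ p ∈ Finset.HasAntidiagonal.antidiagonal k,
        (n₁.multichoose p.1 * (n - n₁).multichoose p.1) *
          ((n - n₂).multichoose p.2 * n₂.multichoose p.2) : ℕ) : ℚ) := by
    simp [pairSeries]
  rw [h1, h0, Nat.cast_add, add_comm]
  congr 1
  cases k with
  | zero => rw [finrank_formSpace_neg_one_zero]; simp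
  | succ k =>
    rw [PowerSeries.coeff_succ_X_mul, PowerSeries.coeff_mul,
      finrank_formSpace_neg_one (h.trans h₂) h₂]
    simp [shiftSeries]

lemma varHilbertSeries_harmonic [CharZero F] (h : n₁ ≤ n₂) (h₂ : n₂ ≤ n) {ℓ₁ ℓ₂ : ℤ}
    {M₀ : Submodule F (harmonic F n n₁ n₂ ℓ₁ ℓ₂)} [FiniteDimensional F M₀] (hM₀ : M₀ ≠ ⊥)
    (hgen : AssocVar.Generates F (LieAlgebra.SpecialLinear.sl (Fin n) F) M₀) :
    AssocVar.varHilbertSeries (L := LieAlgebra.SpecialLinear.sl (Fin n) F) M₀ =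
      symSeries n n₁ n₂ := by
  rw [AssocVar.varHilbertSeries, radical_annGr_harmonic h hM₀ hgen,
    AssocVar.finrank_quotHilbertSeries, finrank_range_matSym_pow_eq h h₂]

end Osc

end

theorem theorem1 {F : Type*} [Field F] [CharZero F] (n n₁ n₂ : ℕ) (hn : 1 < n)
    (hn₁ : 1 ≤ n₁) (hn₁₂ : n₁ ≤ n₂) (hn₂ : n₂ ≤ n) (ℓ₁ ℓ₂ : ℤ)
    (hirr : LieModule.IsIrreducible F (LieAlgebra.SpecialLinear.sl (Fin n) F)
      (Osc.harmonic F n n₁ n₂ ℓ₁ ℓ₂))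
    (M₀ : Submodule F (Osc.harmonic F n n₁ n₂ ℓ₁ ℓ₂)) (hfin : FiniteDimensional F M₀)
    (hgen : AssocVar.Generates F (LieAlgebra.SpecialLinear.sl (Fin n) F) M₀) :
    (n₂ < n → ℓ₁ ≤ 0 ∨ ℓ₂ ≤ 0 →
      AssocVar.varHilbertSeries (L := LieAlgebra.SpecialLinear.sl (Fin n) F) M₀ =
        Osc.numSeries n n₁ n₂ * ((1 - PowerSeries.X) ^ (2 * n - 3))⁻¹) ∧
    (n₁ < n₂ → n₂ = n →
      AssocVar.varHilbertSeries (L := LieAlgebra.SpecialLinear.sl (Fin n) F) M₀ =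
        Osc.numSeries' n n₁ * ((1 - PowerSeries.X) ^ (n - 1))⁻¹) := by
  -- An irreducible module is nonzero, and the zero subspace generates only zero.
  have hM₀ : M₀ ≠ ⊥ := by
    rintro rfl
    have hnt : Nontrivial (LieSubmodule F (LieAlgebra.SpecialLinear.sl (Fin n) F)
      (Osc.harmonic F n n₁ n₂ ℓ₁ ℓ₂)) := hirr.toNontrivial
    rw [LieSubmodule.nontrivial_iff] at hnt
    rw [AssocVar.Generates, AssocVar.envSpan, Submodule.map₂_bot_right] at hgen
    exact bot_ne_top hgen
  have hconst : ∀ k : ℕ,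
      PowerSeries.constantCoeff ((1 - PowerSeries.X : PowerSeries ℚ) ^ k) ≠ 0 := by
    intro k
    simp
  rw [Osc.varHilbertSeries_harmonic hn₁₂ hn₂ hM₀ hgen]
  refine ⟨fun h _ => ?_, fun h h' => ?_⟩
  · rw [PowerSeries.eq_mul_inv_iff_mul_eq (hconst _), Osc.symSeries_mul n n₁ n₂ hn₁ hn₁₂ h]
  · subst h'
    rw [PowerSeries.eq_mul_inv_iff_mul_eq (hconst _), Osc.symSeries_self_mul _ _ h]
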